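/- Let $\mathsf C$ be a symmetric monoidal category with tensor product $\otimes$, unit object $K$ and symmetry $c$ (written as if strict; $X\otimes f$ and $f\otimes X$ denote $id_X\otimes f$ and $f\otimes id_X$). Let $H=(H,\eta_H,\mu_H,\varepsilon_H,\delta_H,\lambda_H)$ be a finite Hopf algebra in $\mathsf C$ (unit, product, counit, coproduct, antipode), i.e. there are an object $H^*$ and morphisms $a\colon K\to H^*\otimes H$, $b\colon H\otimes H^*\to K$ satisfying the triangle identities $(b\otimes H)\circ(H\otimes a)=id_H$ and $(H^*\otimes b)\circ(a\otimes H^*)=id_{H^*}$. Then $\lambda_H$ is an isomorphism, and the following holds. Put $$R=\mu_H\circ c_{H,H}\circ(\mu_H\otimes\lambda_H^{-1})\circ(H\otimes\delta_H)\colon H\otimes H\to H,$$ $$\overline R=(H\otimes(\mu_H\circ(\lambda_H^{-1}\otimes H)))\circ(\delta_H\otimes H)\circ c_{H,H}\circ\delta_H\colon H\to H\otimes H,$$ $$S=(\mu_H\otimes H)\circ(\lambda_H\otimes\overline R)\circ\delta_H\colon H\to H\otimes H.$$ Let $\widehat H=(H^{cop})^*$ be the Hopf algebra on $H^*$ with $$\eta_{\widehat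 H}=(H^*\otimes\varepsilon_H)\circ a,\qquad \varepsilon_{\widehat H}=b\circ(\eta_H\otimes H^*),$$ $$\mu_{\widehat H}=(H^*\otimes b)\circ(H^*\otimes H\otimes b\otimes H^*)\circ(((H^*\otimes(c_{H,H}\circ\delta_H))\circ a)\otimes H^*\otimes H^*),$$ $$\delta_{\widehat H}=(H^*\otimes H^*\otimes(b\circ(\mu_H\otimes H^*)))\circ(((H^*\otimes a\otimes H)\circ a)\otimes H^*),$$ $$\lambda_{\widehat H}=(H^*\otimes b)\circ(H^*\otimes\lambda_H^{-1}\otimes H^*)\circ(a\otimes H^*).$$ Let $T(H)=\widehat H\otimes H$ be the tensor product Hopf algebra, and let $D(H)=\widehat H\bowtie H$ be the Drinfeld double: it has the unit, counit and coproduct of $T(H)$, the product $(\mu_{\widehat H}\otimes\mu_H)\circ(H^*\otimes\Psi\otimes H)$ and the antipode $\Psi\circ(\lambda_H\otimes\lambda_{\widehat H})\circ c_{H^*,H}$, where $$\Psi=(\varphi\otimes\phi)\circ(H\otimes c_{H,H^*}\otimes H^*)\circ(\delta_H\otimes\delta_{\widehat H}),$$ $$\varphi=(H^*\otimes b)\circ(H^*\otimes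 R\otimes H^*)\circ(a\otimes H\otimes H^*),\qquad \phi=(H\otimes b)\circ(\overline R\otimes H^*).$$ A pair $(X_1,X_2)$ of Hopf algebras on the same object $X$ with the same coalgebra structure $(\varepsilon,\delta)$, products $\mu^1,\mu^2$ and antipodes $\lambda^1,\lambda^2$ is a Hopf brace if $$\mu^2\circ(X\otimes\mu^1)=\mu^1\circ(\mu^2\otimes\Gamma)\circ(X\otimes c_{X,X}\otimes X)\circ(\delta\otimes X\otimes X),\qquad \Gamma=\mu^1\circ(\lambda^1\otimes\mu^2)\circ(\delta\otimes X).$$ **Statement.** Suppose that $$(R\otimes H)\circ(H\otimes(c_{H,H}\circ\delta_H))=(R\otimes H)\circ(H\otimes\delta_H).$$ Then $(T(H),D(H))$ is a Hopf brace in $\mathsf C$ if and only if $R\colon H\otimes H\to H$ is a coalgebra morphism (for the tensor product coalgebra structure on $H\otimes H$) and $$(\mu_H\otimes H\otimes H)\circ(H\otimes c_{H,H}\otimes H)\circ(\overline R\otimes((\mu_H\otimes H)\circ(H\otimes S)\circ c_{H,H}))\circ(\delta_H\otimes H)=(\mu_H\otimes\delta_H)\circ(H\otimes c_{H,H})\circ(\overline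 R\otimes H).$$ -/

import Mathlib

open CategoryTheory MonoidalCategory MonObj ComonObj HopfObj

universe v u

namespace DrinfeldBrace

section General

variable {C : Type u} [Category.{v} C] [MonoidalCategory C]

/-- The five structure morphisms `(η, μ, ε, δ, λ)` of a candidate Hopf algebra on the object `X`
(unit, product, counit, coproduct, antipode). The axioms are the predicate
`HopfData.IsHopfAlgebra` below. -/
structure HopfData (X : C) where
  /-- the unit `η` -/
  one : 𝟙_ C ⟶ X
  /-- the product `μ` -/
  mul : X ⊗ X ⟶ X
  /-- the counit `ε` -/
  counit : X ⟶ 𝟙_ C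
  /-- the coproduct `δ` -/
  comul : X ⟶ X ⊗ X
  /-- the antipode `λ` -/
  antipode : X ⟶ X

variable [BraidedCategory C]

/-- The structure morphisms of a Hopf algebra of Mathlib. -/
def HopfData.ofHopfObj (X : C) [HopfObj X] : HopfData X where
  one := η[X]
  mul := μ[X]
  counit := ε[X]
  comul := Δ[X]
  antipode := 𝒮[X]

/-- The tuple `(X, η, μ, ε, δ, λ)` is a Hopf algebra in `C`: its entries are the structure
morphisms of a Hopf algebra structure (in the sense of Mathlib) on `X`. -/
def HopfData.IsHopfAlgebra {X : C} (D : HopfData X) : Prop :=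
  ∃ h : HopfObj X, @HopfData.ofHopfObj C _ _ _ X h = D

/-- The morphism `Γ = μ¹ ∘ (λ¹ ⊗ μ²) ∘ (δ ⊗ X)`. -/
def gam {X : C} (H₁ H₂ : HopfData X) : X ⊗ X ⟶ X :=
  H₁.comul ▷ X ⊗≫ (H₁.antipode ⊗ₘ H₂.mul) ≫ H₁.mul

/-- `(H₁, H₂)` is a Hopf brace: two Hopf algebras with the same underlying coalgebra such that
`μ² ∘ (X ⊗ μ¹) = μ¹ ∘ (μ² ⊗ Γ) ∘ (X ⊗ c ⊗ X) ∘ (δ ⊗ X ⊗ X)`. -/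
structure IsHopfBrace {X : C} (H₁ H₂ : HopfData X) : Prop where
  counit_eq : H₁.counit = H₂.counit
  comul_eq : H₁.comul = H₂.comul
  isHopfAlgebra_left : H₁.IsHopfAlgebra
  isHopfAlgebra_right : H₂.IsHopfAlgebra
  compat : X ◁ H₁.mul ≫ H₂.mul =
    H₁.comul ▷ (X ⊗ X) ≫ tensorμ X X X X ≫ (H₂.mul ⊗ₘ gam H₁ H₂) ≫ H₁.mul

/-- The tensor product `A ⊗ B` of Hopf algebras. -/
def HopfData.tensor {X Y : C} (A : HopfData X) (B : HopfData Y) : HopfData (X ⊗ Y) where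
  one := (λ_ (𝟙_ C)).inv ≫ (A.one ⊗ₘ B.one)
  mul := tensorμ X Y X Y ≫ (A.mul ⊗ₘ B.mul)
  counit := (A.counit ⊗ₘ B.counit) ≫ (λ_ (𝟙_ C)).hom
  comul := (A.comul ⊗ₘ B.comul) ≫ tensorμ X X Y Y
  antipode := A.antipode ⊗ₘ B.antipode

/-- The morphism `Ψ = (φ ⊗ ψ) ∘ (Y ⊗ c ⊗ X) ∘ (δ ⊗ δ)` attached to a left action `φ` of `B` (on
`Y`) on `A` (on `X`) and a right action `ψ` of `A` on `B`. -/
def exchange {X Y : C} (A : HopfData X) (B : HopfData Y) (φ : Y ⊗ X ⟶ X) (ψ : Y ⊗ X ⟶ Y) :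
    Y ⊗ X ⟶ X ⊗ Y :=
  (B.comul ⊗ₘ A.comul) ≫ tensorμ Y Y X X ≫ (φ ⊗ₘ ψ)

/-- The bicrossed product `A ⋈ B` with respect to actions `φ` and `ψ`: the unit, counit and
coproduct of `A ⊗ B`, the product `(μ ⊗ μ) ∘ (X ⊗ Ψ ⊗ Y)` and the antipode `Ψ ∘ (λ ⊗ λ) ∘ c`. -/
def HopfData.bicrossed {X Y : C} (A : HopfData X) (B : HopfData Y)
    (φ : Y ⊗ X ⟶ X) (ψ : Y ⊗ X ⟶ Y) : HopfData (X ⊗ Y) where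
  one := (A.tensor B).one
  mul := 𝟙 ((X ⊗ Y) ⊗ (X ⊗ Y)) ⊗≫ X ◁ exchange A B φ ψ ▷ Y ⊗≫ (A.mul ⊗ₘ B.mul)
  counit := (A.tensor B).counit
  comul := (A.tensor B).comul
  antipode := (β_ X Y).hom ≫ (B.antipode ⊗ₘ A.antipode) ≫ exchange A B φ ψ

end General

section Double

variable {C : Type u} [Category.{v} C] [MonoidalCategory C] [SymmetricCategory C]
variable (H : C) [HopfObj H] [IsIso 𝒮[H]]

/-- `R = μ ∘ c ∘ (μ ⊗ λ⁻¹) ∘ (H ⊗ δ)`; on elements, `R (x ⊗ h) = λ⁻¹(h₂) x h₁`. -/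
noncomputable def R : H ⊗ H ⟶ H :=
  H ◁ Δ[H] ⊗≫ (μ[H] ⊗ₘ inv 𝒮[H]) ≫ (β_ H H).hom ≫ μ[H]

/-- `R̄ = (H ⊗ (μ ∘ (λ⁻¹ ⊗ H))) ∘ (δ ⊗ H) ∘ c ∘ δ`; on elements, `R̄ h = h₂ ⊗ λ⁻¹(h₃) h₁`. -/
noncomputable def Rbar : H ⟶ H ⊗ H :=
  Δ[H] ≫ (β_ H H).hom ≫ Δ[H] ▷ H ⊗≫ H ◁ (inv 𝒮[H] ▷ H ≫ μ[H])

/-- `S = (μ ⊗ H) ∘ (λ ⊗ R̄) ∘ δ`. -/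
noncomputable def S : H ⟶ H ⊗ H :=
  Δ[H] ≫ (𝒮[H] ⊗ₘ Rbar H) ⊗≫ μ[H] ▷ H

/-- The cocommutativity class condition
`(R ⊗ H) ∘ (H ⊗ (c ∘ δ)) = (R ⊗ H) ∘ (H ⊗ δ)`. -/
def CocommClass : Prop :=
  H ◁ (Δ[H] ≫ (β_ H H).hom) ⊗≫ R H ▷ H = H ◁ Δ[H] ⊗≫ R H ▷ H

/-- The identity
`(μ ⊗ H ⊗ H) ∘ (H ⊗ c ⊗ H) ∘ (R̄ ⊗ ((μ ⊗ H) ∘ (H ⊗ S) ∘ c)) ∘ (δ ⊗ H)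
  = (μ ⊗ δ) ∘ (H ⊗ c) ∘ (R̄ ⊗ H)`. -/
def RbarIdentity : Prop :=
  Δ[H] ▷ H ⊗≫ (Rbar H ⊗ₘ ((β_ H H).hom ≫ H ◁ S H ⊗≫ μ[H] ▷ H)) ⊗≫
      H ◁ (β_ H H).hom ▷ H ⊗≫ μ[H] ▷ (H ⊗ H) =
    Rbar H ▷ H ⊗≫ H ◁ (β_ H H).hom ⊗≫ (μ[H] ⊗ₘ Δ[H])

/- `Hd` is a dual `H*` of `H`: the pairing consists of the unit `η_ Hd H : 𝟙_ C ⟶ Hd ⊗ H` and the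
counit `ε_ Hd H : H ⊗ Hd ⟶ 𝟙_ C` of the adjunction between `H ⊗ -` and `Hd ⊗ -`. -/
variable (Hd : C) [ExactPairing Hd H]

/-- The Hopf algebra `Ĥ = (H^cop)*` on `Hd`. For vector spaces, its product is the convolution
product and its coproduct is determined by `f₁(x) f₂(y) = f (y x)`. -/
noncomputable def dualCop : HopfData Hd where
  one := η_ Hd H ≫ Hd ◁ ε[H] ≫ (ρ_ Hd).hom
  mul := 𝟙 (Hd ⊗ Hd) ⊗≫ (η_ Hd H ≫ Hd ◁ (Δ[H] ≫ (β_ H H).hom)) ▷ (Hd ⊗ Hd) ⊗≫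
    (Hd ⊗ H) ◁ (ε_ Hd H ▷ Hd) ⊗≫ Hd ◁ ε_ Hd H ≫ (ρ_ Hd).hom
  counit := (λ_ Hd).inv ≫ η[H] ▷ Hd ≫ ε_ Hd H
  comul := (λ_ Hd).inv ≫ (η_ Hd H ⊗≫ Hd ◁ (η_ Hd H ▷ H)) ▷ Hd ⊗≫
    (Hd ⊗ Hd) ◁ (μ[H] ▷ Hd ≫ ε_ Hd H) ≫ (ρ_ (Hd ⊗ Hd)).hom
  antipode := (λ_ Hd).inv ≫ η_ Hd H ▷ Hd ⊗≫ Hd ◁ (inv 𝒮[H] ▷ Hd) ≫ Hd ◁ ε_ Hd H ≫ (ρ_ Hd).hom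

/-- The left action of `H` on `Ĥ`,
`(H* ⊗ b) ∘ (H* ⊗ R ⊗ H*) ∘ (a ⊗ H ⊗ H*)`. -/
noncomputable def leftAction : H ⊗ Hd ⟶ Hd :=
  (λ_ (H ⊗ Hd)).inv ≫ η_ Hd H ▷ (H ⊗ Hd) ⊗≫ Hd ◁ (R H ▷ Hd) ≫ Hd ◁ ε_ Hd H ≫ (ρ_ Hd).hom

/-- The right action of `Ĥ` on `H`, `(H ⊗ b) ∘ (R̄ ⊗ H*)`. -/
noncomputable def rightAction : H ⊗ Hd ⟶ H :=
  Rbar H ▷ Hd ⊗≫ H ◁ ε_ Hd H ≫ (ρ_ H).hom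

/-- `T(H) = Ĥ ⊗ H`. -/
noncomputable def T : HopfData (Hd ⊗ H) :=
  (dualCop H Hd).tensor (HopfData.ofHopfObj H)

/-- The Drinfeld double `D(H) = Ĥ ⋈ H`. -/
noncomputable def D : HopfData (Hd ⊗ H) :=
  (dualCop H Hd).bicrossed (HopfData.ofHopfObj H) (leftAction H Hd) (rightAction H Hd)

end Double

end DrinfeldBrace

/-! In Sweedler notation, with S the antipode of H, the two actions in the exchange Ψ of the double
recombine: a factor h₃S⁻¹(h₂) cancels between them and leaves h ⊗ f ↦ f(S⁻¹(h₃) - h₁) ⊗ h₂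
(`eval_doubleExchangeE`). With this form, T(H) and D(H) are seen to be Hopf algebras without any
further condition. They share their coalgebra, so only the compatibility of the two products is in
question.

In that compatibility the functional in the first argument and the H-component of the third are
spectators. Replacing them by units, and pairing the remaining functionals with dual bases, gives an
equivalent identity in H alone (`compat_iff_star`): Δ(S⁻¹(h₃)xh₁) ⊗ h₂k = S⁻¹(h₃)x₁h₁ ⊗ S⁻¹(h₇)x₂h₅
⊗ h₂kS(h₄)h₆. At x = 1 it becomes `RbarIdentity`; at k = 1, with the counit on the last leg, it says
that R is comultiplicative. Conversely, S⁻¹(h₃)xh₁ ⊗ h₂ is assembled from R(x ⊗ h₁) and R̄(h₂), so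
these two conditions expand the left side. The class condition then reorders the letters so that the
surplus ones cancel (`star_of_rbar`). This converse is the only use of the class condition.

Bijectivity of S comes from an endomorphism π of H, defined as a partial trace. It is idempotent,
its values are right integrals, x₁ ⊗ π(x₂) = 1 ⊗ π(x), and the trace of π ∘ S is 1. It plays the
role of x ↦ λ(x)t for integrals t in H and λ on H, and the classical formula h ↦ λ(t₂h)t₁, rewritten
as a trace, inverts S (`isIso_antipode`). No object of integrals has to be split off.

The identities themselves are proved by computation with string diagrams. A formal morphism is
compiled to a program, a list of operations on named wires; the names determine all permutations of
tensor factors. The meaning of a program does not depend on the names (`den_rename`) nor on the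
order of execution (`den_reorder`), so a law may replace any matching part of a program
(`applyAt_sound`). Rewriting with the Hopf laws moves coproducts before antipodes and antipodes
before products, and cancels antipodes; equality of the results, up to names and order, proves
equality of morphisms (`eval_eq_of_check`). Places found by search are checked before use, so the
search needs no correctness proof. -/

namespace WireDiagram

/-! ### Permutations of tensor factors, indexed by lists of named wires -/

section

/-- The type of the wire named `n`: its parity. -/
def wireType (n : ℕ) : Bool := n % 2 == 1

section Monoidal

variable {C : Type u} [Category.{v} C] [MonoidalCategory C] (X : Bool → C)

/-- The right-nested tensor product of the types of a list of wires. -/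
@[reducible] def obj : List ℕ → C
  | [] => 𝟙_ C
  | a :: l => X (wireType a) ⊗ obj l

lemma obj_congr : ∀ {l m : List ℕ}, l.map wireType = m.map wireType → obj X l = obj X m
  | [], [], _ => rfl
  | a :: l, b :: m, h => by
    simp only [List.map_cons, List.cons.injEq] at h
    rw [obj, obj, h.1, obj_congr h.2]

lemma eqToHom_tensorHom_eqToHom {A A' B B' : C} (p : A = A') (q : B = B') :
    eqToHom p ⊗ₘ eqToHom q = eqToHom (by rw [p, q]) := by
  subst p q; simp

lemma whiskerLeft_transport {A A' Y Y' Z Z' : C} (p : A = A') (q : Y = Y') (r : Z' = Z)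
    (f : Y' ⟶ Z') (e₁ e₂) :
    A ◁ (eqToHom q ≫ f ≫ eqToHom r) = eqToHom e₁ ≫ A' ◁ f ≫ eqToHom e₂ := by
  subst p q r; simp

/-- Concatenation of lists of wires. -/
def app : ∀ l r : List ℕ, obj X l ⊗ obj X r ≅ obj X (l ++ r)
  | [], _ => λ_ _
  | a :: l, r => α_ _ _ _ ≪≫ whiskerLeftIso (X (wireType a)) (app l r)

lemma app_nil (r : List ℕ) : (app X [] r).hom = (λ_ (obj X r)).hom := rfl

lemma app_cons (a : ℕ) (l r : List ℕ) :
    (app X (a :: l) r).hom =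
      (α_ (X (wireType a)) (obj X l) (obj X r)).hom ≫ X (wireType a) ◁ (app X l r).hom := rfl

lemma app_nil_right (l : List ℕ) :
    (app X l []).hom = (ρ_ (obj X l)).hom ≫ eqToHom (by simp) := by
  induction l with
  | nil => simp [app_nil, unitors_equal]
  | cons a l ih =>
    rw [app_cons, ih, whiskerLeft_comp, whiskerLeft_eqToHom, ← Category.assoc,
      ← rightUnitor_tensor_hom]

lemma obj_append_congr {l l' r r' : List ℕ} (h : l.map wireType = l'.map wireType)
    (k : r.map wireType = r'.map wireType) : obj X (l ++ r) = obj X (l' ++ r') :=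
  obj_congr X (by simp [h, k])

lemma assoc_eqToHom {A A' B B' D D' : C} (p : A = A') (q : B = B') (r : D = D') :
    ((eqToHom p ⊗ₘ eqToHom q) ⊗ₘ eqToHom r) ≫ (α_ A' B' D').hom =
      (α_ A B D).hom ≫ (eqToHom p ⊗ₘ (eqToHom q ⊗ₘ eqToHom r)) := by
  subst p q r; simp

lemma app_eqToHom : ∀ {l l' r r' : List ℕ} (h : l.map wireType = l'.map wireType)
    (k : r.map wireType = r'.map wireType),
    (eqToHom (obj_congr X h) ⊗ₘ eqToHom (obj_congr X k)) ≫ (app X l' r').hom =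
      (app X l r).hom ≫ eqToHom (obj_append_congr X h k)
  | [], [], r, r', _, k => by
    have e : ∀ {A A' : C} (p : A = A'), (𝟙 (𝟙_ C) ⊗ₘ eqToHom p) ≫ (λ_ A').hom =
      (λ_ A).hom ≫ eqToHom p := by
      intro A A' p; subst p; simp
    exact e (obj_congr X k)
  | a :: l, b :: l', r, r', h, k => by
    have h' : wireType a = wireType b ∧ l.map wireType = l'.map wireType := by simpa using h
    have e1 : eqToHom (obj_congr X h) =
        eqToHom (congrArg X h'.1) ⊗ₘ eqToHom (obj_congr X h'.2) := by
      rw [eqToHom_tensorHom_eqToHom]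
    have e2 : eqToHom (obj_append_congr X h k) =
        eqToHom (congrArg X h'.1) ⊗ₘ eqToHom (obj_append_congr X h'.2 k) := by
      rw [eqToHom_tensorHom_eqToHom]
    rw [e1, e2, app_cons, app_cons, reassoc_of% (assoc_eqToHom (congrArg X h'.1)), Category.assoc,
      ← id_tensorHom, ← id_tensorHom, tensorHom_comp_tensorHom, tensorHom_comp_tensorHom,
      app_eqToHom h'.2 k, Category.comp_id, Category.id_comp]

lemma app_assoc (l m r : List ℕ) :
    (app X l m).hom ▷ obj X r ≫ (app X (l ++ m) r).hom =
      (α_ _ _ _).hom ≫ obj X l ◁ (app X m r).hom ≫ (app X l (m ++ r)).hom ≫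
        eqToHom (by simp) := by
  induction l with
  | nil => simp [app_nil]
  | cons a l ih =>
    have e : eqToHom (by simp : obj X ((a :: l) ++ (m ++ r)) = obj X (((a :: l) ++ m) ++ r)) =
      X (wireType a) ◁ eqToHom (by simp : obj X (l ++ (m ++ r)) = obj X ((l ++ m) ++ r)) := by
      simp
    rw [e]
    change (((α_ (X (wireType a)) (obj X l) (obj X m)).hom ≫ X (wireType a) ◁ (app X l m).hom) ▷
      obj X r) ≫ (α_ (X (wireType a)) (obj X (l ++ m)) (obj X r)).hom ≫
        X (wireType a) ◁ (app X (l ++ m) r).hom =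
      (α_ (X (wireType a) ⊗ obj X l) (obj X m) (obj X r)).hom ≫
        (X (wireType a) ⊗ obj X l) ◁ (app X m r).hom ≫
        ((α_ (X (wireType a)) (obj X l) (obj X (m ++ r))).hom ≫
          X (wireType a) ◁ (app X l (m ++ r)).hom) ≫ _
    rw [comp_whiskerRight, Category.assoc, associator_naturality_middle_assoc, ← whiskerLeft_comp,
      ih]
    simp

end Monoidal

section Symmetric

variable {C : Type u} [Category.{v} C] [MonoidalCategory C] [SymmetricCategory C] (X : Bool → C)

/-- Exchange of the first two factors. -/
def swp (A B Y : C) : A ⊗ (B ⊗ Y) ⟶ B ⊗ (A ⊗ Y) :=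
  (α_ A B Y).inv ≫ (β_ A B).hom ▷ Y ≫ (α_ B A Y).hom

@[simp]
lemma swp_swp (A B Y : C) : swp A B Y ≫ swp B A Y = 𝟙 _ := by
  simp [swp, ← comp_whiskerRight_assoc]

@[simp]
lemma swp_swp_assoc (A B Y : C) {W : C} (k : A ⊗ (B ⊗ Y) ⟶ W) :
    swp A B Y ≫ swp B A Y ≫ k = k := by
  rw [← Category.assoc, swp_swp, Category.id_comp]

instance (A B Y : C) : IsIso (swp A B Y) := by
  unfold swp; infer_instance

lemma swp_naturality (A B : C) {Y Z : C} (f : Y ⟶ Z) :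
    A ◁ B ◁ f ≫ swp A B Z = swp A B Y ≫ B ◁ A ◁ f := by
  simp only [swp, Category.assoc, associator_inv_naturality_right_assoc, whisker_exchange_assoc,
    associator_naturality_right]

lemma swp_naturality_assoc (A B : C) {Y Z W : C} (f : Y ⟶ Z) (k : B ⊗ (A ⊗ Z) ⟶ W) :
    A ◁ B ◁ f ≫ swp A B Z ≫ k = swp A B Y ≫ B ◁ A ◁ f ≫ k := by
  rw [← Category.assoc, swp_naturality, Category.assoc]

lemma swp_whiskerRight (A B Y Z : C) :
    swp A B Y ▷ Z ≫ (α_ B (A ⊗ Y) Z).hom ≫ B ◁ (α_ A Y Z).hom =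
      (α_ A (B ⊗ Y) Z).hom ≫ A ◁ (α_ B Y Z).hom ≫ swp A B (Y ⊗ Z) := by
  simp only [swp]; monoidal

/-- The Yang–Baxter equation in the presence of a further factor. -/
lemma swp_braid (A B D Y : C) :
    A ◁ swp B D Y ≫ swp A D (B ⊗ Y) ≫ D ◁ swp A B Y =
      swp A B (D ⊗ Y) ≫ B ◁ swp A D Y ≫ swp B D (A ⊗ Y) := by
  have h := congrArg (fun f => (α_ A B (D ⊗ Y)).inv ≫ (α_ (A ⊗ B) D Y).inv ≫ (α_ A B D).hom ▷ Y ≫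
    f ▷ Y ≫ (α_ D (B ⊗ A) Y).hom ≫ D ◁ (α_ B A Y).hom)
    (BraidedCategory.yang_baxter A B D)
  refine Eq.trans ?_ (h.symm.trans ?_)
  all_goals
    simp only [swp]
    monoidal

lemma swp_braid_assoc (A B D Y : C) {W : C} (k : D ⊗ (B ⊗ (A ⊗ Y)) ⟶ W) :
    A ◁ swp B D Y ≫ swp A D (B ⊗ Y) ≫ D ◁ swp A B Y ≫ k =
      swp A B (D ⊗ Y) ≫ B ◁ swp A D Y ≫ swp B D (A ⊗ Y) ≫ k := by
  simpa only [Category.assoc] using congrArg (· ≫ k) (swp_braid A B D Y)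

/-- Insertion of a wire into a sorted list of wires. -/
def insertHom (a : ℕ) : ∀ s : List ℕ,
    X (wireType a) ⊗ obj X s ⟶ obj X (s.orderedInsert (· ≤ ·) a)
  | [] => eqToHom (by rw [List.orderedInsert_nil])
  | b :: s =>
    if h : a ≤ b then eqToHom (by rw [List.orderedInsert_cons_of_le _ s h])
    else swp (X (wireType a)) (X (wireType b)) (obj X s) ≫ X (wireType b) ◁ insertHom a s ≫
      eqToHom (by rw [List.orderedInsert_of_not_le _ s h])

lemma insertHom_nil (a : ℕ) : insertHom X a [] = eqToHom (by rw [List.orderedInsert_nil]) := rfl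

lemma insertHom_cons_of_le {a b : ℕ} (s : List ℕ) (h : a ≤ b) :
    insertHom X a (b :: s) = eqToHom (by rw [List.orderedInsert_cons_of_le _ s h]) := by
  rw [insertHom, dif_pos h]

lemma insertHom_cons_of_not_le {a b : ℕ} (s : List ℕ) (h : ¬ a ≤ b) :
    insertHom X a (b :: s) =
      swp (X (wireType a)) (X (wireType b)) (obj X s) ≫ X (wireType b) ◁ insertHom X a s ≫
      eqToHom (by rw [List.orderedInsert_of_not_le _ s h]) := by
  rw [insertHom, dif_neg h]

lemma insertHom_congr (a : ℕ) {s t : List ℕ} (h : s = t) :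
    insertHom X a t = eqToHom (by rw [h]) ≫ insertHom X a s ≫ eqToHom (by rw [h]) := by
  subst h; simp

lemma isIso_insertHom (a : ℕ) (s : List ℕ) : IsIso (insertHom X a s) := by
  induction s with
  | nil => rw [insertHom_nil]; infer_instance
  | cons b s ih =>
    by_cases h : a ≤ b
    · rw [insertHom_cons_of_le X s h]; infer_instance
    · rw [insertHom_cons_of_not_le X s h]
      infer_instance

lemma orderedInsert_comm (a b : ℕ) (s : List ℕ) :
    (s.orderedInsert (· ≤ ·) a).orderedInsert (· ≤ ·) b =
      (s.orderedInsert (· ≤ ·) b).orderedInsert (· ≤ ·) a := by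
  induction s <;> grind

/-- Induction on the sorted list. Only when its head `c` precedes both `a` and `b` do three wires
really cross; that case is the Yang–Baxter equation. -/
lemma insertHom_comm_of_lt {a b : ℕ} (hab : a < b) (s : List ℕ) :
    X (wireType a) ◁ insertHom X b s ≫ insertHom X a (s.orderedInsert (· ≤ ·) b) =
      swp (X (wireType a)) (X (wireType b)) (obj X s) ≫ X (wireType b) ◁ insertHom X a s ≫
        insertHom X b (s.orderedInsert (· ≤ ·) a) ≫ eqToHom (by rw [orderedInsert_comm]) := by
  induction s with
  | nil =>
    rw [insertHom_congr X a (List.orderedInsert_nil (r := (· ≤ ·)) b).symm,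
      insertHom_congr X b (List.orderedInsert_nil (r := (· ≤ ·)) a).symm,
      insertHom_cons_of_le X _ hab.le, insertHom_cons_of_not_le X _ (not_le.2 hab),
      insertHom_nil, insertHom_nil]
    simp
  | cons c s ih =>
    by_cases hbc : b ≤ c
    · rw [insertHom_cons_of_le X s hbc, insertHom_cons_of_le X s (hab.le.trans hbc),
        insertHom_congr X a (List.orderedInsert_cons_of_le (· ≤ ·) s hbc).symm,
        insertHom_congr X b (List.orderedInsert_cons_of_le (· ≤ ·) s (hab.le.trans hbc)).symm,
        insertHom_cons_of_le X _ hab.le, insertHom_cons_of_not_le X _ (not_le.2 hab),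
        insertHom_cons_of_le X s hbc]
      simp
    · by_cases hac : a ≤ c
      · rw [insertHom_cons_of_not_le X s hbc, insertHom_cons_of_le X s hac,
          insertHom_congr X a (List.orderedInsert_of_not_le (· ≤ ·) s hbc).symm,
          insertHom_congr X b (List.orderedInsert_cons_of_le (· ≤ ·) s hac).symm,
          insertHom_cons_of_le X _ hac, insertHom_cons_of_not_le X _ (not_le.2 hab),
          insertHom_cons_of_not_le X s hbc]
        simp
      · rw [insertHom_cons_of_not_le X s hbc, insertHom_cons_of_not_le X s hac,
          insertHom_congr X a (List.orderedInsert_of_not_le (· ≤ ·) s hbc).symm,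
          insertHom_congr X b (List.orderedInsert_of_not_le (· ≤ ·) s hac).symm,
          insertHom_cons_of_not_le X _ hac, insertHom_cons_of_not_le X _ hbc]
        simp only [whiskerLeft_comp, whiskerLeft_eqToHom, Category.assoc, eqToHom_trans,
          eqToHom_trans_assoc, eqToHom_refl, Category.id_comp, swp_naturality_assoc]
        have ih' := congrArg (X (wireType c) ◁ ·) ih
        simp only [whiskerLeft_comp, whiskerLeft_eqToHom] at ih'
        rw [reassoc_of% ih', swp_braid_assoc]
        simp

lemma insertHom_comm {a b : ℕ} (hab : a ≠ b) (s : List ℕ) :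
    X (wireType a) ◁ insertHom X b s ≫ insertHom X a (s.orderedInsert (· ≤ ·) b) =
      swp (X (wireType a)) (X (wireType b)) (obj X s) ≫ X (wireType b) ◁ insertHom X a s ≫
        insertHom X b (s.orderedInsert (· ≤ ·) a) ≫ eqToHom (by rw [orderedInsert_comm]) := by
  rcases lt_or_gt_of_ne hab with h | h
  · exact insertHom_comm_of_lt X h s
  -- The case `b < a` follows from the other one because the symmetry is an involution.
  · have e := insertHom_comm_of_lt X h s
    rw [reassoc_of% e]
    simp

/-- Sorting of a list of wires. -/
def sortHom : ∀ l : List ℕ, obj X l ⟶ obj X (l.insertionSort (· ≤ ·))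
  | [] => eqToHom (by rw [List.insertionSort_nil])
  | a :: l => X (wireType a) ◁ sortHom l ≫ insertHom X a _ ≫
      eqToHom (by rw [List.insertionSort_cons])

lemma sortHom_cons (a : ℕ) (l : List ℕ) :
    sortHom X (a :: l) = X (wireType a) ◁ sortHom X l ≫ insertHom X a _ ≫
      eqToHom (by rw [List.insertionSort_cons]) := rfl

instance isIso_sortHom (l : List ℕ) : IsIso (sortHom X l) := by
  induction l with
  | nil => exact inferInstanceAs (IsIso (eqToHom _))
  | cons a l ih =>
    rw [sortHom_cons]
    have := isIso_insertHom X a (l.insertionSort (· ≤ ·))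
    infer_instance

lemma insertionSort_eq_of_perm {l m : List ℕ} (h : l.Perm m) :
    l.insertionSort (· ≤ ·) = m.insertionSort (· ≤ ·) :=
  List.Perm.eq_of_pairwise' (List.pairwise_insertionSort _ _) (List.pairwise_insertionSort _ _)
    ((List.perm_insertionSort _ _).trans (h.trans (List.perm_insertionSort _ _).symm))

/-- The permutation of tensor factors which reorders a list of wires. -/
noncomputable def permHom {l m : List ℕ} (h : l.Perm m) : obj X l ⟶ obj X m :=
  sortHom X l ≫ eqToHom (by rw [insertionSort_eq_of_perm h]) ≫ inv (sortHom X m)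

@[simp] lemma permHom_refl {l : List ℕ} (h : l.Perm l) : permHom X h = 𝟙 _ := by
  simp [permHom]

@[simp]
lemma permHom_comp {l m n : List ℕ} (h : l.Perm m) (k : m.Perm n) :
    permHom X h ≫ permHom X k = permHom X (h.trans k) := by
  simp [permHom]

@[simp]
lemma permHom_comp_assoc {l m n : List ℕ} (h : l.Perm m) (k : m.Perm n) {W : C}
    (f : obj X n ⟶ W) : permHom X h ≫ permHom X k ≫ f = permHom X (h.trans k) ≫ f := by
  rw [← Category.assoc, permHom_comp]

lemma permHom_eq {l m : List ℕ} (h : l = m) (k : l.Perm m) :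
    permHom X k = eqToHom (by rw [h]) := by
  subst h; simp

lemma permHom_cons (a : ℕ) {l m : List ℕ} (h : l.Perm m) (k : (a :: l).Perm (a :: m)) :
    permHom X k = X (wireType a) ◁ permHom X h := by
  rw [permHom, ← Category.assoc, IsIso.comp_inv_eq, sortHom_cons, sortHom_cons,
    insertHom_congr X a (insertionSort_eq_of_perm h), permHom]
  simp [← whiskerLeft_comp_assoc]

/-- Distinctness is essential: sorting cannot tell equal names apart, and for `a = b` the left side
would be the identity. This is the source of all `Nodup` hypotheses below. -/
lemma permHom_swap {a b : ℕ} (hab : a ≠ b) {l : List ℕ} (k : (a :: b :: l).Perm (b :: a :: l)) :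
    permHom X k = swp (X (wireType a)) (X (wireType b)) (obj X l) := by
  rw [permHom, ← Category.assoc, IsIso.comp_inv_eq, sortHom_cons, sortHom_cons, sortHom_cons,
    sortHom_cons, insertHom_congr X a (List.insertionSort_cons (· ≤ ·) b l).symm,
    insertHom_congr X b (List.insertionSort_cons (· ≤ ·) a l).symm]
  have e := insertHom_comm X hab (l.insertionSort (· ≤ ·))
  simp only [whiskerLeft_comp, Category.assoc, whiskerLeft_eqToHom, eqToHom_trans_assoc,
    eqToHom_trans, eqToHom_refl, Category.id_comp, reassoc_of% e, swp_naturality_assoc]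

lemma permHom_append_left (a : List ℕ) {l m : List ℕ} (h : l.Perm m)
    (k : (a ++ l).Perm (a ++ m)) :
    (app X a l).hom ≫ permHom X k = obj X a ◁ permHom X h ≫ (app X a m).hom := by
  induction a with
  | nil =>
    rw [app_nil, app_nil]
    exact (leftUnitor_naturality (permHom X h)).symm
  | cons b a ih =>
    have h' : (a ++ l).Perm (a ++ m) := h.append_left a
    have e : permHom X k = X (wireType b) ◁ permHom X h' := permHom_cons X b h' k
    rw [app_cons, app_cons, e, Category.assoc, ← whiskerLeft_comp, ih h']
    simp

lemma swp_transport {A A' B B' Y Y' : C} (p : A = A') (q : B = B') (r : Y = Y') (e₁ e₂) :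
    swp A B Y = eqToHom e₁ ≫ swp A' B' Y' ≫ eqToHom e₂ := by
  subst p q r; simp

lemma map_wireType_of_forall {σ : ℕ → ℕ} {l : List ℕ}
    (hσ : ∀ a ∈ l, wireType (σ a) = wireType a) :
    (l.map σ).map wireType = l.map wireType := by
  simpa using hσ

/-- Wires can be renamed. -/
lemma permHom_rename {σ : ℕ → ℕ} {l m : List ℕ} (h : l.Perm m) (hl : (l.map σ).Nodup)
    (hσ : ∀ a ∈ l, wireType (σ a) = wireType a) (e₁ e₂) :
    permHom X (h.map σ) = eqToHom e₁ ≫ permHom X h ≫ eqToHom e₂ := by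
  induction h with
  | nil => simp
  | @cons a l m h ih =>
    have hl' : ∀ b ∈ l, wireType (σ b) = wireType b := fun b hb => hσ b (List.mem_cons_of_mem _ hb)
    have hm' : ∀ b ∈ m, wireType (σ b) = wireType b := fun b hb => hl' b (h.mem_iff.2 hb)
    have ih' := ih (List.nodup_cons.1 hl).2 hl' (obj_congr X (map_wireType_of_forall hl'))
      (obj_congr X (map_wireType_of_forall hm')).symm
    rw [permHom_cons X a h]
    refine (permHom_cons X (σ a) (h.map σ) _).trans ?_
    rw [ih']
    exact whiskerLeft_transport (congrArg X (hσ a List.mem_cons_self)) _ _ _ _ _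
  | swap a b l =>
    simp only [List.map_cons, List.nodup_cons, List.mem_cons, not_or] at hl
    have hl' : ∀ b ∈ l, wireType (σ b) = wireType b := fun b hb => hσ b (by simp [hb])
    have hab : b ≠ a := fun e => hl.1.1 (congrArg σ e)
    rw [permHom_swap X hab]
    refine (permHom_swap X hl.1.1 _).trans ?_
    exact swp_transport (congrArg X (hσ b (by simp))) (congrArg X (hσ a (by simp)))
      (obj_congr X (map_wireType_of_forall hl')) _ _
  | @trans l m n h k ih₁ ih₂ =>
    have hm' : ∀ b ∈ m, wireType (σ b) = wireType b := fun b hb => hσ b (h.mem_iff.2 hb)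
    have e := obj_congr X (map_wireType_of_forall hm')
    rw [← permHom_comp X (h.map σ) (k.map σ), ih₁ hl hσ e₁ e.symm,
      ih₂ ((h.map σ).nodup_iff.1 hl) hm' e e₂]
    simp

/-- The induction decomposes the permutation itself into adjacent transpositions, which is why names
must be distinct here, unlike in `permHom_append_left`. -/
lemma permHom_append_right (r : List ℕ) {l m : List ℕ} (h : l.Perm m) (hl : l.Nodup)
    (k : (l ++ r).Perm (m ++ r)) :
    (app X l r).hom ≫ permHom X k = permHom X h ▷ obj X r ≫ (app X m r).hom := by
  induction h with
  | nil => simp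
  | @cons a l m h ih =>
    have e : permHom X k = X (wireType a) ◁ permHom X (h.append_right r) :=
      permHom_cons X a (h.append_right r) k
    rw [permHom_cons X a h, e, app_cons, app_cons, Category.assoc, ← whiskerLeft_comp,
      ih (List.nodup_cons.1 hl).2]
    simp
  | swap a b l =>
    simp only [List.nodup_cons, List.mem_cons, not_or] at hl
    have e : permHom X k = swp (X (wireType b)) (X (wireType a)) (obj X (l ++ r)) :=
      permHom_swap X hl.1.1 k
    rw [e, permHom_swap X hl.1.1, app_cons, app_cons, app_cons, app_cons]
    rw [whiskerLeft_comp, Category.assoc, Category.assoc, swp_naturality,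
      reassoc_of% (swp_whiskerRight (X (wireType b)) (X (wireType a)) (obj X l) (obj X r)).symm]
    simp
  | @trans l m n h₁ h₂ ih₁ ih₂ =>
    rw [← permHom_comp X (h₁.append_right r) (h₂.append_right r), ← permHom_comp X h₁ h₂,
      reassoc_of% (ih₁ hl), ih₂ (h₁.nodup_iff.1 hl), comp_whiskerRight, Category.assoc]

lemma permHom_middle (a : ℕ) (l m : List ℕ) (h : a ∉ l)
    (k : (a :: (l ++ m)).Perm (l ++ a :: m)) :
    X (wireType a) ◁ (app X l m).hom ≫ permHom X k =
      swp (X (wireType a)) (obj X l) (obj X m) ≫ (app X l (a :: m)).hom := by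
  induction l with
  | nil =>
    have e : permHom X k = 𝟙 _ := permHom_refl X k
    rw [e, app_nil, app_nil]
    simp [swp]
  | cons b l ih =>
    simp only [List.mem_cons, not_or] at h
    have k' : (a :: (l ++ m)).Perm (l ++ a :: m) := List.perm_middle.symm
    have e : permHom X k = swp (X (wireType a)) (X (wireType b)) (obj X (l ++ m)) ≫
        X (wireType b) ◁ permHom X k' := by
      rw [← permHom_cons X b k' (k'.cons b), ← permHom_swap X h.1 (List.Perm.swap ..),
        permHom_comp]
    rw [e, app_cons, app_cons, whiskerLeft_comp, Category.assoc, swp_naturality_assoc,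
      ← whiskerLeft_comp, ih h.2]
    simp [swp, BraidedCategory.braiding_tensor_right_hom]

/-- The wires of `l` are moved across `m` one at a time; the hexagon identity collects these moves
into one braiding. -/
lemma permHom_braid {l m : List ℕ} (h : (l ++ m).Nodup) (k : (l ++ m).Perm (m ++ l)) :
    (app X l m).hom ≫ permHom X k = (β_ _ _).hom ≫ (app X m l).hom := by
  induction l with
  | nil =>
    rw [permHom_eq X (by simp : [] ++ m = m ++ []), app_nil, app_nil_right]
    simp
  | cons a l ih =>
    have k₁ : (l ++ m).Perm (m ++ l) := List.perm_append_comm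
    have k₂ : (a :: (m ++ l)).Perm (m ++ a :: l) := List.perm_middle.symm
    have e : permHom X k = X (wireType a) ◁ permHom X k₁ ≫ permHom X k₂ := by
      rw [← permHom_cons X a k₁ (k₁.cons a), permHom_comp]
    have h' : a ∉ m := fun ha => (List.nodup_cons.1 h).1 (by simp [ha])
    rw [e, app_cons, Category.assoc, ← whiskerLeft_comp_assoc, ih (List.nodup_cons.1 h).2,
      whiskerLeft_comp, Category.assoc, permHom_middle X a m l h']
    simp [swp, BraidedCategory.braiding_tensor_left_hom]

end Symmetric

end

/-! ### Programs on named wires and their interpretation -/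

section

/-- Formal tensor products of the two basic types. -/
inductive Ob
  | unit
  | atom (t : Bool)
  | tensor (A B : Ob)

/-- The interpretation of a formal object. -/
@[reducible] def Ob.eval {C : Type u} [Category.{v} C] [MonoidalCategory C] (X : Bool → C) : Ob → C
  | unit => 𝟙_ C
  | atom t => X t
  | tensor A B => A.eval X ⊗ B.eval X

/-- The list of the atoms of a formal object, as a list of wires named `0` and `1`. -/
@[reducible] def Ob.flat : Ob → List ℕ
  | unit => []
  | atom t => [t.toNat]
  | tensor A B => A.flat ++ B.flat

/-- The operations of a Hopf algebra `H` with bijective antipode and a dual. The atom `false` stands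
for `H`, the atom `true` for its dual. -/
inductive Op
  | one | mul | counit | comul | ant | ainv | cup | cap

/-- Equality test for operations. -/
def Op.toNat : Op → ℕ
  | one => 0 | mul => 1 | counit => 2 | comul => 3 | ant => 4 | ainv => 5 | cup => 6 | cap => 7

lemma Op.toNat_injective : Function.Injective Op.toNat := by
  intro a b h
  cases a <;> cases b <;> first | rfl | (simp [Op.toNat] at h)

/-- The source of an operation. -/
@[reducible] def Op.dom : Op → Ob
  | one => .unit
  | mul => .tensor (.atom false) (.atom false)
  | counit => .atom false
  | comul => .atom false
  | ant => .atom false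
  | ainv => .atom false
  | cup => .unit
  | cap => .tensor (.atom false) (.atom true)

/-- The target of an operation. -/
@[reducible] def Op.cod : Op → Ob
  | one => .atom false
  | mul => .atom false
  | counit => .unit
  | comul => .tensor (.atom false) (.atom false)
  | ant => .atom false
  | ainv => .atom false
  | cup => .tensor (.atom true) (.atom false)
  | cap => .unit

/-- An interpretation of the basic types and of the operations. -/
structure Model (C : Type u) [Category.{v} C] [MonoidalCategory C] where
  /-- the interpretation of the basic types -/
  X : Bool → C
  /-- the interpretation of the operations -/
  sem : ∀ k : Op, k.dom.eval X ⟶ k.cod.eval X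

/-- A statement applies an operation to the wires `i` and names the resulting wires `o`. -/
structure Stmt where
  /-- the operation -/
  op : Op
  /-- the names of the inputs -/
  i : List ℕ
  /-- the names of the outputs -/
  o : List ℕ

/-- The wires of a statement have the right types. -/
def Stmt.Typed (g : Stmt) : Prop :=
  g.i.map wireType = g.op.dom.flat.map wireType ∧ g.o.map wireType = g.op.cod.flat.map wireType

/-- A program is well formed if it can be executed on the wires `l` and leaves the wires `m`. -/
def WF : List ℕ → List Stmt → List ℕ → Prop
  | l, [], m => l.Perm m
  | l, g :: p, m => g.Typed ∧ l.Perm (g.i ++ l.diff g.i) ∧ WF (g.o ++ l.diff g.i) p m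

/-- All the wires occurring in a program have distinct names. -/
def Uniq (l : List ℕ) (p : List Stmt) : Prop := (l ++ p.flatMap Stmt.o).Nodup

variable {C : Type u} [Category.{v} C] [MonoidalCategory C]

lemma wireType_toNat (t : Bool) : wireType t.toNat = t := by cases t <;> rfl

/-- A formal object is the tensor product of its atoms. -/
def flatIso (X : Bool → C) : ∀ A : Ob, A.eval X ≅ obj X A.flat
  | .unit => Iso.refl _
  | .atom t => (ρ_ (X t)).symm ≪≫ eqToIso (by rw [Ob.flat, obj, wireType_toNat, obj])
  | .tensor A B => (flatIso X A ⊗ᵢ flatIso X B) ≪≫ app X A.flat B.flat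

variable (M : Model C)

/-- The interpretation of a statement. -/
def Stmt.hom (g : Stmt) (h : g.Typed) : obj M.X g.i ⟶ obj M.X g.o :=
  eqToHom (obj_congr M.X h.1) ≫ (flatIso M.X _).inv ≫ M.sem g.op ≫ (flatIso M.X _).hom ≫
    eqToHom (obj_congr M.X h.2).symm

/-- The action of a statement in presence of further wires `r`. -/
def Stmt.act (g : Stmt) (h : g.Typed) (r : List ℕ) : obj M.X (g.i ++ r) ⟶ obj M.X (g.o ++ r) :=
  (app M.X g.i r).inv ≫ g.hom M h ▷ obj M.X r ≫ (app M.X g.o r).hom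

lemma Stmt.act_append (g : Stmt) (h : g.Typed) (r s : List ℕ) :
    (app M.X (g.i ++ r) s).hom ≫ eqToHom (by rw [List.append_assoc]) ≫ g.act M h (r ++ s) =
      g.act M h r ▷ obj M.X s ≫ (app M.X (g.o ++ r) s).hom ≫
        eqToHom (by rw [List.append_assoc]) := by
  have e₁ := app_assoc M.X g.i r s
  have e₂ := app_assoc M.X g.o r s
  rw [← cancel_epi ((app M.X g.i r).hom ▷ obj M.X s), reassoc_of% e₁]
  simp only [Stmt.act, comp_whiskerRight, Category.assoc, hom_inv_whiskerRight_assoc,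
    reassoc_of% e₂, eqToHom_trans, eqToHom_refl, Category.comp_id, eqToHom_trans_assoc,
    Category.id_comp, Iso.hom_inv_id_assoc, whisker_exchange_assoc]
  simp

lemma Stmt.act_app (g : Stmt) (h : g.Typed) (r : List ℕ) :
    (app M.X g.i r).hom ≫ g.act M h r = g.hom M h ▷ obj M.X r ≫ (app M.X g.o r).hom := by
  simp [Stmt.act]

lemma Stmt.act_app_assoc (g : Stmt) (h : g.Typed) (r : List ℕ) {W : C}
    (k : obj M.X (g.o ++ r) ⟶ W) : (app M.X g.i r).hom ≫ g.act M h r ≫ k =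
      g.hom M h ▷ obj M.X r ≫ (app M.X g.o r).hom ≫ k := by
  simp [Stmt.act]

lemma whiskerRight_transport {A A' B B' Y Y' : C} (p : A = A') (q : B = B') (r : Y = Y')
    (f : A' ⟶ B') :
    (eqToHom p ≫ f ≫ eqToHom q.symm) ▷ Y ≫ (eqToHom q ⊗ₘ eqToHom r) =
      (eqToHom p ⊗ₘ eqToHom r) ≫ f ▷ Y' := by
  subst p q r; simp

/-- Renaming of the wires of a statement. -/
def Stmt.rename (σ : ℕ → ℕ) (g : Stmt) : Stmt := ⟨g.op, g.i.map σ, g.o.map σ⟩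

lemma Stmt.Typed.rename {σ : ℕ → ℕ} (hσ : ∀ a, wireType (σ a) = wireType a) {g : Stmt}
    (h : g.Typed) : (g.rename σ).Typed :=
  ⟨(map_wireType_of_forall fun a _ => hσ a).trans h.1,
    (map_wireType_of_forall fun a _ => hσ a).trans h.2⟩

lemma Stmt.act_rename {σ : ℕ → ℕ} (hσ : ∀ a, wireType (σ a) = wireType a) {g : Stmt}
    (h : g.Typed) (r : List ℕ) (e₁ e₂) :
    (g.rename σ).act M (h.rename hσ) (r.map σ) =
      eqToHom e₁ ≫ g.act M h r ≫ eqToHom e₂ := by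
  have k (l : List ℕ) : (l.map σ).map wireType = l.map wireType :=
    map_wireType_of_forall fun a _ => hσ a
  have a₁ := app_eqToHom M.X (k g.i) (k r)
  have a₂ := app_eqToHom M.X (k g.o) (k r)
  have e : (g.rename σ).hom M (h.rename hσ) =
      eqToHom (obj_congr M.X (k g.i)) ≫ g.hom M h ≫ eqToHom (obj_congr M.X (k g.o)).symm := by
    simp only [Stmt.hom, Category.assoc, eqToHom_trans, eqToHom_trans_assoc]
    rfl
  have a₂' : (app M.X (g.o.map σ) (r.map σ)).hom =
      (eqToHom (obj_congr M.X (k g.o)) ⊗ₘ eqToHom (obj_congr M.X (k r))) ≫ (app M.X g.o r).hom ≫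
        eqToHom (obj_append_congr M.X (k g.o) (k r)).symm := by
    rw [reassoc_of% a₂]; simp
  have key (F : obj M.X (g.i.map σ) ⟶ obj M.X (g.o.map σ))
      (hF : F = eqToHom (obj_congr M.X (k g.i)) ≫ g.hom M h ≫
        eqToHom (obj_congr M.X (k g.o)).symm) (e₁ e₂) :
      (app M.X (g.i.map σ) (r.map σ)).inv ≫ F ▷ obj M.X (r.map σ) ≫
        (app M.X (g.o.map σ) (r.map σ)).hom = eqToHom e₁ ≫ g.act M h r ≫ eqToHom e₂ := by
    rw [hF, a₂', Iso.inv_comp_eq, Stmt.act,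
      ← eqToHom_trans (obj_append_congr M.X (k g.i) (k r)) rfl,
      Category.assoc, ← reassoc_of% a₁, reassoc_of% (whiskerRight_transport _ _ _ (g.hom M h))]
    simp
  exact key _ e _ _

section Symmetric

variable {C : Type u} [Category.{v} C] [MonoidalCategory C] [SymmetricCategory C] (M : Model C)

/-- The interpretation of a program. -/
noncomputable def den : ∀ (l : List ℕ) (p : List Stmt) (m : List ℕ), WF l p m →
    (obj M.X l ⟶ obj M.X m)
  | _, [], _, h => permHom M.X h
  | l, g :: p, m, h => permHom M.X h.2.1 ≫ g.act M h.1 (l.diff g.i) ≫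
      den (g.o ++ l.diff g.i) p m h.2.2

lemma den_nil {l m : List ℕ} (h : WF l [] m) : den M l [] m h = permHom M.X h := rfl

lemma den_cons {l m : List ℕ} {g : Stmt} {p : List Stmt} (h : WF l (g :: p) m) :
    den M l (g :: p) m h = permHom M.X h.2.1 ≫ g.act M h.1 (l.diff g.i) ≫
      den M (g.o ++ l.diff g.i) p m h.2.2 := rfl

lemma perm_append_left_comm {α : Type} (a b r : List α) : (a ++ (b ++ r)).Perm (b ++ (a ++ r)) := by
  rw [← List.append_assoc, ← List.append_assoc]
  exact List.perm_append_comm.append_right r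

lemma swp_naturality_left {A A' : C} (f : A ⟶ A') (B Y : C) :
    f ▷ (B ⊗ Y) ≫ swp A' B Y = swp A B Y ≫ B ◁ f ▷ Y := by
  simp [swp, ← comp_whiskerRight_assoc]

lemma swp_naturality_left_assoc {A A' : C} (f : A ⟶ A') (B Y : C) {W : C}
    (k : B ⊗ (A' ⊗ Y) ⟶ W) :
    f ▷ (B ⊗ Y) ≫ swp A' B Y ≫ k = swp A B Y ≫ B ◁ f ▷ Y ≫ k := by
  rw [← Category.assoc, swp_naturality_left, Category.assoc]

lemma Stmt.act_permHom (g : Stmt) (h : g.Typed) {r r' : List ℕ} (e : r.Perm r') :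
    g.act M h r ≫ permHom M.X (e.append_left g.o) =
      permHom M.X (e.append_left g.i) ≫ g.act M h r' := by
  rw [Stmt.act, Stmt.act, Category.assoc, Category.assoc, permHom_append_left M.X _ e,
    Iso.inv_comp_eq, reassoc_of% (permHom_append_left M.X g.i e), Iso.hom_inv_id_assoc,
    whisker_exchange_assoc]

lemma perm_diff_of_perm_append {l a r : List ℕ} (h : l.Perm (a ++ r)) : (l.diff a).Perm r :=
  (h.diff_right a).trans (by rw [List.perm_iff_count]; intro b; simp [List.count_diff])

lemma WF.of_perm {l l' m : List ℕ} {p : List Stmt} (e : l.Perm l') (h : WF l p m) : WF l' p m := by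
  induction p generalizing l l' with
  | nil => exact e.symm.trans h
  | cons g p ih =>
    exact ⟨h.1, (e.symm.trans h.2.1).trans ((e.diff_right _).append_left _),
      ih ((e.diff_right _).append_left _) h.2.2⟩

lemma WF.cons {l r m : List ℕ} {g : Stmt} {p : List Stmt} (hg : g.Typed) (e : l.Perm (g.i ++ r))
    (h : WF (g.o ++ r) p m) : WF l (g :: p) m :=
  have e' := perm_diff_of_perm_append e
  ⟨hg, e.trans (e'.symm.append_left _), h.of_perm (e'.symm.append_left _)⟩

lemma WF.exists_cons {l m : List ℕ} {g : Stmt} {p : List Stmt} (h : WF l (g :: p) m) :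
    ∃ r, l.Perm (g.i ++ r) ∧ WF (g.o ++ r) p m :=
  ⟨_, h.2.1, h.2.2⟩

lemma den_of_perm {l l' m : List ℕ} {p : List Stmt} (e : l.Perm l') (h : WF l p m)
    (h' : WF l' p m) :
    den M l p m h = permHom M.X e ≫ den M l' p m h' := by
  induction p generalizing l l' with
  | nil => exact (permHom_comp M.X _ _).symm
  | cons g p ih =>
    rw [den_cons, den_cons, ih ((e.diff_right g.i).append_left g.o) h.2.2 h'.2.2,
      reassoc_of% (g.act_permHom M h.1 (e.diff_right g.i))]
    simp only [permHom_comp_assoc]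

/-- Frees the interpretation from the particular order `l.diff g.i` of the untouched wires. -/
lemma den_cons_of_perm {l r m : List ℕ} {g : Stmt} {p : List Stmt} (h : WF l (g :: p) m)
    (e : l.Perm (g.i ++ r)) (h' : WF (g.o ++ r) p m) :
    den M l (g :: p) m h = permHom M.X e ≫ g.act M h.1 r ≫ den M (g.o ++ r) p m h' := by
  have e' := perm_diff_of_perm_append e
  rw [den_cons, den_of_perm M (e'.append_left g.o) h.2.2 h',
    reassoc_of% (g.act_permHom M h.1 e'), permHom_comp_assoc]

lemma WF.perm_right {l m m' : List ℕ} {p : List Stmt} (h : WF l p m) (e : m.Perm m') :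
    WF l p m' := by
  induction p generalizing l with
  | nil => exact h.trans e
  | cons g p ih => exact ⟨h.1, h.2.1, ih h.2.2⟩

lemma WF.append {l k m : List ℕ} {p q : List Stmt} (h : WF l p k) (h' : WF k q m) :
    WF l (p ++ q) m := by
  induction p generalizing l with
  | nil => exact h'.of_perm h.symm
  | cons g p ih => exact ⟨h.1, h.2.1, ih h.2.2⟩

lemma den_append {l k m : List ℕ} {p q : List Stmt} (h : WF l p k) (h' : WF k q m)
    (h'' : WF l (p ++ q) m) :
    den M l (p ++ q) m h'' = den M l p k h ≫ den M k q m h' := by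
  induction p generalizing l with
  | nil => rw [den_nil]; exact den_of_perm M h _ _
  | cons g p ih =>
    rw [den_cons, Category.assoc, Category.assoc, ← ih h.2.2 h''.2.2]
    rfl

lemma den_perm_right {l m m' : List ℕ} {p : List Stmt} (h : WF l p m) (e : m.Perm m')
    (h' : WF l p m') : den M l p m' h' = den M l p m h ≫ permHom M.X e := by
  induction p generalizing l with
  | nil => exact (permHom_comp M.X _ _).symm
  | cons g p ih =>
    rw [den_cons, den_cons, Category.assoc, Category.assoc, ← ih h.2.2]

lemma Uniq.tail {l r : List ℕ} {g : Stmt} {p : List Stmt} (hu : Uniq l (g :: p))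
    (e : l.Perm (g.i ++ r)) : Uniq (g.o ++ r) p := by
  have hu' := (e.append_right _).nodup_iff.1 hu
  simp only [List.flatMap_cons] at hu'
  rw [Uniq]
  grind [List.nodup_append]

/-- A program does not act on wires it does not mention; this is what makes local replacement
possible. -/
lemma den_frame {l m : List ℕ} (r : List ℕ) {p : List Stmt} (hu : Uniq l p) (h : WF l p m)
    (h' : WF (l ++ r) p (m ++ r)) :
    (app M.X l r).hom ≫ den M (l ++ r) p (m ++ r) h' =
      den M l p m h ▷ obj M.X r ≫ (app M.X m r).hom := by
  induction p generalizing l with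
  | nil => exact permHom_append_right M.X r h hu.of_append_left h'
  | cons g p ih =>
    obtain ⟨s, e, hs⟩ := h.exists_cons
    have e' : (l ++ r).Perm (g.i ++ (s ++ r)) := by
      rw [← List.append_assoc]; exact e.append_right r
    have hs' : WF ((g.o ++ s) ++ r) p (m ++ r) :=
      WF.of_perm (by rw [List.append_assoc]; exact (perm_diff_of_perm_append e').append_left _)
        h'.2.2
    have hs'' : WF (g.o ++ (s ++ r)) p (m ++ r) := by rwa [← List.append_assoc]
    have e₁ : den M (g.o ++ (s ++ r)) p (m ++ r) hs'' =
        eqToHom (by rw [List.append_assoc]) ≫ den M ((g.o ++ s) ++ r) p (m ++ r) hs' := by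
      rw [den_of_perm M (List.Perm.of_eq (List.append_assoc g.o s r).symm) hs'' hs',
          permHom_eq M.X (List.append_assoc g.o s r).symm]
    have e₂ : permHom M.X e' = permHom M.X (e.append_right r) ≫
        eqToHom (by rw [List.append_assoc]) := by
      rw [← permHom_eq M.X (List.append_assoc g.i s r) (by simp), permHom_comp]
    rw [den_cons_of_perm M h' e' hs'', den_cons_of_perm M h e hs, e₁, e₂, Category.assoc,
      reassoc_of% (permHom_append_right M.X r e hu.of_append_left),
      reassoc_of% (g.act_append M h.1 s r)]
    simp only [eqToHom_trans_assoc, eqToHom_refl, Category.id_comp, ih (hu.tail e) hs hs']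
    simp

lemma permHom_swap_blocks {a b : List ℕ} (r : List ℕ) (h : (a ++ b).Nodup)
    (k : (a ++ (b ++ r)).Perm (b ++ (a ++ r))) :
    obj M.X a ◁ (app M.X b r).hom ≫ (app M.X a (b ++ r)).hom ≫ permHom M.X k =
      swp (obj M.X a) (obj M.X b) (obj M.X r) ≫ obj M.X b ◁ (app M.X a r).hom ≫
        (app M.X b (a ++ r)).hom := by
  have k₁ : (a ++ b).Perm (b ++ a) := List.perm_append_comm
  have e : permHom M.X k = eqToHom (by rw [List.append_assoc]) ≫
      permHom M.X (k₁.append_right r) ≫ eqToHom (by rw [List.append_assoc]) := by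
    rw [← permHom_eq M.X (List.append_assoc a b r).symm (by simp),
      ← permHom_eq M.X (List.append_assoc b a r) (by simp)]
    simp
  have e₁ := app_assoc M.X a b r
  have e₂ := app_assoc M.X b a r
  rw [← cancel_epi (α_ _ _ _).hom, e, ← reassoc_of% e₁,
    reassoc_of% (permHom_append_right M.X r k₁ h), ← comp_whiskerRight_assoc,
    permHom_braid M.X h k₁, comp_whiskerRight, Category.assoc, reassoc_of% e₂]
  simp [swp]

/-- The interchange law for two operations on disjoint blocks of wires, with the block permutations
made explicit. -/
lemma Stmt.act_act (g g' : Stmt) (h : g.Typed) (h' : g'.Typed) (r : List ℕ)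
    (n₁ : (g.o ++ g'.i).Nodup) (n₂ : (g.i ++ g'.i).Nodup) (n₃ : (g'.o ++ g.i).Nodup)
    (n₄ : (g.o ++ g'.o).Nodup) (k₁ k₂ k₃ k₄) :
    g.act M h (g'.i ++ r) ≫ permHom M.X (m := g'.i ++ (g.o ++ r)) k₁ ≫ g'.act M h' (g.o ++ r) =
      permHom M.X (m := g'.i ++ (g.i ++ r)) k₂ ≫ g'.act M h' (g.i ++ r) ≫
        permHom M.X (m := g.i ++ (g'.o ++ r)) k₃ ≫ g.act M h (g'.o ++ r) ≫ permHom M.X k₄ := by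
  rw [← cancel_epi (obj M.X g.i ◁ (app M.X g'.i r).hom ≫ (app M.X g.i (g'.i ++ r)).hom)]
  simp only [Category.assoc]
  rw [reassoc_of% (permHom_swap_blocks M r n₂ k₂), g.act_app_assoc, g'.act_app_assoc,
    whisker_exchange_assoc, whisker_exchange_assoc, reassoc_of% (permHom_swap_blocks M r n₁ k₁),
    reassoc_of% (permHom_swap_blocks M r n₃ k₃), g.act_app_assoc, g'.act_app,
    whisker_exchange_assoc, whisker_exchange_assoc, permHom_swap_blocks M r n₄ k₄,
    swp_naturality_left_assoc (g.hom M h) (obj M.X g'.o), swp_swp_assoc,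
    swp_naturality_left_assoc (g.hom M h) (obj M.X g'.i), whisker_exchange_assoc]

lemma WF.swap {l m r : List ℕ} {g g' : Stmt} {p : List Stmt}
    (e : l.Perm (g.i ++ (g'.i ++ r))) (h : WF l (g :: g' :: p) m) : WF l (g' :: g :: p) m := by
  have e₁ : (g.o ++ l.diff g.i).Perm (g'.i ++ (g.o ++ r)) :=
    ((perm_diff_of_perm_append e).append_left g.o).trans (perm_append_left_comm _ _ _)
  have h₁ : WF (g'.o ++ (g.o ++ r)) p m :=
    h.2.2.2.2.of_perm ((perm_diff_of_perm_append e₁).append_left _)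
  exact WF.cons h.2.2.1 (e.trans (perm_append_left_comm _ _ _))
    (WF.cons h.1 (perm_append_left_comm _ _ _) (h₁.of_perm (perm_append_left_comm _ _ _)))

/-- The hypothesis `e` expresses independence: the inputs of both statements are already present, on
separate wires. -/
lemma den_swap {l m r : List ℕ} {g g' : Stmt} {p : List Stmt} (hu : Uniq l (g :: g' :: p))
    (e : l.Perm (g.i ++ (g'.i ++ r))) (h : WF l (g :: g' :: p) m) (h' : WF l (g' :: g :: p) m) :
    den M l (g :: g' :: p) m h = den M l (g' :: g :: p) m h' := by
  have k (a b : List ℕ) : (a ++ (b ++ r)).Perm (b ++ (a ++ r)) := perm_append_left_comm a b r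
  have h₁ : WF (g.o ++ (g'.i ++ r)) (g' :: p) m :=
    h.2.2.of_perm ((perm_diff_of_perm_append e).append_left _)
  have h₂ : WF (g'.o ++ (g.o ++ r)) p m :=
    h₁.2.2.of_perm ((perm_diff_of_perm_append (k g.o g'.i)).append_left _)
  have h₃ : WF (g'.o ++ (g.i ++ r)) (g :: p) m :=
    h'.2.2.of_perm ((perm_diff_of_perm_append (e.trans (k _ _))).append_left _)
  have h₄ : WF (g.o ++ (g'.o ++ r)) p m := h₂.of_perm (k _ _)
  have hn := (e.append_right _).nodup_iff.1 hu
  simp only [List.flatMap_cons] at hn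
  rw [den_cons_of_perm M h e h₁, den_cons_of_perm M h₁ (k _ _) h₂,
    den_cons_of_perm M h' (e.trans (k _ _)) h₃, den_cons_of_perm M h₃ (k _ _) h₄,
    den_of_perm M (k _ _) h₄ h₂]
  have := g.act_act M g' h.1 h'.1 r (by grind [List.nodup_append]) (by grind [List.nodup_append])
    (by grind [List.nodup_append]) (by grind [List.nodup_append])
    (k _ _) (k _ _) (k _ _) (k _ _)
  rw [reassoc_of% this]
  simp

lemma WF.mem_input {l m : List ℕ} {p : List Stmt} (h : WF l p m) {g : Stmt} (hg : g ∈ p) {a : ℕ}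
    (ha : a ∈ g.i) : a ∈ l ∨ a ∈ p.flatMap Stmt.o := by
  induction p generalizing l with
  | nil => simp at hg
  | cons g' p ih =>
    rcases List.mem_cons.1 hg with rfl | hg
    · exact Or.inl (h.2.1.mem_iff.2 (by simp [ha]))
    · have := ih h.2.2 hg
      have : a ∈ l.diff g'.i → a ∈ l := fun h => List.diff_subset _ _ h
      simp only [List.mem_append, List.flatMap_cons] at *
      tauto

lemma den_move {l m r : List ℕ} {g : Stmt} {p q : List Stmt} (hu : Uniq l (p ++ g :: q))
    (e : l.Perm (g.i ++ r)) (h : WF l (p ++ g :: q) m) :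
    ∃ h' : WF l (g :: (p ++ q)) m, den M l (p ++ g :: q) m h = den M l (g :: (p ++ q)) m h' := by
  induction p generalizing l r with
  | nil => exact ⟨h, rfl⟩
  | cons g' p ih =>
    obtain ⟨s, e', hs⟩ := h.exists_cons
    have hn : (l ++ (g'.o ++ (p ++ g :: q).flatMap Stmt.o)).Nodup := hu
    -- The inputs of `g` exist from the start. Since names are never reused, they are not outputs of
    -- `g'` or of a later statement, so they are among the wires left untouched by `g'`.
    have hsub : ∀ a ∈ g.i, a ∈ s := by
      intro a ha
      have h₁ := hs.mem_input (g := g) (by simp) ha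
      have h₂ : a ∈ l := e.mem_iff.2 (by simp [ha])
      have hd := List.disjoint_of_nodup_append hn h₂
      simp only [List.mem_append] at hd h₁
      rcases h₁ with (h₁ | h₁) | h₁
      · exact absurd (Or.inl h₁) hd
      · exact h₁
      · exact absurd (Or.inr h₁) hd
    have hgi : g.i.Nodup := (e.nodup_iff.1 hn.of_append_left).of_append_left
    have ht : s.Perm (g.i ++ s.diff g.i) :=
      (List.subperm_append_diff_self_of_count_le fun a ha =>
        List.subperm_iff_count.1 (hgi.subperm hsub) a).symm
    generalize s.diff g.i = t at ht
    have e₁ : (g'.o ++ s).Perm (g.i ++ (g'.o ++ t)) :=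
      (ht.append_left _).trans (perm_append_left_comm _ _ _)
    have e₂ : l.Perm (g'.i ++ (g.i ++ t)) := e'.trans (ht.append_left _)
    obtain ⟨h₁, h₂⟩ := ih (hu.tail e') e₁ hs
    have h₃ : WF l (g' :: g :: (p ++ q)) m := WF.cons h.1 e' h₁
    have hu' : Uniq l (g' :: g :: (p ++ q)) := by
      refine (List.Perm.nodup_iff (List.Perm.append_left l ?_)).1 hu
      exact (List.Perm.flatMap_right _ (List.Perm.cons _ List.perm_middle))
    refine ⟨h₃.swap e₂, ?_⟩
    refine Eq.trans ?_ (den_swap M hu' e₂ h₃ _)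
    refine (den_cons_of_perm M h e' hs).trans ?_
    exact (congrArg (fun f => permHom M.X e' ≫ g'.act M h.1 s ≫ f) h₂).trans
      (den_cons_of_perm M h₃ e' h₁).symm

/-- A program means no more than its string diagram. The first statement of `q` can be executed at
once, so it can be moved to the front of `p`; then induction. -/
theorem den_reorder {l m : List ℕ} {p q : List Stmt} (e : p.Perm q) (hu : Uniq l p)
    (h : WF l p m) (h' : WF l q m) : den M l p m h = den M l q m h' := by
  induction q generalizing l p with
  | nil => obtain rfl := e.eq_nil; rfl
  | cons g q ih =>
    obtain ⟨p₁, p₂, rfl⟩ := List.append_of_mem (e.mem_iff.2 List.mem_cons_self)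
    obtain ⟨r, e₁, hr⟩ := h'.exists_cons
    obtain ⟨h₁, h₂⟩ := den_move M hu e₁ h
    have hu' : Uniq l (g :: (p₁ ++ p₂)) :=
      (List.Perm.nodup_iff (List.Perm.append_left l
        (List.Perm.flatMap_right _ List.perm_middle))).1 hu
    have h₃ : WF (g.o ++ r) (p₁ ++ p₂) m :=
      h₁.2.2.of_perm ((perm_diff_of_perm_append e₁).append_left _)
    rw [h₂, den_cons_of_perm M h₁ e₁ h₃, den_cons_of_perm M h' e₁ hr,
      ih (List.perm_middle.symm.trans e).cons_inv (hu'.tail e₁) h₃ hr]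

theorem den_rename {σ : ℕ → ℕ} (hσ : ∀ a, wireType (σ a) = wireType a) {l m : List ℕ}
    {p : List Stmt} (h : WF l p m) (hu : Uniq (l.map σ) (p.map (Stmt.rename σ))) (e₁ e₂) :
    ∃ h', den M (l.map σ) (p.map (Stmt.rename σ)) (m.map σ) h' =
      eqToHom e₁ ≫ den M l p m h ≫ eqToHom e₂ := by
  induction p generalizing l with
  | nil =>
    exact ⟨List.Perm.map σ h, permHom_rename M.X h hu.of_append_left (fun a _ => hσ a) e₁ e₂⟩
  | cons g p ih =>
    obtain ⟨r, e, hr⟩ := h.exists_cons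
    have e' : (l.map σ).Perm (g.i.map σ ++ r.map σ) := by
      rw [← List.map_append]; exact e.map σ
    have k (l : List ℕ) : obj M.X (l.map σ) = obj M.X l :=
      obj_congr M.X (map_wireType_of_forall fun a _ => hσ a)
    have k' (l l' : List ℕ) : obj M.X (l.map σ ++ l'.map σ) = obj M.X (l ++ l') := by
      rw [← List.map_append]; exact k _
    have hu' : Uniq ((g.o ++ r).map σ) (p.map (Stmt.rename σ)) := by
      rw [List.map_append]; exact Uniq.tail (g := g.rename σ) hu e'
    obtain ⟨h₁, h₂⟩ := ih hr hu' (k _)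
    have h₃ : WF (g.o.map σ ++ r.map σ) (p.map (Stmt.rename σ)) (m.map σ) := by
      rwa [← List.map_append]
    have h₄ : den M (g.o.map σ ++ r.map σ) (p.map (Stmt.rename σ)) (m.map σ) h₃ =
        eqToHom (k' _ _) ≫ den M (g.o ++ r) p m hr ≫ eqToHom e₂ := by
      rw [den_of_perm M (List.Perm.of_eq List.map_append.symm) h₃ h₁, h₂,
        permHom_eq M.X List.map_append.symm]
      simp
    have h₅ : permHom M.X e' = eqToHom (k l) ≫ permHom M.X e ≫ eqToHom (k' _ _).symm := by
      rw [← permHom_comp M.X (e.map σ) (List.Perm.of_eq List.map_append),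
        permHom_rename M.X e hu.of_append_left (fun a _ => hσ a) (k _) (k _).symm,
        permHom_eq M.X List.map_append]
      simp
    refine ⟨WF.cons (h.1.rename hσ) e' h₃, ?_⟩
    refine (den_cons_of_perm M (g := g.rename σ) _ e' h₃).trans ?_
    have key (F : obj M.X (g.i.map σ ++ r.map σ) ⟶ obj M.X (g.o.map σ ++ r.map σ))
        (hF : F = eqToHom (k' _ _) ≫ g.act M h.1 r ≫ eqToHom (k' _ _).symm) :
        permHom M.X e' ≫ F ≫ den M _ _ _ h₃ = eqToHom e₁ ≫ den M l (g :: p) m h ≫ eqToHom e₂ := by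
      rw [hF, h₄, h₅, den_cons_of_perm M h e hr]
      simp
    exact key _ (Stmt.act_rename M hσ h.1 r _ _)

end Symmetric

end

/-! ### Compilation of formal morphisms to programs -/

section

/-- Formal morphisms. -/
inductive Expr : Ob → Ob → Type
  | id (A : Ob) : Expr A A
  | comp {A B D : Ob} (f : Expr A B) (g : Expr B D) : Expr A D
  | tensor {A B A' B' : Ob} (f : Expr A B) (g : Expr A' B') : Expr (.tensor A A') (.tensor B B')
  | whiskerLeft (A : Ob) {B B' : Ob} (f : Expr B B') : Expr (.tensor A B) (.tensor A B')
  | whiskerRight {A A' : Ob} (f : Expr A A') (B : Ob) : Expr (.tensor A B) (.tensor A' B)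
  | assoc (A B D : Ob) : Expr (.tensor (.tensor A B) D) (.tensor A (.tensor B D))
  | assocInv (A B D : Ob) : Expr (.tensor A (.tensor B D)) (.tensor (.tensor A B) D)
  | lunit (A : Ob) : Expr (.tensor .unit A) A
  | lunitInv (A : Ob) : Expr A (.tensor .unit A)
  | runit (A : Ob) : Expr (.tensor A .unit) A
  | runitInv (A : Ob) : Expr A (.tensor A .unit)
  | braid (A B : Ob) : Expr (.tensor A B) (.tensor B A)
  | op (k : Op) : Expr k.dom k.cod

/-- Names for the outputs of an operation. -/
def freshNames : ℕ → List ℕ → List ℕ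
  | _, [] => []
  | k, t :: s => (2 * k + t) :: freshNames (k + 1) s

/-- The result of the compilation of a formal morphism: the program, the names of its outputs, and
the next fresh name. -/
structure Compiled where
  /-- the program -/
  p : List Stmt
  /-- the names of the outputs -/
  m : List ℕ
  /-- the next fresh name -/
  k : ℕ

/-- Compilation of a formal morphism with given names of the inputs. -/
def Expr.compile : ∀ {A B : Ob}, Expr A B → List ℕ → ℕ → Compiled
  | _, _, .id _, l, k => ⟨[], l, k⟩
  | _, _, .comp f g, l, k =>
    let c := f.compile l k
    let d := g.compile c.m c.k
    ⟨c.p ++ d.p, d.m, d.k⟩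
  | _, _, .tensor (A := A) f g, l, k =>
    let c := f.compile (l.take A.flat.length) k
    let d := g.compile (l.drop A.flat.length) c.k
    ⟨c.p ++ d.p, c.m ++ d.m, d.k⟩
  | _, _, .whiskerLeft A f, l, k =>
    let c := f.compile (l.drop A.flat.length) k
    ⟨c.p, l.take A.flat.length ++ c.m, c.k⟩
  | _, _, .whiskerRight (A := A) f _, l, k =>
    let c := f.compile (l.take A.flat.length) k
    ⟨c.p, c.m ++ l.drop A.flat.length, c.k⟩
  | _, _, .assoc _ _ _, l, k => ⟨[], l, k⟩
  | _, _, .assocInv _ _ _, l, k => ⟨[], l, k⟩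
  | _, _, .lunit _, l, k => ⟨[], l, k⟩
  | _, _, .lunitInv _, l, k => ⟨[], l, k⟩
  | _, _, .runit _, l, k => ⟨[], l, k⟩
  | _, _, .runitInv _, l, k => ⟨[], l, k⟩
  | _, _, .braid A _, l, k => ⟨[], l.drop A.flat.length ++ l.take A.flat.length, k⟩
  | _, _, .op o, l, k =>
    let m := freshNames k o.cod.flat
    ⟨[⟨o, l, m⟩], m, k + o.cod.flat.length⟩

section Monoidal

variable {C : Type u} [Category.{v} C] [MonoidalCategory C] (X : Bool → C)

/-- The wires `l` have the types of the atoms of `A`. -/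
def Labels (A : Ob) (l : List ℕ) : Prop := l.map wireType = A.flat.map wireType

/-- A formal object is the tensor product of wires with the right types. -/
def lab (A : Ob) (l : List ℕ) (h : Labels A l) : A.eval X ≅ obj X l :=
  flatIso X A ≪≫ eqToIso (obj_congr X h.symm)

lemma Labels.exists_append {A B : Ob} {l : List ℕ} (h : Labels (.tensor A B) l) :
    ∃ n m, l = n ++ m ∧ Labels A n ∧ Labels B m ∧ n.length = A.flat.length := by
  rw [Labels, Ob.flat, List.map_append, List.map_eq_append_iff] at h
  obtain ⟨n, m, rfl, h₁, h₂⟩ := h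
  exact ⟨n, m, rfl, h₁, h₂, by simpa using congrArg List.length h₁⟩

lemma Labels.append {A B : Ob} {n m : List ℕ} (h : Labels A n) (k : Labels B m) :
    Labels (.tensor A B) (n ++ m) := by
  rw [Labels, Ob.flat, List.map_append, List.map_append, h, k]

lemma lab_tensor {A B : Ob} {n m : List ℕ} (h : Labels A n) (k : Labels B m) :
    (lab X (.tensor A B) (n ++ m) (h.append k)).hom =
      ((lab X A n h).hom ⊗ₘ (lab X B m k).hom) ≫ (app X n m).hom := by
  have e := app_eqToHom X h.symm k.symm
  simp only [lab, flatIso, Iso.trans_hom, eqToIso.hom, Category.assoc, tensorIso_hom]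
  rw [← tensorHom_comp_tensorHom, Category.assoc, e]

lemma freshNames_labels (A : Ob) (k : ℕ) : Labels A (freshNames k A.flat) := by
  rw [Labels]
  generalize A.flat = s
  induction s generalizing k with
  | nil => rfl
  | cons t s ih =>
    rw [freshNames, List.map_cons, List.map_cons, ih]
    simp [wireType]

lemma lab_unit (h : Labels .unit []) : (lab X .unit [] h).hom = 𝟙 (𝟙_ C) := by
  simp [lab, flatIso]

lemma Labels.eq_nil {l : List ℕ} (h : Labels .unit l) : l = [] := by
  simpa [Labels, Ob.flat] using h

lemma comp_assoc_lab (A B D : Ob) (l : List ℕ) (hl : Labels (.tensor (.tensor A B) D) l)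
    (hl' : Labels (.tensor A (.tensor B D)) l) :
    (α_ _ _ _).hom ≫ (lab X (.tensor A (.tensor B D)) l hl').hom =
      (lab X (.tensor (.tensor A B) D) l hl).hom := by
  obtain ⟨n', r, rfl, hn', hr, -⟩ := hl.exists_append
  obtain ⟨n, m, rfl, hn, hm, -⟩ := hn'.exists_append
  have e : (lab X (.tensor A (.tensor B D)) ((n ++ m) ++ r) hl').hom =
      (lab X (.tensor A (.tensor B D)) (n ++ (m ++ r)) (hn.append (hm.append hr))).hom ≫
        eqToHom (by rw [List.append_assoc]) := by
    simp [lab]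
  have a := app_assoc X n m r
  rw [e, lab_tensor X hn (hm.append hr), lab_tensor X hm hr, lab_tensor X (hn.append hm) hr,
    lab_tensor X hn hm]
  generalize (lab X A n hn).hom = f
  generalize (lab X B m hm).hom = g
  generalize (lab X D r hr).hom = h
  have e₁ : ((f ⊗ₘ g) ≫ (app X n m).hom) ⊗ₘ h = ((f ⊗ₘ g) ⊗ₘ h) ≫ (app X n m).hom ▷ _ := by
    rw [← tensorHom_id, tensorHom_comp_tensorHom, Category.comp_id]
  have e₂ : f ⊗ₘ ((g ⊗ₘ h) ≫ (app X m r).hom) = (f ⊗ₘ (g ⊗ₘ h)) ≫ _ ◁ (app X m r).hom := by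
    rw [← id_tensorHom, tensorHom_comp_tensorHom, Category.comp_id]
  simp only [e₁, e₂, Category.assoc]
  rw [a, associator_naturality_assoc]

end Monoidal

section Symmetric

variable {C : Type u} [Category.{v} C] [MonoidalCategory C] [SymmetricCategory C] (M : Model C)

/-- The interpretation of a formal morphism. -/
@[reducible] def Expr.eval : ∀ {A B : Ob}, Expr A B → (A.eval M.X ⟶ B.eval M.X)
  | _, _, .id _ => 𝟙 _
  | _, _, .comp f g => f.eval ≫ g.eval
  | _, _, .tensor f g => f.eval ⊗ₘ g.eval
  | _, _, .whiskerLeft A f => A.eval M.X ◁ f.eval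
  | _, _, .whiskerRight f B => f.eval ▷ B.eval M.X
  | _, _, .assoc _ _ _ => (α_ _ _ _).hom
  | _, _, .assocInv _ _ _ => (α_ _ _ _).inv
  | _, _, .lunit _ => (λ_ _).hom
  | _, _, .lunitInv _ => (λ_ _).inv
  | _, _, .runit _ => (ρ_ _).hom
  | _, _, .runitInv _ => (ρ_ _).inv
  | _, _, .braid _ _ => (β_ _ _).hom
  | _, _, .op k => M.sem k

lemma Uniq.of_append_left {l : List ℕ} {p q : List Stmt} (h : Uniq l (p ++ q)) : Uniq l p := by
  rw [Uniq, List.flatMap_append, ← List.append_assoc] at h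
  exact h.of_append_left

lemma Uniq.of_append_right {l m : List ℕ} {p q : List Stmt} (h : Uniq l (p ++ q)) (w : WF l p m) :
    Uniq m q := by
  induction p generalizing l with
  | nil => exact (List.Perm.nodup_iff (List.Perm.append_right _ w)).1 h
  | cons g p ih => exact ih (Uniq.tail (p := p ++ q) h w.2.1) w.2.2

lemma Uniq.of_sublist {l m : List ℕ} {p : List Stmt} (h : Uniq l p) (e : m.Sublist l) : Uniq m p :=
  h.sublist (e.append_right _)

lemma WF.frame {l m : List ℕ} (r : List ℕ) {p : List Stmt} (h : WF l p m) :
    WF (l ++ r) p (m ++ r) := by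
  induction p generalizing l with
  | nil => exact List.Perm.append_right r h
  | cons g p ih =>
    obtain ⟨s, e, hs⟩ := h.exists_cons
    refine WF.cons h.1 (r := s ++ r) ?_ ?_
    · rw [← List.append_assoc]; exact e.append_right r
    · rw [← List.append_assoc]; exact ih hs

lemma WF.frame_left {l m : List ℕ} (r : List ℕ) {p : List Stmt} (h : WF l p m) :
    WF (r ++ l) p (r ++ m) :=
  ((h.frame r).of_perm List.perm_append_comm).perm_right List.perm_append_comm

/-- Spectators on the left are reduced to spectators on the right by conjugation with the braiding.
-/
lemma den_frame_left {l m : List ℕ} (r : List ℕ) {p : List Stmt} (hu : Uniq (r ++ l) p)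
    (h : WF l p m) (h' : WF (r ++ l) p (r ++ m)) :
    (app M.X r l).hom ≫ den M (r ++ l) p (r ++ m) h' =
      obj M.X r ◁ den M l p m h ≫ (app M.X r m).hom := by
  have k (a b : List ℕ) : (a ++ b).Perm (b ++ a) := List.perm_append_comm
  have n₁ : (r ++ l).Nodup := List.Nodup.of_append_left hu
  have n₂ : (m ++ r).Nodup := by
    have := Uniq.of_append_right (q := []) (m := m ++ r) (by simpa using hu)
      ((h.frame r).of_perm (k _ _))
    simpa [Uniq] using this
  have hu' : Uniq l p := hu.of_sublist (List.sublist_append_right _ _)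
  rw [den_of_perm M (k r l) h' ((h.frame r).perm_right (k _ _)),
    den_perm_right M (h.frame r) (k m r), reassoc_of% (permHom_braid M.X n₁ (k r l)),
    reassoc_of% (den_frame M r hu' h (h.frame r)), permHom_braid M.X n₂ (k m r)]
  simp

/-- A compiled program computes the given morphism. -/
def Realizes {A B : Ob} (f : A.eval M.X ⟶ B.eval M.X) (l : List ℕ) (hl : Labels A l)
    (p : List Stmt) (m : List ℕ) : Prop :=
  ∃ (hm : Labels B m) (h : WF l p m),
    f ≫ (lab M.X B m hm).hom = (lab M.X A l hl).hom ≫ den M l p m h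

lemma realizes_nil {A B : Ob} {f : A.eval M.X ⟶ B.eval M.X} {l : List ℕ} {hl : Labels A l}
    (hl' : Labels B l) (e : f ≫ (lab M.X B l hl').hom = (lab M.X A l hl).hom) :
    Realizes M f l hl [] l :=
  ⟨hl', List.Perm.refl _, e.trans (by
    have h : den M l [] l (List.Perm.refl _) = 𝟙 _ := permHom_refl M.X _
    exact ((congrArg _ h).trans (Category.comp_id _)).symm)⟩

/-- Associators, unitors and braidings compile to empty programs: the coherence isomorphisms keep
the list of wires and a braiding only permutes it. All coherence bookkeeping is absorbed here. -/
theorem Expr.realizes_compile {A B : Ob} (e : Expr A B) (l : List ℕ) (k : ℕ) (hl : Labels A l)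
    (hu : Uniq l (e.compile l k).p) :
    Realizes M (e.eval M) l hl (e.compile l k).p (e.compile l k).m := by
  induction e generalizing l k with
  | id A => exact realizes_nil M hl (Category.id_comp _)
  | comp f g ihf ihg =>
    obtain ⟨hm, h, e⟩ := ihf l k hl hu.of_append_left
    obtain ⟨hm', h', e'⟩ := ihg _ _ hm (hu.of_append_right h)
    refine ⟨hm', h.append h', ?_⟩
    rw [Expr.eval, Category.assoc]
    refine (congrArg (f.eval M ≫ ·) e').trans ?_
    rw [reassoc_of% e]
    exact congrArg ((lab M.X _ l hl).hom ≫ ·) (den_append M h h' _).symm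
  | @tensor A B A' B' f g ihf ihg =>
    obtain ⟨n, m, rfl, hn, hm, hlen⟩ := hl.exists_append
    have hc : (tensor f g).compile (n ++ m) k =
        ⟨(f.compile n k).p ++ (g.compile m (f.compile n k).k).p,
          (f.compile n k).m ++ (g.compile m (f.compile n k).k).m,
          (g.compile m (f.compile n k).k).k⟩ := by
      simp only [compile, ← hlen, List.take_left, List.drop_left]
    rw [hc] at hu ⊢
    obtain ⟨hn', h₁, e₁⟩ := ihf n k hn (hu.of_append_left.of_sublist (List.sublist_append_left _ _))
    have hu' := hu.of_append_right (h₁.frame m)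
    obtain ⟨hm', h₂, e₂⟩ := ihg m _ hm (hu'.of_sublist (List.sublist_append_right _ _))
    -- The tensor product is executed sequentially: `f` with the inputs of `g` as spectators, then
    -- `g` with the outputs of `f` as spectators.
    refine ⟨hn'.append hm', (h₁.frame m).append (h₂.frame_left _), ?_⟩
    rw [lab_tensor M.X hn' hm', lab_tensor M.X hn hm,
      den_append M (h₁.frame m) (h₂.frame_left _), Category.assoc,
      reassoc_of% (den_frame M m (hu.of_append_left.of_sublist (List.sublist_append_left _ _)) h₁),
      den_frame_left M _ hu' h₂, tensorHom_comp_tensorHom_assoc, e₁, e₂,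
      ← tensorHom_comp_tensorHom_assoc, tensorHom_def (den M _ _ _ h₁), Category.assoc]
  | @whiskerLeft A B B' f ih =>
    obtain ⟨n, m, rfl, hn, hm, hlen⟩ := hl.exists_append
    have hc : (whiskerLeft A f).compile (n ++ m) k =
        ⟨(f.compile m k).p, n ++ (f.compile m k).m, (f.compile m k).k⟩ := by
      simp only [compile, ← hlen, List.take_left, List.drop_left]
    rw [hc] at hu ⊢
    obtain ⟨hm', h₂, e₂⟩ := ih m k hm (hu.of_sublist (List.sublist_append_right _ _))
    refine ⟨hn.append hm', h₂.frame_left _, ?_⟩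
    rw [lab_tensor M.X hn hm', lab_tensor M.X hn hm, Category.assoc, den_frame_left M _ hu h₂,
      Expr.eval, ← id_tensorHom, tensorHom_comp_tensorHom_assoc, e₂, ← id_tensorHom,
      tensorHom_comp_tensorHom_assoc]
    simp
  | @whiskerRight A A' f B ih =>
    obtain ⟨n, m, rfl, hn, hm, hlen⟩ := hl.exists_append
    have hc : (whiskerRight f B).compile (n ++ m) k =
        ⟨(f.compile n k).p, (f.compile n k).m ++ m, (f.compile n k).k⟩ := by
      simp only [compile, ← hlen, List.take_left, List.drop_left]
    rw [hc] at hu ⊢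
    have hu' := hu.of_sublist (List.sublist_append_left n m)
    obtain ⟨hn', h₁, e₁⟩ := ih n k hn hu'
    refine ⟨hn'.append hm, h₁.frame _, ?_⟩
    rw [lab_tensor M.X hn' hm, lab_tensor M.X hn hm, Category.assoc, den_frame M m hu' h₁,
      Expr.eval, ← tensorHom_id, tensorHom_comp_tensorHom_assoc, e₁, ← tensorHom_id,
      tensorHom_comp_tensorHom_assoc]
    simp
  | assoc A B D =>
    have hl' : Labels (.tensor A (.tensor B D)) l := by simpa [Labels, Ob.flat] using hl
    exact realizes_nil M hl' (comp_assoc_lab M.X A B D l hl hl')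
  | assocInv A B D =>
    have hl' : Labels (.tensor (.tensor A B) D) l := by simpa [Labels, Ob.flat] using hl
    refine realizes_nil M hl' ?_
    rw [Expr.eval, Iso.inv_comp_eq, comp_assoc_lab M.X A B D l hl' hl]
  | lunit A =>
    obtain ⟨n, m, rfl, hn, hm, hlen⟩ := hl.exists_append
    obtain rfl := hn.eq_nil
    refine realizes_nil M hm ?_
    refine Eq.trans ?_ (lab_tensor M.X hn hm).symm
    rw [lab_unit M.X, app_nil]
    simp
  | lunitInv A =>
    have hn : Labels .unit [] := rfl
    refine realizes_nil M (hn.append hl) ?_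
    refine (congrArg ((λ_ _).inv ≫ ·) (lab_tensor M.X hn hl)).trans ?_
    rw [lab_unit M.X, app_nil]
    simp
  | runit A =>
    obtain ⟨n, m, rfl, hn, hm, hlen⟩ := hl.exists_append
    obtain rfl := hm.eq_nil
    have e : (lab M.X A (n ++ []) (by simpa using hn)).hom =
      (lab M.X A n hn).hom ≫ eqToHom (by simp) := by simp [lab]
    refine realizes_nil M (by simpa using hn) ?_
    rw [lab_tensor M.X hn hm, lab_unit M.X, app_nil_right, e]
    simp
  | runitInv A =>
    have hn : Labels .unit [] := rfl
    have hl' : Labels (.tensor A .unit) l := by simpa [Labels, Ob.flat] using hl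
    have e : (lab M.X (.tensor A .unit) l hl').hom =
      (lab M.X (.tensor A .unit) (l ++ []) (hl.append hn)).hom ≫ eqToHom (by simp) := by simp [lab]
    refine realizes_nil M hl' ?_
    rw [e, lab_tensor M.X hl hn, lab_unit M.X, app_nil_right]
    simp
  | braid A B =>
    obtain ⟨n, m, rfl, hn, hm, hlen⟩ := hl.exists_append
    have hc : (braid A B).compile (n ++ m) k = ⟨[], m ++ n, k⟩ := by
      simp only [compile, ← hlen, List.take_left, List.drop_left]
    rw [hc] at hu ⊢
    refine ⟨hm.append hn, List.perm_append_comm, ?_⟩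
    refine Eq.trans ?_ ((congrArg ((lab M.X _ (n ++ m) hl).hom ≫ ·)
      (den_nil M (List.perm_append_comm : (n ++ m).Perm (m ++ n)))).symm)
    rw [lab_tensor M.X hm hn, lab_tensor M.X hn hm]
    have hp := permHom_braid M.X (List.Nodup.of_append_left hu)
      (List.perm_append_comm : (n ++ m).Perm (m ++ n))
    simp only [Category.assoc]
    rw [hp]
    simp
  | op o =>
    have hm := freshNames_labels o.cod k
    set m := freshNames k o.cod.flat with hmdef
    have h : WF l [⟨o, l, m⟩] m := WF.cons ⟨hl, hm⟩ (r := []) (by simp) (by simp [WF])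
    have key : den M l [⟨o, l, m⟩] m h =
        (lab M.X _ l hl).inv ≫ M.sem o ≫ (lab M.X _ m hm).hom := by
      have h₀ : l.Perm (l ++ []) := by simp
      have h₁ : (m ++ []).Perm m := by simp
      have e₁ := app_nil_right M.X l
      have e₂ := app_nil_right M.X m
      refine (den_cons_of_perm M h (r := []) h₀ h₁).trans ?_
      refine (congrArg (fun f => permHom M.X h₀ ≫ Stmt.act M ⟨o, l, m⟩ h.1 [] ≫ f)
        ((den_nil M h₁).trans (permHom_eq M.X (by simp) _))).trans ?_
      rw [permHom_eq M.X (by simp) h₀]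
      have e₃ : (app M.X l []).inv = eqToHom (by simp) ≫ (ρ_ (obj M.X l)).inv := by
        rw [← cancel_epi (app M.X l []).hom, Iso.hom_inv_id, e₁]; simp
      change _ ≫ ((app M.X l []).inv ≫ (Stmt.hom M ⟨o, l, m⟩ h.1) ▷ 𝟙_ C ≫ (app M.X m []).hom) ≫
        _ = _
      rw [e₂, e₃]
      simp [Stmt.hom, lab]
    exact ⟨hm, h, (Eq.trans (by simp) (congrArg ((lab M.X _ l hl).hom ≫ ·) key.symm) :
      M.sem o ≫ (lab M.X _ m hm).hom = _)⟩

end Symmetric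

end

/-! ### Rewriting of subdiagrams -/

section

/-- A program together with the list of its outputs. -/
structure Prog where
  /-- the statements -/
  p : List Stmt
  /-- the outputs -/
  m : List ℕ

/-- Renaming of the wires of a program. -/
def Prog.rename (σ : ℕ → ℕ) (P : Prog) : Prog := ⟨P.p.map (Stmt.rename σ), P.m.map σ⟩

/-- A rewrite rule for programs with inputs `l`. The names occurring in it are less than `w`. -/
structure Rule where
  /-- the inputs -/
  l : List ℕ
  /-- the left hand side -/
  L : Prog
  /-- the right hand side -/
  R : Prog
  /-- a bound for the names -/
  w : ℕ

/-- The reversed rule. -/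
def Rule.symm (r : Rule) : Rule := ⟨r.l, r.R, r.L, r.w⟩

/-- A partial renaming of wires. -/
abbrev Subst := List (ℕ × ℕ)

/-- The value of a partial renaming. -/
def Subst.get? : Subst → ℕ → Option ℕ
  | [], _ => none
  | (a, b) :: σ, n => bif Nat.beq a n then some b else Subst.get? σ n

/-- Extension of a partial renaming by the translation by `b`. -/
def Subst.extend (σ : Subst) (b n : ℕ) : ℕ := (σ.get? n).getD (n + b)

/-- A partial renaming preserves the types of the wires. -/
def Subst.typed : Subst → Bool
  | [] => true
  | (a, b) :: σ => Nat.beq (a % 2) (b % 2) && Subst.typed σ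

/-- `b` is a value of the partial renaming. -/
def Subst.hasValue : Subst → ℕ → Bool
  | [], _ => false
  | (_, b) :: σ, n => Nat.beq b n || Subst.hasValue σ n

/-- Extension of a partial renaming by `a ↦ b`. -/
def Subst.bind (σ : Subst) (a b : ℕ) : Option Subst :=
  match σ.get? a with
  | some c => bif Nat.beq b c then some σ else none
  | none => bif σ.hasValue b then none else some ((a, b) :: σ)

/-- Extension of a partial renaming by a list of values. -/
def Subst.bindList : Subst → List ℕ → List ℕ → Option Subst
  | σ, a :: l, b :: m =>
    match σ.bind a b with
    | some σ' => Subst.bindList σ' l m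
    | none => none
  | σ, [], [] => some σ
  | _, _, _ => none

/-- The first successful value of a function on a list. -/
def firstSome {α β : Type} (f : α → Option β) : List α → Option β
  | [] => none
  | a :: l =>
    match f a with
    | some b => some b
    | none => firstSome f l

lemma exists_of_firstSome {α β : Type} {f : α → Option β} {l : List α} {b : β}
    (h : firstSome f l = some b) : ∃ a, f a = some b := by
  induction l with
  | nil => simp [firstSome] at h
  | cons a l ih =>
    rw [firstSome] at h
    split at h
    · exact ⟨a, by grind⟩
    · exact ih h

/-- Search for the statements of a pattern in a program. -/
def matchAll {β : Type} (p : List Stmt) : List Stmt → Subst → (Subst → Option β) → Option β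
  | [], σ, k => k σ
  | g :: q, σ, k => firstSome (fun s => bif Nat.beq g.op.toNat s.op.toNat then
      match σ.bindList g.o s.o with
      | some σ' =>
        match σ'.bindList g.i s.i with
        | some σ'' => matchAll p q σ'' k
        | none => none
      | none => none
    else none) p

/-- Nothing is claimed about the match found: the continuation `k` carries out all checks by itself.
-/
lemma exists_of_matchAll {β : Type} {p q : List Stmt} {σ : Subst} {k : Subst → Option β} {b : β}
    (h : matchAll p q σ k = some b) : ∃ σ', k σ' = some b := by
  induction q generalizing σ with
  | nil => exact ⟨σ, h⟩
  | cons g q ih =>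
    obtain ⟨s, hs⟩ := exists_of_firstSome h
    grind

/-- Equality test for lists of natural numbers. -/
def eqNats : List ℕ → List ℕ → Bool
  | [], [] => true
  | a :: l, b :: m => Nat.beq a b && eqNats l m
  | _, _ => false

lemma eqNats_iff : ∀ {l m : List ℕ}, eqNats l m = true → l = m
  | [], [], _ => rfl
  | a :: l, b :: m, h => by
    simp only [eqNats, Bool.and_eq_true] at h
    rw [Nat.eq_of_beq_eq_true h.1, eqNats_iff h.2]
  | [], b :: m, h => by simp [eqNats] at h
  | a :: l, [], h => by simp [eqNats] at h

/-- Equality test for statements. -/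
def Stmt.beq (g s : Stmt) : Bool :=
  Nat.beq g.op.toNat s.op.toNat && (eqNats g.o s.o && eqNats g.i s.i)

lemma Stmt.eq_of_beq {g s : Stmt} (h : g.beq s = true) : g = s := by
  simp only [Stmt.beq, Bool.and_eq_true] at h
  obtain ⟨o, i, u⟩ := g
  obtain ⟨o', i', u'⟩ := s
  have h₁ : o = o' := Op.toNat_injective (Nat.eq_of_beq_eq_true h.1)
  have h₂ : i = i' := eqNats_iff h.2.2
  have h₃ : u = u' := eqNats_iff h.2.1
  rw [h₁, h₂, h₃]

/-- Removal of one element of a list. -/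
def remove {α : Type} (e : α → α → Bool) (a : α) : List α → Option (List α)
  | [] => none
  | b :: l => bif e a b then some l else (remove e a l).map (b :: ·)

lemma perm_of_remove {α : Type} {e : α → α → Bool} (he : ∀ {a b}, e a b = true → a = b) {a : α}
    {l m : List α} (h : remove e a l = some m) : l.Perm (a :: m) := by
  induction l generalizing m with
  | nil => simp [remove] at h
  | cons b l ih =>
    rw [remove, cond_eq_ite] at h
    split at h
    · next hab => rw [he hab]; simp only [Option.some.injEq] at h; rw [h]
    · obtain ⟨n, hn, rfl⟩ := Option.map_eq_some_iff.1 h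
      exact ((ih hn).cons b).trans (List.Perm.swap ..)

/-- Removal of the elements of a list. -/
def removeAll {α : Type} (e : α → α → Bool) : List α → List α → Option (List α)
  | [], l => some l
  | a :: d, l =>
    match remove e a l with
    | some l' => removeAll e d l'
    | none => none

lemma perm_of_removeAll {α : Type} {e : α → α → Bool} (he : ∀ {a b}, e a b = true → a = b)
    {d l m : List α} (h : removeAll e d l = some m) : l.Perm (d ++ m) := by
  induction d generalizing l with
  | nil => simp only [removeAll, Option.some.injEq] at h; rw [h]; rfl
  | cons a d ih =>
    rw [removeAll] at h
    split at h
    · next l' hl => exact (perm_of_remove he hl).trans ((ih h).cons a)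
    · simp at h

/-- Type check of a list of wires. -/
def checkTypes : List ℕ → List ℕ → Bool
  | [], [] => true
  | a :: l, b :: m => Nat.beq (a % 2) b && checkTypes l m
  | _, _ => false

lemma wireType_eq_of_mod {a b : ℕ} (h : a % 2 = b % 2) : wireType a = wireType b := by
  rw [wireType, wireType, h]

lemma checkTypes_sound {l m : List ℕ} (h : checkTypes l m = true) :
    l.map wireType = m.map wireType := by
  induction l generalizing m with
  | nil => cases m with
    | nil => rfl
    | cons b m => simp [checkTypes] at h
  | cons a l ih => cases m with
    | nil => simp [checkTypes] at h
    | cons b m =>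
      simp only [checkTypes, Bool.and_eq_true] at h
      have := Nat.eq_of_beq_eq_true h.1
      rw [List.map_cons, List.map_cons, ih h.2, wireType_eq_of_mod (a := a) (b := b) (by omega)]

/-- Type check of a statement. -/
def Stmt.check (g : Stmt) : Bool := checkTypes g.i g.op.dom.flat && checkTypes g.o g.op.cod.flat

lemma Stmt.check_sound {g : Stmt} (h : g.check = true) : g.Typed := by
  simp only [Stmt.check, Bool.and_eq_true] at h
  exact ⟨checkTypes_sound h.1, checkTypes_sound h.2⟩

/-- Execution of a program on a list of wires. -/
def exec : List ℕ → List Stmt → Option (List ℕ)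
  | l, [] => some l
  | l, g :: p =>
    match removeAll Nat.beq g.i l with
    | some r => bif g.check then exec (g.o ++ r) p else none
    | none => none

lemma wf_of_exec {l m : List ℕ} {p : List Stmt} (h : exec l p = some m) : WF l p m := by
  induction p generalizing l with
  | nil => simp only [exec, Option.some.injEq] at h; rw [h]; exact List.Perm.refl _
  | cons g p ih =>
    rw [exec] at h
    split at h
    · next r hr =>
      rw [cond_eq_ite] at h
      split at h
      · next hg =>
        exact WF.cons (Stmt.check_sound hg) (perm_of_removeAll Nat.eq_of_beq_eq_true hr) (ih h)
      · simp at h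
    · simp at h

/-- A test for lists without repetition. The numbers in `k` are excluded. -/
def nodupMask : ℕ → List ℕ → Bool
  | _, [] => true
  | k, a :: l => Nat.beq (Nat.land (Nat.shiftRight k a) 1) 0 &&
      nodupMask (Nat.lor k (Nat.shiftLeft 1 a)) l

/-- The binary digits of `k` record the names met so far, hence the second conclusion, which drives
the induction. -/
lemma nodupMask_sound {k : ℕ} {l : List ℕ} (h : nodupMask k l = true) :
    l.Nodup ∧ ∀ a ∈ l, k.testBit a = false := by
  induction l generalizing k with
  | nil => simp
  | cons a l ih =>
    simp only [nodupMask, Bool.and_eq_true] at h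
    obtain ⟨h₁, h₂⟩ := ih h.2
    have h₃ := Nat.eq_of_beq_eq_true h.1
    have h₄ : k.testBit a = false := by
      rw [Nat.testBit]
      have : (1 &&& (k >>> a)) = 0 := by rw [Nat.land_comm]; exact h₃
      simp [this]
    have h₅ : ∀ b ∈ l, k.testBit b = false ∧ a ≠ b := by
      intro b hb
      have := h₂ b hb
      have e : Nat.lor k (Nat.shiftLeft 1 a) = k ||| (1 <<< a) := rfl
      rw [e, Nat.testBit_or, Bool.or_eq_false_iff] at this
      refine ⟨this.1, ?_⟩
      rintro rfl
      simp [Nat.testBit_shiftLeft] at this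
    refine ⟨List.nodup_cons.2 ⟨fun ha => (h₅ a ha).2 rfl, h₁⟩, ?_⟩
    simp only [List.mem_cons, forall_eq_or_imp]
    exact ⟨h₄, fun b hb => (h₅ b hb).1⟩

/-- A test for programs with distinct names of the wires. -/
def checkUniq (l : List ℕ) (p : List Stmt) : Bool := nodupMask 0 (l ++ p.flatMap Stmt.o)

lemma checkUniq_sound {l : List ℕ} {p : List Stmt} (h : checkUniq l p = true) : Uniq l p :=
  (nodupMask_sound h).1

/-- Test for a permutation. -/
def checkPerm (l m : List ℕ) : Bool :=
  match removeAll Nat.beq m l with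
  | some [] => true
  | _ => false

lemma checkPerm_sound {l m : List ℕ} (h : checkPerm l m = true) : l.Perm m := by
  rw [checkPerm] at h
  split at h
  · next e => simpa using perm_of_removeAll Nat.eq_of_beq_eq_true e
  · simp at h

/-- The list meets the set of the digits of `k`. -/
def meets (k : ℕ) : List ℕ → Bool
  | [] => false
  | a :: l => Nat.beq (Nat.land (Nat.shiftRight k a) 1) 1 || meets k l

/-- The set of the digits of `k` and of the elements of the list. -/
def addMask (k : ℕ) : List ℕ → ℕ
  | [] => k
  | a :: l => addMask (Nat.lor k (Nat.shiftLeft 1 a)) l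

/-- The statements which depend on the wires given by the digits of `t`, and the other ones. -/
def split : ℕ → List Stmt → List Stmt × List Stmt
  | _, [] => ([], [])
  | t, g :: p => bif meets t g.i then
      match split (addMask t g.o) p with
      | (q, q') => (q, g :: q')
    else
      match split t p with
      | (q, q') => (g :: q, q')

/-- Nothing more is needed: whether the two halves can be executed in this order is tested by
`exec`. -/
lemma split_perm (t : ℕ) (p : List Stmt) : p.Perm ((split t p).1 ++ (split t p).2) := by
  induction p generalizing t with
  | nil => simp [split]
  | cons g p ih =>
    rw [split, cond_eq_ite]
    split
    · exact ((ih _).cons g).trans List.perm_middle.symm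
    · exact (ih _).cons g

lemma Subst.wireType_get? {σ : Subst} (h : σ.typed = true) {n m : ℕ} (e : σ.get? n = some m) :
    wireType m = wireType n := by
  induction σ with
  | nil => simp [Subst.get?] at e
  | cons x σ ih =>
    obtain ⟨a, b⟩ := x
    simp only [Subst.typed, Bool.and_eq_true] at h
    rw [Subst.get?, cond_eq_ite] at e
    split at e
    · next h' =>
      have h₁ := Nat.eq_of_beq_eq_true h.1
      have h₂ := Nat.eq_of_beq_eq_true h'
      simp only [Option.some.injEq] at e
      subst h₂ e
      exact wireType_eq_of_mod h₁.symm
    · exact ih h.2 e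

/-- Types are parities, so fresh names may only be produced by an even shift. -/
lemma Subst.wireType_extend {σ : Subst} (h : σ.typed = true) {b : ℕ} (hb : b % 2 = 0) (n : ℕ) :
    wireType (σ.extend b n) = wireType n := by
  rw [Subst.extend]
  cases e : σ.get? n with
  | none => exact wireType_eq_of_mod (by simp only [Option.getD_none]; omega)
  | some m => exact Subst.wireType_get? h e

/-- The application of a rewrite rule at the place given by a partial renaming. The number `b` is
an even bound for the names of the wires. -/
def applyAt (r : Rule) (l : List ℕ) (P : Prog) (b : ℕ) (σ : Subst) : Option Prog :=
  let L := r.L.rename (σ.extend b)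
  let R := r.R.rename (σ.extend b)
  let d := r.l.map (σ.extend b)
  match removeAll Stmt.beq L.p P.p with
  | none => none
  | some rest =>
    let pre := (split (addMask 0 L.m) rest).1
    let post := (split (addMask 0 L.m) rest).2
    match exec l pre with
    | none => none
    | some c =>
      match removeAll Nat.beq d c with
      | none => none
      | some s =>
        match exec (L.m ++ s) post with
        | none => none
        | some m =>
          let τ : Subst := L.m.zip R.m
          let post' := post.map (Stmt.rename (τ.extend 0))
          bif checkPerm m P.m && (Nat.beq (b % 2) 0 && (σ.typed && (τ.typed &&
              (checkUniq l P.p && (checkUniq d L.p && (checkUniq d R.p &&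
              (eqNats ((L.m ++ s).map (τ.extend 0)) (R.m ++ s) &&
              checkUniq (R.m ++ s) post'))))))) then
            some ⟨pre ++ (R.p ++ post'), P.m.map (τ.extend 0)⟩
          else none

variable {C : Type u} [Category.{v} C] [MonoidalCategory C] [SymmetricCategory C] (M : Model C)

/-- Two programs have the same interpretation. -/
def Same (l : List ℕ) (P Q : Prog) : Prop :=
  ∃ (h : WF l P.p P.m) (h' : WF l Q.p Q.m) (e : obj M.X P.m = obj M.X Q.m),
    den M l P.p P.m h ≫ eqToHom e = den M l Q.p Q.m h'

variable {M}

lemma Same.symm {l : List ℕ} {P Q : Prog} (h : Same M l P Q) : Same M l Q P := by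
  obtain ⟨h, h', e, k⟩ := h
  exact ⟨h', h, e.symm, by rw [← k]; simp⟩

lemma Same.trans {l : List ℕ} {P Q R : Prog} (h : Same M l P Q) (k : Same M l Q R) :
    Same M l P R := by
  obtain ⟨h, h', e, k₁⟩ := h
  obtain ⟨_, h'', e', k₂⟩ := k
  exact ⟨h, h'', e.trans e', by rw [← k₂, ← k₁]; simp⟩

lemma Same.refl {l : List ℕ} {P : Prog} (h : WF l P.p P.m) : Same M l P P :=
  ⟨h, h, rfl, by simp⟩

variable (M)

/-- The two sides of a rewrite rule have the same interpretation. -/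
def Rule.Valid (r : Rule) : Prop := Same M r.l r.L r.R

variable {M}

lemma Rule.Valid.symm {r : Rule} (h : r.Valid M) : r.symm.Valid M := Same.symm h

lemma Same.rename {l : List ℕ} {P Q : Prog} (h : Same M l P Q) {σ : ℕ → ℕ}
    (hσ : ∀ a, wireType (σ a) = wireType a) (u₁ : Uniq (l.map σ) (P.rename σ).p)
    (u₂ : Uniq (l.map σ) (Q.rename σ).p) : Same M (l.map σ) (P.rename σ) (Q.rename σ) := by
  obtain ⟨h, h', e, k⟩ := h
  have o (m : List ℕ) : obj M.X (m.map σ) = obj M.X m :=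
    obj_congr M.X (map_wireType_of_forall fun a _ => hσ a)
  obtain ⟨h₁, e₁⟩ := den_rename M hσ h u₁ (o _) (o _).symm
  obtain ⟨h₂, e₂⟩ := den_rename M hσ h' u₂ (o _) (o _).symm
  refine ⟨h₁, h₂, (o _).trans (e.trans (o _).symm), ?_⟩
  refine Eq.trans ?_ e₂.symm
  refine (congrArg (· ≫ eqToHom _) e₁).trans ?_
  rw [← k]
  simp only [Category.assoc, eqToHom_trans]
  rfl

lemma Same.frame {l : List ℕ} {P Q : Prog} (h : Same M l P Q)
    (ht : P.m.map wireType = Q.m.map wireType) (u₁ : Uniq l P.p) (u₂ : Uniq l Q.p) (r : List ℕ) :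
    Same M (l ++ r) ⟨P.p, P.m ++ r⟩ ⟨Q.p, Q.m ++ r⟩ := by
  obtain ⟨h, h', e, k⟩ := h
  refine ⟨h.frame r, h'.frame r, obj_append_congr M.X ht rfl, ?_⟩
  have e₁ := den_frame M r u₁ h (h.frame r)
  have e₂ := den_frame M r u₂ h' (h'.frame r)
  have e₃ := app_eqToHom M.X ht (rfl : r.map wireType = r.map wireType)
  rw [← cancel_epi (app M.X l r).hom, e₂, reassoc_of% e₁, ← e₃, ← k]
  simp

/-- The statements not depending on the matched part are executed before it and the dependent ones
after it. The matched part is then a contiguous block with spectators `s`, and the rule applies by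
the frame property. The remainder is renamed by `τ`, because the new block names its outputs
differently. -/
theorem applyAt_sound {r : Rule} (hr : r.Valid M) {l : List ℕ} {P Q : Prog} {b : ℕ} {σ : Subst}
    (h : applyAt r l P b σ = some Q) (hw : WF l P.p P.m) : Same M l P Q := by
  simp only [applyAt] at h
  split at h
  · simp at h
  next rest hrest =>
  split at h
  · simp at h
  next c hc =>
  split at h
  · simp at h
  next s hs =>
  split at h
  · simp at h
  next m hm =>
  rw [cond_eq_ite] at h
  split at h
  swap
  · simp at h
  next hall =>
  simp only [Option.some.injEq] at h
  subst h
  simp only [Bool.and_eq_true] at hall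
  obtain ⟨hperm, hb, hσ, hτ, u₁, u₂, u₃, heq, u₄⟩ := hall
  have hb := Nat.eq_of_beq_eq_true hb
  have hσ' := Subst.wireType_extend hσ hb
  have hτ' := Subst.wireType_extend hτ (b := 0) rfl
  have u₁ := checkUniq_sound u₁
  have u₂ := checkUniq_sound u₂
  have u₃ := checkUniq_sound u₃
  have u₄ := checkUniq_sound u₄
  have heq := eqNats_iff heq
  set L := r.L.rename (σ.extend b) with hL
  set R := r.R.rename (σ.extend b) with hR
  set d := r.l.map (σ.extend b) with hd
  set pre := (split (addMask 0 L.m) rest).1 with hpre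
  set post := (split (addMask 0 L.m) rest).2 with hpost
  set τ := Subst.extend (L.m.zip R.m) 0 with hτdef
  have hLR : Same M d L R := Same.rename hr hσ' u₂ u₃
  -- The renaming `τ` preserves types and was checked to carry the outputs of `L` to those of `R`.
  have ht : L.m.map wireType = R.m.map wireType := by
    have h₁ : (L.m ++ s).map wireType = (R.m ++ s).map wireType := by
      rw [← heq, map_wireType_of_forall fun a _ => hτ' a]
    rw [List.map_append, List.map_append] at h₁
    exact List.append_cancel_right h₁
  have p₁ : P.p.Perm (pre ++ (L.p ++ post)) := by
    have h₁ := perm_of_removeAll Stmt.eq_of_beq hrest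
    have h₂ : rest.Perm (pre ++ post) := split_perm _ rest
    exact h₁.trans ((h₂.append_left _).trans (perm_append_left_comm _ _ _))
  have w₁ : WF l pre (d ++ s) :=
    (wf_of_exec hc).perm_right (perm_of_removeAll Nat.eq_of_beq_eq_true hs)
  have w₂ : WF (L.m ++ s) post P.m := (wf_of_exec hm).perm_right (checkPerm_sound hperm)
  obtain ⟨k₁, k₂, e, k⟩ := hLR.frame ht u₂ u₃ s
  have o (m : List ℕ) : obj M.X (m.map τ) = obj M.X m :=
    obj_congr M.X (map_wireType_of_forall fun a _ => hτ' a)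
  have u₄' : Uniq ((L.m ++ s).map τ) (post.map (Stmt.rename τ)) := by rw [heq]; exact u₄
  obtain ⟨w₃', e₃'⟩ := den_rename M hτ' w₂ u₄' (o _) (o _).symm
  have w₃ : WF (R.m ++ s) (post.map (Stmt.rename τ)) (P.m.map τ) := heq ▸ w₃'
  have e₃ : den M (R.m ++ s) (post.map (Stmt.rename τ)) (P.m.map τ) w₃ =
      eqToHom e.symm ≫ den M (L.m ++ s) post P.m w₂ ≫ eqToHom (o _).symm := by
    rw [den_of_perm M (List.Perm.of_eq heq.symm) w₃ w₃', e₃', permHom_eq M.X heq.symm]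
    simp
  refine ⟨hw, w₁.append (k₂.append w₃), (o _).symm, ?_⟩
  have w₄ : WF l (pre ++ (L.p ++ post)) P.m := w₁.append (k₁.append w₂)
  rw [den_reorder M p₁ u₁ hw w₄, den_append M w₁ (k₁.append w₂), den_append M k₁ w₂]
  refine Eq.trans ?_ (den_append M w₁ (k₂.append w₃) _).symm
  rw [den_append M k₂ w₃, e₃, ← k]
  simp

end

/-! ### Calculations with rewrite rules, and proof by reflection -/

section

/-- Search order for the statements of a pattern. -/
def searchOrder (p : List Stmt) : List Stmt :=
  let rare (g : Stmt) : Bool := match g.op with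
    | .mul | .comul => false
    | _ => true
  p.filter rare ++ p.filter fun g => !rare g

/-- Application of a rewrite rule at the first possible place extending a partial renaming. -/
def applyRule (r : Rule) (hint : Subst) (l : List ℕ) (P : Prog) (b : ℕ) : Option Prog :=
  matchAll P.p (searchOrder r.L.p) hint (applyAt r l P b)

/-- Evaluation of a number before further use. -/
def forceNat {α : Type} (n : ℕ) (k : ℕ → α) : α := Nat.casesOn n (k 0) fun m => k (Nat.succ m)

/-- Evaluation of a list of numbers before further use. -/
def forceNats {α : Type} : List ℕ → (List ℕ → α) → α
  | [], k => k []
  | a :: l, k => forceNat a fun a' => forceNats l fun l' => k (a' :: l')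

/-- Evaluation of a list of statements before further use. -/
def forceStmts {α : Type} : List Stmt → (List Stmt → α) → α
  | [], k => k []
  | ⟨o, i, u⟩ :: p, k =>
    forceNats i fun i' => forceNats u fun u' => forceStmts p fun p' => k (⟨o, i', u'⟩ :: p')

/-- Evaluation of a program before further use. -/
def Prog.force {α : Type} (P : Prog) (k : Prog → α) : α :=
  forceStmts P.p fun p => forceNats P.m fun m => k ⟨p, m⟩

/-- Evaluation of a list of rules before further use. -/
def forceRules {α : Type} : List Rule → (List Rule → α) → α
  | [], k => k []
  | r :: rs, k => forceNats r.l fun l => r.L.force fun L => r.R.force fun R => forceNat r.w fun w =>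
    forceRules rs fun rs' => k (⟨l, L, R, w⟩ :: rs')

lemma forceNat_eq {α : Type} (n : ℕ) (k : ℕ → α) : forceNat n k = k n := by cases n <;> rfl

lemma forceNats_eq {α : Type} (l : List ℕ) (k : List ℕ → α) : forceNats l k = k l := by
  induction l generalizing k with
  | nil => rfl
  | cons a l ih => rw [forceNats, forceNat_eq, ih]

lemma forceStmts_eq {α : Type} (p : List Stmt) (k : List Stmt → α) : forceStmts p k = k p := by
  induction p generalizing k with
  | nil => rfl
  | cons g p ih => rw [forceStmts, forceNats_eq, forceNats_eq, ih]

lemma Prog.force_eq {α : Type} (P : Prog) (k : Prog → α) : P.force k = k P := by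
  rw [Prog.force, forceStmts_eq, forceNats_eq]

lemma forceRules_eq {α : Type} (rs : List Rule) (k : List Rule → α) : forceRules rs k = k rs := by
  induction rs generalizing k with
  | nil => rfl
  | cons r rs ih =>
    rw [forceRules, forceNats_eq, Prog.force_eq, Prog.force_eq, forceNat_eq, ih]

/-- A step in a calculation with rewrite rules indexed by `J`. -/
inductive Cmd (J : Type)
  | rw (i : J) (hint : Subst)
  | rwr (i : J) (hint : Subst)
  | simp (is : List J) (fuel : ℕ)

/-- Repeated application of a rewrite rule. The last entry is the remaining fuel. -/
def applyMany (r : Rule) (l : List ℕ) : ℕ → Prog → ℕ → Prog × ℕ × ℕ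
  | 0, P, b => (P, b, 0)
  | n + 1, P, b =>
    match applyRule r [] l P b with
    | some Q => Q.force fun Q' => forceNat (b + r.w) fun b' => applyMany r l n Q' b'
    | none => (P, b, n + 1)

/-- Application of rewrite rules, one after the other. -/
def applyAll (l : List ℕ) : List Rule → ℕ → Prog → ℕ → Prog × ℕ × ℕ
  | [], n, P, b => (P, b, n)
  | r :: rs, n, P, b =>
    match applyMany r l n P b with
    | (Q, b', n') => applyAll l rs n' Q b'

/-- Repeated application of rewrite rules. -/
def simpLoop (rs : List Rule) (l : List ℕ) : ℕ → ℕ → Prog → ℕ → Prog × ℕ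
  | 0, _, P, b => (P, b)
  | k + 1, n, P, b =>
    match applyAll l rs n P b with
    | (Q, b', n') => bif Nat.beq n n' then (Q, b') else simpLoop rs l k n' Q b'

/-- Execution of a calculation. -/
def run {J : Type} (rules : J → Rule) (l : List ℕ) : List (Cmd J) → Prog → ℕ → Option (Prog × ℕ)
  | [], P, b => some (P, b)
  | .rw i hint :: s, P, b =>
    match applyRule (rules i) hint l P b with
    | some Q => run rules l s Q (b + (rules i).w)
    | none => none
  | .rwr i hint :: s, P, b =>
    match applyRule (rules i).symm hint l P b with
    | some Q => run rules l s Q (b + (rules i).w)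
    | none => none
  | .simp is n :: s, P, b =>
    match forceRules (is.map rules) fun rs => simpLoop rs l n n P b with
    | (Q, b') => run rules l s Q b'

/-- An even bound for the names of wires. -/
def bound : ℕ → List ℕ → ℕ
  | b, [] => b
  | b, a :: l => bif Nat.ble b a then bound (2 * (a / 2) + 2) l else bound b l

/-- An even bound for the names of the wires of a program. -/
def Prog.bound (l : List ℕ) (P : Prog) : ℕ := WireDiagram.bound 0 (l ++ P.p.flatMap Stmt.o)

/-- Test if two programs agree up to the given renaming. -/
def isoAt (l : List ℕ) (P Q : Prog) (σ : Subst) : Option Unit :=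
  let f := σ.extend 0
  let P' := P.rename f
  bif σ.typed && (eqNats (l.map f) l && (eqNats P'.m Q.m && (checkUniq l P'.p &&
      match removeAll Stmt.beq P'.p Q.p with
      | some [] => (match exec l Q.p with
        | some m => checkPerm m Q.m
        | none => false)
      | _ => false))) then
    some () else none

/-- Test if two programs agree up to the names of the wires. -/
def isoCheck (l : List ℕ) (P Q : Prog) : Bool :=
  match matchAll Q.p P.p (l.zip l ++ P.m.zip Q.m) (isoAt l P Q) with
  | some _ => true
  | none => false

/-- A program is well formed, as a test. -/
def Prog.check (l : List ℕ) (P : Prog) : Bool :=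
  match exec l P.p with
  | some m => checkPerm m P.m
  | none => false

/-- Test if two programs agree after the given calculations. -/
def checkSame {J : Type} (rules : J → Rule) (l : List ℕ) (P Q : Prog) (s t : List (Cmd J)) : Bool :=
  P.check l && (Q.check l &&
    match P.force fun P => run rules l s P (P.bound l) with
    | some (P', _) =>
      match Q.force fun Q => run rules l t Q (Q.bound l) with
      | some (Q', _) => isoCheck l P' Q'
      | none => false
    | none => false)

/-- The program of a formal morphism. -/
def Expr.prog {A B : Ob} (e : Expr A B) : Prog :=
  let c := e.compile (freshNames 0 A.flat) A.flat.length
  ⟨c.p, c.m⟩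

/-- The next fresh name. -/
def Expr.fresh {A B : Ob} (e : Expr A B) : ℕ :=
  (e.compile (freshNames 0 A.flat) A.flat.length).k

/-- The rewrite rule of an equation between formal morphisms. -/
def Rule.ofExpr {A B : Ob} (e e' : Expr A B) : Rule :=
  ⟨freshNames 0 A.flat, e.prog, e'.prog, 2 * (e.fresh + e'.fresh)⟩

variable {C : Type u} [Category.{v} C] [MonoidalCategory C] [SymmetricCategory C] {M : Model C}

lemma Prog.check_sound {l : List ℕ} {P : Prog} (h : P.check l = true) : WF l P.p P.m := by
  rw [Prog.check] at h
  split at h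
  · next m hm => exact (wf_of_exec hm).perm_right (checkPerm_sound h)
  · simp at h

lemma applyRule_sound {r : Rule} (hr : r.Valid M) {hint : Subst} {l : List ℕ} {P Q : Prog} {b : ℕ}
    (h : applyRule r hint l P b = some Q) (hw : WF l P.p P.m) : Same M l P Q := by
  obtain ⟨σ, hσ⟩ := exists_of_matchAll h
  exact applyAt_sound hr hσ hw

lemma Same.wf {l : List ℕ} {P Q : Prog} (h : Same M l P Q) : WF l Q.p Q.m := h.2.1

/-- Whether the loop stops for lack of a match or for lack of fuel is irrelevant: every intermediate
program is equivalent to the first, and no termination or confluence is claimed. -/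
lemma applyMany_sound {r : Rule} (hr : r.Valid M) {l : List ℕ} {n : ℕ} {P : Prog}
    {b : ℕ} (hw : WF l P.p P.m) : Same M l P (applyMany r l n P b).1 := by
  induction n generalizing P b with
  | zero => exact Same.refl hw
  | succ n ih =>
    rw [applyMany]
    split
    · next Q hQ =>
      rw [Prog.force_eq, forceNat_eq]
      have h₁ := applyRule_sound hr hQ hw
      exact h₁.trans (ih h₁.wf)
    · exact Same.refl hw

lemma applyAll_sound {rs : List Rule} (hr : ∀ r ∈ rs, r.Valid M) {l : List ℕ} {n : ℕ} {P : Prog}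
    {b : ℕ} (hw : WF l P.p P.m) : Same M l P (applyAll l rs n P b).1 := by
  induction rs generalizing n P b with
  | nil => exact Same.refl hw
  | cons r rs ih =>
    have h₁ := applyMany_sound (hr r (by simp)) (n := n) (b := b) hw
    exact h₁.trans (ih (fun r hr' => hr r (by simp [hr'])) h₁.wf)

lemma simpLoop_sound {rs : List Rule} (hr : ∀ r ∈ rs, r.Valid M) {l : List ℕ} {k n : ℕ} {P : Prog}
    {b : ℕ} (hw : WF l P.p P.m) : Same M l P (simpLoop rs l k n P b).1 := by
  induction k generalizing n P b with
  | zero => exact Same.refl hw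
  | succ k ih =>
    have h₁ := applyAll_sound hr (n := n) (b := b) hw
    rw [simpLoop]
    generalize applyAll l rs n P b = x at h₁ ⊢
    obtain ⟨Q, b', n'⟩ := x
    dsimp only
    cases n.beq n'
    · exact h₁.trans (ih h₁.wf)
    · exact h₁

lemma run_sound {J : Type} {rules : J → Rule} (hr : ∀ i, (rules i).Valid M) {l : List ℕ}
    {s : List (Cmd J)} {P : Prog} {b : ℕ} {Q : Prog × ℕ} (h : run rules l s P b = some Q)
    (hw : WF l P.p P.m) : Same M l P Q.1 := by
  induction s generalizing P b with
  | nil =>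
    simp only [run, Option.some.injEq] at h
    rw [← h]
    exact Same.refl hw
  | cons c s ih =>
    cases c with
    | rw i hint =>
      rw [run] at h
      split at h
      · next Q' hQ =>
        have h₁ := applyRule_sound (hr i) hQ hw
        exact h₁.trans (ih h h₁.wf)
      · simp at h
    | rwr i hint =>
      rw [run] at h
      split at h
      · next Q' hQ =>
        have h₁ := applyRule_sound (hr i).symm hQ hw
        exact h₁.trans (ih h h₁.wf)
      · simp at h
    | simp is n =>
      rw [run, forceRules_eq] at h
      have h₁ : Same M l P (simpLoop (is.map rules) l n n P b).1 :=
        simpLoop_sound (by simpa using fun i _ => hr i) hw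
      exact h₁.trans (ih h h₁.wf)

/-- Isomorphism of diagrams relative to inputs and outputs: `den_rename` handles the names and
`den_reorder` the order of the statements. -/
lemma isoCheck_sound {l : List ℕ} {P Q : Prog} (h : isoCheck l P Q = true) (hw : WF l P.p P.m) :
    Same M l P Q := by
  rw [isoCheck] at h
  split at h
  swap
  · simp at h
  next u hu =>
  obtain ⟨σ, hσ⟩ := exists_of_matchAll hu
  have of_cond {b : Bool} (h : cond b (some ()) none = some u) : b = true := by
    cases b <;> simp_all
  have hall := of_cond hσ
  simp only [Bool.and_eq_true] at hall
  obtain ⟨h₁, h₂, h₃, h₄, h₅⟩ := hall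
  split at h₅
  swap
  · simp at h₅
  next hp =>
  have hQ : Q.check l = true := h₅
  have h₁ := Subst.wireType_extend h₁ (b := 0) rfl
  have h₂ := eqNats_iff h₂
  have h₃ : P.m.map (σ.extend 0) = Q.m := eqNats_iff h₃
  have h₄ := checkUniq_sound h₄
  have hp : Q.p.Perm (P.rename (σ.extend 0)).p := by
    simpa using perm_of_removeAll Stmt.eq_of_beq hp
  have hQ := Prog.check_sound hQ
  have h₄' : Uniq (l.map (σ.extend 0)) (P.rename (σ.extend 0)).p := by rw [h₂]; exact h₄
  have o (m : List ℕ) : obj M.X (m.map (σ.extend 0)) = obj M.X m :=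
    obj_congr M.X (map_wireType_of_forall fun a _ => h₁ a)
  obtain ⟨w, e⟩ := den_rename M h₁ hw h₄' (o _) (o _).symm
  have w' : WF l (P.rename (σ.extend 0)).p (P.m.map (σ.extend 0)) := by rw [h₂] at w; exact w
  have e' : den M l (P.rename (σ.extend 0)).p (P.m.map (σ.extend 0)) w' =
      den M l P.p P.m hw ≫ eqToHom (o _).symm := by
    have hl : l.Perm (l.map (σ.extend 0)) := List.Perm.of_eq h₂.symm
    rw [den_of_perm M hl w' w, permHom_eq M.X h₂.symm hl]
    refine (congrArg (eqToHom _ ≫ ·) e).trans ?_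
    simp
  have w'' : WF l (P.rename (σ.extend 0)).p Q.m := by rw [← h₃]; exact w'
  have e'' : den M l (P.rename (σ.extend 0)).p Q.m w'' =
      den M l (P.rename (σ.extend 0)).p (P.m.map (σ.extend 0)) w' ≫
        eqToHom (congrArg (obj M.X) h₃) := by
    rw [den_perm_right M w' (List.Perm.of_eq h₃) w'', permHom_eq M.X h₃]
  refine ⟨hw, hQ, (o _).symm.trans (congrArg (obj M.X) h₃), ?_⟩
  rw [← den_reorder M hp.symm h₄ w'' hQ, e'', e']
  simp

theorem same_of_checkSame {J : Type} {rules : J → Rule} (hr : ∀ i, (rules i).Valid M) {l : List ℕ}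
    {P Q : Prog} (s t : List (Cmd J)) (h : checkSame rules l P Q s t = true) : Same M l P Q := by
  simp only [checkSame, Bool.and_eq_true, Prog.force_eq] at h
  obtain ⟨h₁, h₂, h⟩ := h
  split at h
  swap
  · simp at h
  next P' _ hP =>
  split at h
  swap
  · simp at h
  next Q' _ hQ =>
  have hP' := run_sound hr hP (Prog.check_sound h₁)
  have hQ' := run_sound hr hQ (Prog.check_sound h₂)
  exact (hP'.trans (isoCheck_sound h hP'.wf)).trans hQ'.symm

/-- Both directions are used: a proved equation of morphisms becomes a rewrite rule, and a
successful calculation becomes an equation of morphisms. -/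
lemma same_iff_eval_eq {A B : Ob} {e e' : Expr A B}
    (u : checkUniq (freshNames 0 A.flat) e.prog.p = true)
    (u' : checkUniq (freshNames 0 A.flat) e'.prog.p = true) :
    Same M (freshNames 0 A.flat) e.prog e'.prog ↔ e.eval M = e'.eval M := by
  obtain ⟨k₁, k₂, k₃⟩ := Expr.realizes_compile M e _ _ (freshNames_labels A 0) (checkUniq_sound u)
  obtain ⟨k₁', k₂', k₃'⟩ := Expr.realizes_compile M e' _ _ (freshNames_labels A 0)
    (checkUniq_sound u')
  have ht : obj M.X e.prog.m = obj M.X e'.prog.m := obj_congr M.X (k₁.trans k₁'.symm)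
  have hl : (lab M.X B e'.prog.m k₁').hom = (lab M.X B e.prog.m k₁).hom ≫ eqToHom ht := by
    simp [lab]
  have key (f g : A.eval M.X ⟶ B.eval M.X) (d : obj M.X (freshNames 0 A.flat) ⟶ obj M.X e.prog.m)
      (d' : obj M.X (freshNames 0 A.flat) ⟶ obj M.X e'.prog.m)
      (hf : f ≫ (lab M.X B e.prog.m k₁).hom = (lab M.X A _ (freshNames_labels A 0)).hom ≫ d)
      (hg : g ≫ (lab M.X B e'.prog.m k₁').hom = (lab M.X A _ (freshNames_labels A 0)).hom ≫ d') :
      d ≫ eqToHom ht = d' ↔ f = g := by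
    constructor
    · intro h
      rw [← cancel_mono (lab M.X B e'.prog.m k₁').hom, hg, hl, reassoc_of% hf, h]
    · rintro rfl
      rw [← cancel_epi (lab M.X A _ (freshNames_labels A 0)).hom, ← hg, hl, reassoc_of% hf]
  have := key _ _ _ _ k₃ k₃'
  rw [← this]
  exact ⟨fun ⟨_, _, _, h⟩ => h, fun h => ⟨k₂, k₂', ht, h⟩⟩

/-- Test if the names of the wires of an equation between formal morphisms are distinct. -/
def uniqExprs {A B : Ob} (e e' : Expr A B) : Bool :=
  checkUniq (freshNames 0 A.flat) e.prog.p && checkUniq (freshNames 0 A.flat) e'.prog.p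

lemma Rule.valid_ofExpr {A B : Ob} {e e' : Expr A B} (u : uniqExprs e e' = true) :
    (Rule.ofExpr e e').Valid M ↔ e.eval M = e'.eval M := by
  simp only [uniqExprs, Bool.and_eq_true] at u
  exact same_iff_eval_eq u.1 u.2

/-- Test if two formal morphisms agree after the given calculations. -/
def checkExprs {J : Type} (rules : J → Rule) {A B : Ob} (e e' : Expr A B) (s t : List (Cmd J)) :
    Bool :=
  uniqExprs e e' && checkSame rules (freshNames 0 A.flat) e.prog e'.prog s t

theorem eval_eq_of_check {J : Type} {rules : J → Rule} (hr : ∀ i, (rules i).Valid M) {A B : Ob}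
    {e e' : Expr A B} (s t : List (Cmd J)) (h : checkExprs rules e e' s t = true) :
    e.eval M = e'.eval M := by
  simp only [checkExprs, Bool.and_eq_true] at h
  exact (Rule.valid_ofExpr h.1).1 (same_of_checkSame hr s t h.2)

end

/-! ### The laws of Hopf algebras and duals as rewrite rules -/

section

namespace Expr

/-- The formal object of the Hopf algebra. -/
abbrev h : Ob := .atom false

/-- The formal object of the dual of the Hopf algebra. -/
abbrev d : Ob := .atom true

/-- The formal tensor square of the Hopf algebra. -/
abbrev hh : Ob := .tensor h h

scoped infixr:80 " ≫ₑ " => Expr.comp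
scoped infixr:70 " ⊗ₑ " => Expr.tensor
scoped infixr:81 " ◁ₑ " => Expr.whiskerLeft
scoped infixl:81 " ▷ₑ " => Expr.whiskerRight

/-- The unit. -/
abbrev one : Expr .unit h := .op .one
/-- The product. -/
abbrev mul : Expr hh h := .op .mul
/-- The counit. -/
abbrev counit : Expr h .unit := .op .counit
/-- The coproduct. -/
abbrev comul : Expr h hh := .op .comul
/-- The antipode. -/
abbrev ant : Expr h h := .op .ant
/-- The inverse of the antipode. -/
abbrev ainv : Expr h h := .op .ainv
/-- The coevaluation. -/
abbrev cup : Expr .unit (.tensor d h) := .op .cup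
/-- The evaluation. -/
abbrev cap : Expr (.tensor h d) .unit := .op .cap

/-- Exchange of the factors in the middle. -/
abbrev tensorμ (A B A' B' : Ob) : Expr (.tensor (.tensor A B) (.tensor A' B'))
    (.tensor (.tensor A A') (.tensor B B')) :=
  .assoc _ _ _ ≫ₑ A ◁ₑ .assocInv _ _ _ ≫ₑ A ◁ₑ (.braid B A' ▷ₑ B') ≫ₑ A ◁ₑ .assoc _ _ _ ≫ₑ
    .assocInv _ _ _

end Expr

section Model

variable {C : Type u} [Category.{v} C] [MonoidalCategory C] [SymmetricCategory C]

/-- The interpretation of the formal operations in a Hopf algebra with a dual and an endomorphism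
which interprets the inverse of the antipode. -/
abbrev hopfModel (H Hd : C) [HopfObj H] [ExactPairing Hd H] (T : H ⟶ H) : Model C where
  X := Bool.rec H Hd
  sem
    | .one => η[H]
    | .mul => μ[H]
    | .counit => ε[H]
    | .comul => Δ[H]
    | .ant => 𝒮[H]
    | .ainv => T
    | .cup => η_ Hd H
    | .cap => ε_ Hd H

end Model

/-- The laws of Hopf algebras and duals. -/
inductive HopfLaw
  | mulAssoc | oneMul | mulOne | comulAssoc | counitComul | comulCounit
  | mulComul | oneComul | mulCounit | oneCounit
  | antLeft | antRight | oneAnt | antCounit | antComul | mulAnt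
  | zigzag | zigzagDual

open WireDiagram.Expr in
/-- The rewrite rules of the laws of Hopf algebras and duals. -/
def HopfLaw.rule : HopfLaw → Rule
  | mulAssoc => .ofExpr (mul ▷ₑ h ≫ₑ mul) (.assoc h h h ≫ₑ h ◁ₑ mul ≫ₑ mul)
  | oneMul => .ofExpr (one ▷ₑ h ≫ₑ mul) (.lunit h)
  | mulOne => .ofExpr (h ◁ₑ one ≫ₑ mul) (.runit h)
  | comulAssoc => .ofExpr (comul ≫ₑ comul ▷ₑ h ≫ₑ .assoc h h h) (comul ≫ₑ h ◁ₑ comul)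
  | counitComul => .ofExpr (comul ≫ₑ counit ▷ₑ h) (.lunitInv h)
  | comulCounit => .ofExpr (comul ≫ₑ h ◁ₑ counit) (.runitInv h)
  | mulComul => .ofExpr (mul ≫ₑ comul) ((comul ⊗ₑ comul) ≫ₑ Expr.tensorμ h h h h ≫ₑ (mul ⊗ₑ mul))
  | oneComul => .ofExpr (one ≫ₑ comul) (.lunitInv .unit ≫ₑ (one ⊗ₑ one))
  | mulCounit => .ofExpr (mul ≫ₑ counit) ((counit ⊗ₑ counit) ≫ₑ .lunit .unit)
  | oneCounit => .ofExpr (one ≫ₑ counit) (.id .unit)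
  | antLeft => .ofExpr (comul ≫ₑ ant ▷ₑ h ≫ₑ mul) (counit ≫ₑ one)
  | antRight => .ofExpr (comul ≫ₑ h ◁ₑ ant ≫ₑ mul) (counit ≫ₑ one)
  | oneAnt => .ofExpr (one ≫ₑ ant) one
  | antCounit => .ofExpr (ant ≫ₑ counit) counit
  | antComul => .ofExpr (ant ≫ₑ comul) (comul ≫ₑ .braid h h ≫ₑ (ant ⊗ₑ ant))
  | mulAnt => .ofExpr (mul ≫ₑ ant) ((ant ⊗ₑ ant) ≫ₑ .braid h h ≫ₑ mul)
  | zigzag => .ofExpr (h ◁ₑ cup ≫ₑ .assocInv h d h ≫ₑ cap ▷ₑ h) (.runit h ≫ₑ .lunitInv h)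
  | zigzagDual => .ofExpr (cup ▷ₑ d ≫ₑ .assoc d h d ≫ₑ d ◁ₑ cap) (.lunit d ≫ₑ .runitInv d)

/-- The laws of Hopf algebras whose antipode is bijective. -/
inductive BijLaw
  | hopf (i : HopfLaw)
  | antAinv | ainvAnt

open WireDiagram.Expr in
/-- The rewrite rules of the laws of Hopf algebras whose antipode is bijective. -/
def BijLaw.rule : BijLaw → Rule
  | hopf i => i.rule
  | antAinv => .ofExpr (ant ≫ₑ ainv) (.id h)
  | ainvAnt => .ofExpr (ainv ≫ₑ ant) (.id h)

section Model

variable {C : Type u} [Category.{v} C] [MonoidalCategory C] [SymmetricCategory C]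
  (H Hd : C) [HopfObj H] [ExactPairing Hd H]

/-- No law in this list involves `ainv`, so its interpretation `T` is arbitrary. The laws are
therefore available before the antipode is known to be invertible. -/
theorem HopfLaw.valid (T : H ⟶ H) (i : HopfLaw) : i.rule.Valid (hopfModel H Hd T) := by
  cases i <;> refine (Rule.valid_ofExpr (by decide +kernel)).2 ?_
  · exact MonObj.mul_assoc H
  · exact MonObj.one_mul H
  · exact MonObj.mul_one H
  · exact (ComonObj.comul_assoc H).symm
  · exact ComonObj.counit_comul H
  · exact ComonObj.comul_counit H
  · exact BimonObj.mul_comul H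
  · exact BimonObj.one_comul H
  · exact BimonObj.mul_counit H
  · exact BimonObj.one_counit H
  · exact HopfObj.antipode_left H
  · exact HopfObj.antipode_right H
  · exact HopfObj.one_antipode H
  · exact HopfObj.antipode_counit H
  · exact HopfObj.antipode_comul H
  · exact HopfObj.mul_antipode H
  · exact ExactPairing.coevaluation_evaluation Hd H
  · exact ExactPairing.evaluation_coevaluation Hd H

theorem BijLaw.valid [IsIso 𝒮[H]] (i : BijLaw) : i.rule.Valid (hopfModel H Hd (inv 𝒮[H])) := by
  cases i
  · exact HopfLaw.valid H Hd _ _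
  · exact (Rule.valid_ofExpr (by decide +kernel)).2 (IsIso.hom_inv_id _)
  · exact (Rule.valid_ofExpr (by decide +kernel)).2 (IsIso.inv_hom_id _)

end Model

end

/-! ### Normalization of words when the antipode is bijective -/

section

open WireDiagram.Expr

/-- The forms of the antipode axiom: `S(x₁) x₂`, `x₁ S(x₂)`, `S⁻¹(x₂) x₁`, `x₂ S⁻¹(x₁)`,
`S⁻²(x₁) S⁻¹(x₂)`, `S⁻¹(x₁) S⁻²(x₂)`. -/
inductive Cancel
  | antLeft | antRight | ainvLeft | ainvRight | ainvSqLeft | ainvSqRight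

/-- The morphism between the coproduct and the product in a form of the antipode axiom. -/
def Cancel.mid : Cancel → Expr hh hh
  | antLeft => ant ▷ₑ h
  | antRight => h ◁ₑ ant
  | ainvLeft => .braid h h ≫ₑ ainv ▷ₑ h
  | ainvRight => .braid h h ≫ₑ h ◁ₑ ainv
  | ainvSqLeft => (ainv ≫ₑ ainv) ⊗ₑ ainv
  | ainvSqRight => ainv ⊗ₑ (ainv ≫ₑ ainv)

/-- A form of the antipode axiom, given by the morphism between the coproduct and the product. -/
def cancelLhs (m : Expr hh hh) : Expr h h := comul ≫ₑ m ≫ₑ mul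

/-- The antipode axiom for letters which are not the last ones of their element. -/
def cancelComulLhs (m : Expr hh hh) : Expr h hh :=
  comul ≫ₑ h ◁ₑ comul ≫ₑ .assocInv h h h ≫ₑ (m ≫ₑ mul) ▷ₑ h

/-- The antipode axiom for letters which are not the last ones of their word. -/
def cancelMulLhs (m : Expr hh hh) : Expr hh h :=
  (comul ≫ₑ m) ▷ₑ h ≫ₑ .assoc h h h ≫ₑ h ◁ₑ mul ≫ₑ mul

/-- The antipode axiom for letters which are not the last ones of their element nor of their
word. -/
def cancelComulMulLhs (m : Expr hh hh) : Expr hh hh :=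
  (comul ≫ₑ h ◁ₑ comul ≫ₑ .assocInv h h h ≫ₑ m ▷ₑ h) ▷ₑ h ≫ₑ .assoc hh h h ≫ₑ
    hh ◁ₑ .braid h h ≫ₑ .assocInv hh h h ≫ₑ (.assoc h h h ≫ₑ h ◁ₑ mul ≫ₑ mul) ▷ₑ h

/-- The rules for the normalization of words in Hopf algebras with bijective antipode. -/
inductive WordLaw
  | bij (i : BijLaw)
  | oneAinv | ainvCounit | ainvComul | mulAinv
  | cancel (c : Cancel)
  | cancelComul (c : Cancel)
  | cancelMul (c : Cancel)
  | cancelComulMul (c : Cancel)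

/-- The rewrite rules for the normalization of words. -/
def WordLaw.rule : WordLaw → Rule
  | bij i => i.rule
  | oneAinv => .ofExpr (one ≫ₑ ainv) one
  | ainvCounit => .ofExpr (ainv ≫ₑ counit) counit
  | ainvComul => .ofExpr (ainv ≫ₑ comul) (comul ≫ₑ .braid h h ≫ₑ (ainv ⊗ₑ ainv))
  | mulAinv => .ofExpr (mul ≫ₑ ainv) ((ainv ⊗ₑ ainv) ≫ₑ .braid h h ≫ₑ mul)
  | cancel c => .ofExpr (cancelLhs c.mid) (counit ≫ₑ one)
  | cancelComul c => .ofExpr (cancelComulLhs c.mid) (.lunitInv h ≫ₑ one ▷ₑ h)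
  | cancelMul c => .ofExpr (cancelMulLhs c.mid) (counit ▷ₑ h ≫ₑ .lunit h)
  | cancelComulMul c => .ofExpr (cancelComulMulLhs c.mid) (.braid h h)

/-- The forms of the antipode axiom without squares. -/
def cancels : List Cancel := [.antLeft, .antRight, .ainvLeft, .ainvRight]

/-- The rules used in the normalization of words. -/
def wordLaws (cs : List Cancel) : List WordLaw :=
  ([.zigzag, .zigzagDual, .oneMul, .mulOne, .counitComul, .comulCounit, .oneComul, .mulCounit,
    .oneCounit, .oneAnt, .antCounit, .antComul, .mulAnt, .mulComul, .mulAssoc, .comulAssoc].map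
    fun i => .bij (.hopf i)) ++
  [.oneAinv, .ainvCounit, .ainvComul, .mulAinv, .bij .antAinv, .bij .ainvAnt] ++
  cs.map .cancel ++ cs.map .cancelMul ++ cs.map .cancelComul ++ cs.map .cancelComulMul

/-- Normalization of words. -/
def normalize : Cmd WordLaw := .simp (wordLaws cancels) 300

/-- A family of rules together with a further rule. -/
def adjoin {J : Type} (rules : J → Rule) (r : Rule) : Option J → Rule
  | none => r
  | some i => rules i

lemma adjoin_valid {C : Type u} [Category.{v} C] [MonoidalCategory C] [SymmetricCategory C]
    {J : Type} {rules : J → Rule} {r : Rule} {M : Model C}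
    (hr : ∀ i, (rules i).Valid M) (h : r.Valid M) (i : Option J) : (adjoin rules r i).Valid M := by
  cases i
  · exact h
  · exact hr _

section Model

variable {C : Type u} [Category.{v} C] [MonoidalCategory C] [SymmetricCategory C]
  (H Hd : C) [HopfObj H] [ExactPairing Hd H] [IsIso 𝒮[H]]

/-- For S⁻¹(x₂)x₁ write x = S(y). Since S reverses the coproduct, the expression becomes y₁S(y₂) =
ε(y) = ε(x); the mirror case is the same. The forms with S⁻² reduce to the antipode axiom after S⁻¹S
is also inserted at the output, as S reverses products. -/
lemma Cancel.valid (c : Cancel) :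
    (Rule.ofExpr (cancelLhs c.mid) (counit ≫ₑ one)).Valid (hopfModel H Hd (inv 𝒮[H])) := by
  have v := BijLaw.valid H Hd
  cases c <;> refine (Rule.valid_ofExpr (by decide +kernel)).2 ?_
  · exact eval_eq_of_check v [.rw (.hopf .antLeft) []] [] (by decide +kernel)
  · exact eval_eq_of_check v [.rw (.hopf .antRight) []] [] (by decide +kernel)
  -- The reversed rule has an identity as its pattern, so the hint must name the wire on which S ∘
  -- S⁻¹ is inserted.
  · exact eval_eq_of_check v [.rwr .ainvAnt [(0, 0)], .simp [.hopf .antComul, .antAinv] 5,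
      .rw (.hopf .antRight) [], .rwr (.hopf .antCounit) [], .rw .ainvAnt []] [] (by decide +kernel)
  · exact eval_eq_of_check v [.rwr .ainvAnt [(0, 0)], .simp [.hopf .antComul, .antAinv] 5,
      .rw (.hopf .antLeft) [], .rwr (.hopf .antCounit) [], .rw .ainvAnt []] [] (by decide +kernel)
  · exact eval_eq_of_check v [.rwr .antAinv [(0, 12)], .simp [.hopf .mulAnt, .ainvAnt] 5,
      .rwr .ainvAnt [(0, 0)], .simp [.hopf .antComul, .antAinv] 5,
      .rw (.hopf .antLeft) [], .rwr (.hopf .antCounit) [], .rw .ainvAnt [],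
      .rwr (.hopf .oneAnt) [], .rw .antAinv []] [] (by decide +kernel)
  · exact eval_eq_of_check v [.rwr .antAinv [(0, 12)], .simp [.hopf .mulAnt, .ainvAnt] 5,
      .rwr .ainvAnt [(0, 0)], .simp [.hopf .antComul, .antAinv] 5,
      .rw (.hopf .antRight) [], .rwr (.hopf .antCounit) [], .rw .ainvAnt [],
      .rwr (.hopf .oneAnt) [], .rw .antAinv []] [] (by decide +kernel)

theorem WordLaw.valid (i : WordLaw) : i.rule.Valid (hopfModel H Hd (inv 𝒮[H])) := by
  have v := BijLaw.valid H Hd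
  have v' (c : Cancel) := adjoin_valid v (Cancel.valid H Hd c)
  cases i with
  | bij i => exact v i
  | cancel c => exact Cancel.valid H Hd c
  | oneAinv =>
    exact (Rule.valid_ofExpr (by decide +kernel)).2 (eval_eq_of_check v
      [.rwr (.hopf .oneAnt) [], .rw .antAinv []] [] (by decide +kernel))
  | ainvCounit =>
    exact (Rule.valid_ofExpr (by decide +kernel)).2 (eval_eq_of_check v
      [.rwr (.hopf .antCounit) [], .rw .ainvAnt []] [] (by decide +kernel))
  | ainvComul =>
    exact (Rule.valid_ofExpr (by decide +kernel)).2 (eval_eq_of_check v []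
      [.rwr .ainvAnt [(0, 0)], .simp [.hopf .antComul, .antAinv] 5] (by decide +kernel))
  | mulAinv =>
    exact (Rule.valid_ofExpr (by decide +kernel)).2 (eval_eq_of_check v
      [.rwr .ainvAnt [(0, 0)], .rwr .ainvAnt [(0, 2)], .rwr (.hopf .mulAnt) [], .rw .antAinv []] []
      (by decide +kernel))
  | cancelComul c =>
    exact (Rule.valid_ofExpr (by cases c <;> decide +kernel)).2 (eval_eq_of_check (v' c)
      -- Coassociativity makes the two letters to be cancelled the legs of a single coproduct; then
      -- the basic form applies.
      [.rwr (some (.hopf .comulAssoc)) [], .rw none [], .rw (some (.hopf .counitComul)) []] []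
      (by cases c <;> decide +kernel))
  | cancelMul c =>
    exact (Rule.valid_ofExpr (by cases c <;> decide +kernel)).2 (eval_eq_of_check (v' c)
      [.rwr (some (.hopf .mulAssoc)) [], .rw none [], .rw (some (.hopf .oneMul)) []] []
      (by cases c <;> decide +kernel))
  | cancelComulMul c =>
    exact (Rule.valid_ofExpr (by cases c <;> decide +kernel)).2 (eval_eq_of_check (v' c)
      [.rwr (some (.hopf .comulAssoc)) [], .rwr (some (.hopf .mulAssoc)) [], .rw none [],
        .rw (some (.hopf .oneMul)) [], .rw (some (.hopf .counitComul)) []] []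
      (by cases c <;> decide +kernel))

end Model

end

/-! ### Formal versions of R, R̄, T(H) and D(H) -/

section

open WireDiagram.Expr

/-- The formal structure morphisms of a Hopf algebra. -/
structure ExprData (A : Ob) where
  /-- the unit -/
  one : Expr .unit A
  /-- the product -/
  mul : Expr (.tensor A A) A
  /-- the counit -/
  counit : Expr A .unit
  /-- the coproduct -/
  comul : Expr A (.tensor A A)
  /-- the antipode -/
  ant : Expr A A

namespace Expr

/-- The formal version of `DrinfeldBrace.R`. -/
def rr : Expr hh h := h ◁ₑ comul ≫ₑ .assocInv _ _ _ ≫ₑ (mul ⊗ₑ ainv) ≫ₑ .braid h h ≫ₑ mul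

/-- The formal version of `DrinfeldBrace.Rbar`. -/
def rbar : Expr h hh := comul ≫ₑ .braid h h ≫ₑ comul ▷ₑ h ≫ₑ .assoc _ _ _ ≫ₑ h ◁ₑ (ainv ▷ₑ h ≫ₑ mul)

/-- The formal version of `DrinfeldBrace.S`. -/
def ss : Expr h hh := comul ≫ₑ (ant ⊗ₑ rbar) ≫ₑ .assocInv _ _ _ ≫ₑ mul ▷ₑ h

/-- One side of `DrinfeldBrace.CocommClass`. -/
def cocommL : Expr hh hh := h ◁ₑ (comul ≫ₑ .braid h h) ≫ₑ .assocInv _ _ _ ≫ₑ rr ▷ₑ h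

/-- The other side of `DrinfeldBrace.CocommClass`. -/
def cocommR : Expr hh hh := h ◁ₑ comul ≫ₑ .assocInv _ _ _ ≫ₑ rr ▷ₑ h

/-- One side of `DrinfeldBrace.RbarIdentity`. -/
def rbarL : Expr hh (.tensor h hh) :=
  comul ▷ₑ h ≫ₑ .assoc _ _ _ ≫ₑ
    (rbar ⊗ₑ (.braid h h ≫ₑ h ◁ₑ ss ≫ₑ .assocInv _ _ _ ≫ₑ mul ▷ₑ h)) ≫ₑ .assoc _ _ _ ≫ₑ
      h ◁ₑ .assocInv _ _ _ ≫ₑ h ◁ₑ (.braid h h ▷ₑ h) ≫ₑ h ◁ₑ .assoc _ _ _ ≫ₑ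
        .assocInv _ _ _ ≫ₑ mul ▷ₑ hh

/-- The other side of `DrinfeldBrace.RbarIdentity`. -/
def rbarR : Expr hh (.tensor h hh) :=
  rbar ▷ₑ h ≫ₑ .assoc _ _ _ ≫ₑ h ◁ₑ .braid h h ≫ₑ .assocInv _ _ _ ≫ₑ (mul ⊗ₑ comul)

/-- The formal version of `DrinfeldBrace.leftAction`. -/
def leftE : Expr (.tensor h d) d :=
  .lunitInv _ ≫ₑ cup ▷ₑ _ ≫ₑ .assoc _ _ _ ≫ₑ d ◁ₑ .assocInv _ _ _ ≫ₑ d ◁ₑ (rr ▷ₑ d) ≫ₑ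
    d ◁ₑ cap ≫ₑ .runit d

/-- The formal version of `DrinfeldBrace.rightAction`. -/
def rightE : Expr (.tensor h d) h := rbar ▷ₑ d ≫ₑ .assoc _ _ _ ≫ₑ h ◁ₑ cap ≫ₑ .runit h

end Expr

/-- The formal Hopf algebra. -/
def hopfE : ExprData h := ⟨one, mul, counit, comul, ant⟩

/-- The formal version of `DrinfeldBrace.dualCop`. -/
def dualE : ExprData d where
  one := cup ≫ₑ d ◁ₑ counit ≫ₑ .runit d
  mul := .lunitInv _ ≫ₑ (cup ≫ₑ d ◁ₑ (comul ≫ₑ .braid h h)) ▷ₑ _ ≫ₑ .assoc _ _ _ ≫ₑ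
    d ◁ₑ (.assoc _ _ _ ≫ₑ h ◁ₑ .assocInv _ _ _) ≫ₑ .assocInv _ _ _ ≫ₑ
      (.tensor d h) ◁ₑ (cap ▷ₑ d) ≫ₑ .assoc _ _ _ ≫ₑ d ◁ₑ h ◁ₑ .lunit d ≫ₑ d ◁ₑ cap ≫ₑ .runit d
  counit := .lunitInv d ≫ₑ one ▷ₑ d ≫ₑ cap
  comul := .lunitInv _ ≫ₑ (cup ≫ₑ d ◁ₑ .lunitInv h ≫ₑ d ◁ₑ (cup ▷ₑ h)) ▷ₑ d ≫ₑ .assoc _ _ _ ≫ₑ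
    d ◁ₑ (.assoc _ _ _ ≫ₑ .assoc _ _ _ ≫ₑ d ◁ₑ .assocInv _ _ _) ≫ₑ .assocInv _ _ _ ≫ₑ
      (.tensor d d) ◁ₑ (mul ▷ₑ d ≫ₑ cap) ≫ₑ .runit _
  ant := .lunitInv d ≫ₑ cup ▷ₑ d ≫ₑ .assoc _ _ _ ≫ₑ d ◁ₑ (ainv ▷ₑ d) ≫ₑ d ◁ₑ cap ≫ₑ .runit d

namespace ExprData

variable {A B : Ob} (E : ExprData A) (F : ExprData B)

/-- The formal version of `HopfData.tensor`. -/
def tensor : ExprData (.tensor A B) where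
  one := .lunitInv .unit ≫ₑ (E.one ⊗ₑ F.one)
  mul := Expr.tensorμ A B A B ≫ₑ (E.mul ⊗ₑ F.mul)
  counit := (E.counit ⊗ₑ F.counit) ≫ₑ .lunit .unit
  comul := (E.comul ⊗ₑ F.comul) ≫ₑ Expr.tensorμ A A B B
  ant := E.ant ⊗ₑ F.ant

/-- The formal version of `exchange`. -/
def exchange (f : Expr (.tensor B A) A) (g : Expr (.tensor B A) B) :
    Expr (.tensor B A) (.tensor A B) :=
  (F.comul ⊗ₑ E.comul) ≫ₑ Expr.tensorμ B B A A ≫ₑ (f ⊗ₑ g)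

/-- The formal version of `HopfData.bicrossed`. -/
def bicrossed (f : Expr (.tensor B A) A) (g : Expr (.tensor B A) B) :
    ExprData (.tensor A B) where
  one := (E.tensor F).one
  mul := .assoc _ _ _ ≫ₑ A ◁ₑ .assocInv _ _ _ ≫ₑ A ◁ₑ (E.exchange F f g ▷ₑ B) ≫ₑ
    A ◁ₑ .assoc _ _ _ ≫ₑ .assocInv _ _ _ ≫ₑ (E.mul ⊗ₑ F.mul)
  counit := (E.tensor F).counit
  comul := (E.tensor F).comul
  ant := .braid A B ≫ₑ (F.ant ⊗ₑ E.ant) ≫ₑ E.exchange F f g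

/-- The formal version of `gam`. -/
def gam (E E' : ExprData A) : Expr (.tensor A A) A :=
  E.comul ▷ₑ A ≫ₑ .assoc _ _ _ ≫ₑ (E.ant ⊗ₑ E'.mul) ≫ₑ E.mul

/-- One side of the compatibility of Hopf braces. -/
def compatL (E E' : ExprData A) : Expr (.tensor A (.tensor A A)) A := A ◁ₑ E.mul ≫ₑ E'.mul

/-- The other side of the compatibility of Hopf braces. -/
def compatR (E E' : ExprData A) : Expr (.tensor A (.tensor A A)) A :=
  E.comul ▷ₑ .tensor A A ≫ₑ Expr.tensorμ A A A A ≫ₑ (E'.mul ⊗ₑ gam E E') ≫ₑ E.mul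

end ExprData

/-- The formal version of `DrinfeldBrace.T`. -/
def tE : ExprData (.tensor d h) := dualE.tensor hopfE

/-- The formal version of `DrinfeldBrace.D`. -/
def dE : ExprData (.tensor d h) := dualE.bicrossed hopfE leftE rightE

/-- A simplified version of `ExprData.exchange` for the Drinfeld double: on elements,
`h ⊗ f ↦ f (S⁻¹(h₃) - h₁) ⊗ h₂`. -/
def doubleExchangeE : Expr (.tensor h d) (.tensor d h) :=
  .lunitInv _ ≫ₑ cup ▷ₑ _ ≫ₑ .assoc _ _ _ ≫ₑ d ◁ₑ (.assocInv _ _ _ ≫ₑ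
    (h ◁ₑ (comul ≫ₑ h ◁ₑ comul) ≫ₑ .assocInv _ _ _ ≫ₑ (mul ⊗ₑ h ◁ₑ ainv) ≫ₑ h ◁ₑ .braid h h ≫ₑ
      .assocInv _ _ _ ≫ₑ (.braid h h ≫ₑ mul) ▷ₑ h) ▷ₑ d ≫ₑ .assoc _ _ _ ≫ₑ h ◁ₑ .braid h d ≫ₑ
    .assocInv _ _ _ ≫ₑ cap ▷ₑ h ≫ₑ .lunit h)

/-- A simplified version of `dE`. -/
def doubleE : ExprData (.tensor d h) :=
  { dE with
    mul := .assoc _ _ _ ≫ₑ d ◁ₑ .assocInv _ _ _ ≫ₑ d ◁ₑ (doubleExchangeE ▷ₑ h) ≫ₑ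
      d ◁ₑ .assoc _ _ _ ≫ₑ .assocInv _ _ _ ≫ₑ (dualE.mul ⊗ₑ mul)
    ant := .braid d h ≫ₑ (ant ⊗ₑ dualE.ant) ≫ₑ doubleExchangeE }

/-- The interpretation of formal structure morphisms. -/
@[reducible] def ExprData.eval {C : Type u} [Category.{v} C] [MonoidalCategory C]
    [SymmetricCategory C] (M : Model C) {A : Ob} (E : ExprData A) :
    DrinfeldBrace.HopfData (A.eval M.X) :=
  ⟨E.one.eval M, E.mul.eval M, E.counit.eval M, E.comul.eval M, E.ant.eval M⟩

open DrinfeldBrace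

variable {C : Type u} [Category.{v} C] [MonoidalCategory C] [SymmetricCategory C]
  (H Hd : C) [HopfObj H] [ExactPairing Hd H] [IsIso 𝒮[H]]

/-- Once the coherence isomorphisms hidden in `⊗≫` are unfolded, the two sides agree definitionally.
The same applies to the similar lemmas below. -/
lemma eval_rr : rr.eval (hopfModel H Hd (inv 𝒮[H])) = R H := by
  simp only [R, monoidalComp, MonoidalCoherence.refl_iso, MonoidalCoherence.assoc'_iso,
    MonoidalCoherence.whiskerRight_iso, Iso.trans_hom, Iso.refl_hom, Iso.symm_hom,
    whiskerRightIso_hom, Category.id_comp, id_whiskerRight]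
  rfl

lemma eval_rbar : rbar.eval (hopfModel H Hd (inv 𝒮[H])) = Rbar H := by
  simp only [Rbar, monoidalComp, MonoidalCoherence.refl_iso, MonoidalCoherence.assoc_iso,
    MonoidalCoherence.whiskerRight_iso, Iso.trans_hom, Iso.refl_hom, whiskerRightIso_hom,
    Category.comp_id, id_whiskerRight]
  rfl

lemma eval_ss : ss.eval (hopfModel H Hd (inv 𝒮[H])) = S H := by
  simp only [S, monoidalComp, MonoidalCoherence.refl_iso, MonoidalCoherence.assoc'_iso,
    MonoidalCoherence.whiskerRight_iso, Iso.trans_hom, Iso.refl_hom, Iso.symm_hom,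
    whiskerRightIso_hom, Category.id_comp, id_whiskerRight, ← eval_rbar H Hd]
  rfl

lemma cocommClass_iff :
    CocommClass H ↔
      cocommL.eval (hopfModel H Hd (inv 𝒮[H])) = cocommR.eval (hopfModel H Hd (inv 𝒮[H])) := by
  simp only [CocommClass, monoidalComp, MonoidalCoherence.refl_iso, MonoidalCoherence.assoc'_iso,
    MonoidalCoherence.whiskerRight_iso, Iso.trans_hom, Iso.refl_hom, Iso.symm_hom,
    whiskerRightIso_hom, Category.id_comp, id_whiskerRight, ← eval_rr H Hd]
  rfl

lemma rbarIdentity_iff :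
    RbarIdentity H ↔
      rbarL.eval (hopfModel H Hd (inv 𝒮[H])) = rbarR.eval (hopfModel H Hd (inv 𝒮[H])) := by
  simp only [RbarIdentity, monoidalComp, MonoidalCoherence.refl_iso, MonoidalCoherence.assoc_iso,
    MonoidalCoherence.assoc'_iso, MonoidalCoherence.whiskerLeft_iso,
    MonoidalCoherence.whiskerRight_iso, Iso.trans_hom, Iso.refl_hom, Iso.symm_hom,
    whiskerLeftIso_hom, whiskerRightIso_hom, Category.id_comp, Category.comp_id, Category.assoc,
    id_whiskerRight, ← eval_rbar H Hd, ← eval_ss H Hd]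
  rfl

lemma eval_leftE : leftE.eval (hopfModel H Hd (inv 𝒮[H])) = leftAction H Hd := by
  simp only [leftAction, monoidalComp, MonoidalCoherence.refl_iso, MonoidalCoherence.assoc_iso,
    MonoidalCoherence.assoc'_iso, MonoidalCoherence.whiskerLeft_iso,
    MonoidalCoherence.whiskerRight_iso, Iso.trans_hom, Iso.refl_hom, Iso.symm_hom,
    whiskerLeftIso_hom, whiskerRightIso_hom, Category.id_comp, Category.assoc, id_whiskerRight,
    ← eval_rr H Hd]
  rfl

lemma eval_rightE : rightE.eval (hopfModel H Hd (inv 𝒮[H])) = rightAction H Hd := by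
  simp only [rightAction, monoidalComp, MonoidalCoherence.refl_iso, MonoidalCoherence.assoc_iso,
    MonoidalCoherence.whiskerRight_iso, Iso.trans_hom, Iso.refl_hom, whiskerRightIso_hom,
    Category.comp_id, id_whiskerRight, ← eval_rbar H Hd]
  rfl

lemma eval_dualE : dualE.eval (hopfModel H Hd (inv 𝒮[H])) = dualCop H Hd := by
  simp only [dualCop, monoidalComp, MonoidalCoherence.refl_iso, MonoidalCoherence.assoc_iso,
    MonoidalCoherence.assoc'_iso, MonoidalCoherence.whiskerLeft_iso, MonoidalCoherence.left_iso,
    MonoidalCoherence.left'_iso, MonoidalCoherence.whiskerRight_iso, Iso.trans_hom, Iso.refl_hom,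
    Iso.symm_hom, whiskerLeftIso_hom, whiskerRightIso_hom, Category.id_comp, Category.comp_id,
    Category.assoc, id_whiskerRight]
  rfl

lemma eval_tE : tE.eval (hopfModel H Hd (inv 𝒮[H])) = T H Hd := by
  rw [T, ← eval_dualE]
  rfl

lemma eval_bicrossed (M : Model C) {A B : Ob} (E : ExprData A) (F : ExprData B)
    (f : Expr (.tensor B A) A) (g : Expr (.tensor B A) B) :
    (E.bicrossed F f g).eval M = (E.eval M).bicrossed (F.eval M) (f.eval M) (g.eval M) := by
  simp only [HopfData.bicrossed, monoidalComp, MonoidalCoherence.refl_iso,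
    MonoidalCoherence.assoc_iso, MonoidalCoherence.assoc'_iso, MonoidalCoherence.whiskerLeft_iso,
    MonoidalCoherence.whiskerRight_iso, Iso.trans_hom, Iso.refl_hom, Iso.symm_hom,
    whiskerLeftIso_hom, whiskerRightIso_hom, Category.id_comp, Category.comp_id, Category.assoc,
    id_whiskerRight]
  rfl

lemma eval_dE : dE.eval (hopfModel H Hd (inv 𝒮[H])) = D H Hd := by
  rw [D, ← eval_dualE, ← eval_leftE, ← eval_rightE]
  exact eval_bicrossed _ _ _ _ _

/-- As f₁(x)f₂(y) = f(yx), the exchange is f(S⁻¹(h₅)h₃S⁻¹(h₂) - h₁) ⊗ h₄, and h₃S⁻¹(h₂) cancels. -/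
lemma eval_doubleExchangeE : doubleExchangeE.eval (hopfModel H Hd (inv 𝒮[H])) =
    (dualE.exchange hopfE leftE rightE).eval (hopfModel H Hd (inv 𝒮[H])) :=
  eval_eq_of_check (WordLaw.valid H Hd) [normalize] [normalize] (by decide +kernel)

lemma eval_doubleE : doubleE.eval (hopfModel H Hd (inv 𝒮[H])) = D H Hd := by
  rw [← eval_dE]
  have e := eval_doubleExchangeE H Hd
  refine congrArg₂ (fun m a => HopfData.mk _ m _ _ a) ?_ ?_
  · exact congrArg (fun f => (α_ _ _ _).hom ≫ Hd ◁ (α_ _ _ _).inv ≫ Hd ◁ (f ▷ H) ≫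
      Hd ◁ (α_ _ _ _).hom ≫ (α_ _ _ _).inv ≫ (dualE.mul.eval (hopfModel H Hd (inv 𝒮[H])) ⊗ₘ μ[H])) e
  · exact congrArg (fun f => (β_ _ _).hom ≫
      (𝒮[H] ⊗ₘ dualE.ant.eval (hopfModel H Hd (inv 𝒮[H]))) ≫ f) e

lemma eval_gam (M : Model C) {A : Ob} (E E' : ExprData A) :
    (ExprData.gam E E').eval M = gam (E.eval M) (E'.eval M) := by
  simp only [gam, monoidalComp, MonoidalCoherence.refl_iso, MonoidalCoherence.assoc_iso,
    MonoidalCoherence.whiskerRight_iso, Iso.trans_hom, Iso.refl_hom, whiskerRightIso_hom,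
    Category.comp_id, id_whiskerRight]
  rfl

end

/-! ### The Hopf algebra axioms for formal structure morphisms -/

section

open WireDiagram.Expr DrinfeldBrace

/-- The laws of Hopf algebras for formal structure morphisms. -/
inductive ExprData.Law
  | mulAssoc | oneMul | mulOne | comulAssoc | counitComul | comulCounit
  | mulComul | oneComul | mulCounit | oneCounit | antLeft | antRight

/-- The source of a law. -/
abbrev ExprData.Law.dom (A : Ob) : ExprData.Law → Ob
  | mulAssoc => .tensor (.tensor A A) A
  | oneMul => .tensor .unit A
  | mulOne => .tensor A .unit
  | mulComul | mulCounit => .tensor A A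
  | oneComul | oneCounit => .unit
  | _ => A

/-- The target of a law. -/
abbrev ExprData.Law.cod (A : Ob) : ExprData.Law → Ob
  | mulAssoc | oneMul | mulOne | antLeft | antRight => A
  | comulAssoc => .tensor A (.tensor A A)
  | counitComul => .tensor .unit A
  | comulCounit => .tensor A .unit
  | mulComul | oneComul => .tensor A A
  | mulCounit | oneCounit => .unit

/-- The left hand side of a law. -/
def ExprData.Law.lhs {A : Ob} (E : ExprData A) : ∀ i : Law, Expr (i.dom A) (i.cod A)
  | mulAssoc => E.mul ▷ₑ A ≫ₑ E.mul
  | oneMul => E.one ▷ₑ A ≫ₑ E.mul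
  | mulOne => A ◁ₑ E.one ≫ₑ E.mul
  | comulAssoc => E.comul ≫ₑ A ◁ₑ E.comul
  | counitComul => E.comul ≫ₑ E.counit ▷ₑ A
  | comulCounit => E.comul ≫ₑ A ◁ₑ E.counit
  | mulComul => E.mul ≫ₑ E.comul
  | oneComul => E.one ≫ₑ E.comul
  | mulCounit => E.mul ≫ₑ E.counit
  | oneCounit => E.one ≫ₑ E.counit
  | antLeft => E.comul ≫ₑ E.ant ▷ₑ A ≫ₑ E.mul
  | antRight => E.comul ≫ₑ A ◁ₑ E.ant ≫ₑ E.mul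

/-- The right hand side of a law. -/
def ExprData.Law.rhs {A : Ob} (E : ExprData A) : ∀ i : Law, Expr (i.dom A) (i.cod A)
  | mulAssoc => .assoc A A A ≫ₑ A ◁ₑ E.mul ≫ₑ E.mul
  | oneMul => .lunit A
  | mulOne => .runit A
  | comulAssoc => E.comul ≫ₑ E.comul ▷ₑ A ≫ₑ .assoc A A A
  | counitComul => .lunitInv A
  | comulCounit => .runitInv A
  | mulComul => (E.comul ⊗ₑ E.comul) ≫ₑ Expr.tensorμ A A A A ≫ₑ (E.mul ⊗ₑ E.mul)
  | oneComul => .lunitInv .unit ≫ₑ (E.one ⊗ₑ E.one)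
  | mulCounit => (E.counit ⊗ₑ E.counit) ≫ₑ .lunit .unit
  | oneCounit => .id .unit
  | antLeft => E.counit ≫ₑ E.one
  | antRight => E.counit ≫ₑ E.one

variable {C : Type u} [Category.{v} C] [MonoidalCategory C] [SymmetricCategory C]

theorem ExprData.isHopfAlgebra (M : Model C) {A : Ob} (E : ExprData A)
    (hE : ∀ i : Law, (i.lhs E).eval M = (i.rhs E).eval M) : (E.eval M).IsHopfAlgebra := by
  let mon : MonObj (A.eval M.X) :=
    { one := E.one.eval M
      mul := E.mul.eval M
      one_mul := hE .oneMul
      mul_one := hE .mulOne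
      mul_assoc := hE .mulAssoc }
  let comon : ComonObj (A.eval M.X) :=
    { counit := E.counit.eval M
      comul := E.comul.eval M
      counit_comul := hE .counitComul
      comul_counit := hE .comulCounit
      comul_assoc := hE .comulAssoc }
  let bimon : BimonObj (A.eval M.X) :=
    { mon, comon with
      mul_comul := hE .mulComul
      one_comul := hE .oneComul
      mul_counit := hE .mulCounit
      one_counit := hE .oneCounit }
  exact ⟨{ bimon with
    antipode := E.ant.eval M
    antipode_left := hE .antLeft
    antipode_right := hE .antRight }, rfl⟩

end

/-! ### T(H) and D(H) are Hopf algebras -/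

section

open WireDiagram.Expr DrinfeldBrace

variable {C : Type u} [Category.{v} C] [MonoidalCategory C] [SymmetricCategory C]
variable (H Hd : C) [HopfObj H] [ExactPairing Hd H] [IsIso 𝒮[H]]

theorem isHopfAlgebra_T : (T H Hd).IsHopfAlgebra := by
  have key (i : ExprData.Law) :
      checkExprs WordLaw.rule (i.lhs tE) (i.rhs tE) [normalize] [normalize] = true := by
    cases i <;> decide +kernel
  rw [← eval_tE]
  exact ExprData.isHopfAlgebra _ _ fun i => eval_eq_of_check (WordLaw.valid H Hd) _ _ (key i)

/-- Normalization of words, with cancellation of squares of antipodes. -/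
def normalizeSq : Cmd WordLaw := .simp (wordLaws [.ainvSqLeft, .ainvSqRight]) 300

set_option maxHeartbeats 2000000 in
theorem isHopfAlgebra_D : (D H Hd).IsHopfAlgebra := by
  -- In the law a₁λ(a₂) = ε(a)1 the exchange acts on a functional already composed with S⁻¹, which
  -- produces letters S⁻²(h). Hence the pass that cancels S⁻² against S⁻¹.
  have key (i : ExprData.Law) : checkExprs WordLaw.rule (i.lhs doubleE) (i.rhs doubleE)
      [normalize, normalizeSq, normalize] [normalize] = true := by
    cases i <;> decide +kernel
  rw [← eval_doubleE]
  exact ExprData.isHopfAlgebra _ _ fun i => eval_eq_of_check (WordLaw.valid H Hd) _ _ (key i)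

end

/-! ### The brace compatibility as an identity in H, and its two specializations -/

section

namespace Expr

/-- On elements, `x ⊗ h ↦ S⁻¹(h₃) x h₁ ⊗ h₂`. -/
def adj : Expr hh hh :=
  h ◁ₑ (comul ≫ₑ h ◁ₑ comul) ≫ₑ .assocInv _ _ _ ≫ₑ (mul ⊗ₑ h ◁ₑ ainv) ≫ₑ h ◁ₑ .braid h h ≫ₑ
    .assocInv _ _ _ ≫ₑ (.braid h h ≫ₑ mul) ▷ₑ h

/-- One side of the compatibility of the double with the tensor product, in terms of `H` only. -/
def starL : Expr (.tensor h hh) (.tensor hh h) :=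
  .assocInv _ _ _ ≫ₑ adj ▷ₑ h ≫ₑ .assoc _ _ _ ≫ₑ (comul ⊗ₑ mul)

/-- The other side of the compatibility of the double with the tensor product, in terms of `H`
only. -/
def starR : Expr (.tensor h hh) (.tensor hh h) :=
  (comul ⊗ₑ comul ▷ₑ h) ≫ₑ .assocInv _ _ _ ≫ₑ tensorμ h h h h ▷ₑ h ≫ₑ
    (adj ⊗ₑ (h ◁ₑ (comul ≫ₑ ant ▷ₑ h) ≫ₑ .assocInv _ _ _ ≫ₑ .braid h h ▷ₑ h ≫ₑ .assoc _ _ _ ≫ₑ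
      h ◁ₑ adj ≫ₑ .assocInv _ _ _ ≫ₑ .braid h h ▷ₑ h ≫ₑ .assoc _ _ _ ≫ₑ h ◁ₑ mul)) ▷ₑ h ≫ₑ
    tensorμ h h h h ▷ₑ h ≫ₑ .assoc _ _ _ ≫ₑ
    hh ◁ₑ (.assoc _ _ _ ≫ₑ h ◁ₑ .braid h h ≫ₑ h ◁ₑ mul ≫ₑ mul)

/-- The evaluation of one side of the compatibility at a unit and at dual bases. -/
def plug (e : Expr (.tensor (.tensor d h) (.tensor (.tensor d h) (.tensor d h))) (.tensor d h)) :
    Expr (.tensor h hh) (.tensor hh h) :=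
  h ◁ₑ (((.lunitInv _ ≫ₑ (cup ≫ₑ d ◁ₑ counit ≫ₑ .runit d) ▷ₑ h) ⊗ₑ
      (.lunitInv _ ≫ₑ (.lunitInv .unit ≫ₑ (cup ⊗ₑ cup)) ▷ₑ h ≫ₑ tensorμ d h d h ▷ₑ h ≫ₑ
        .assoc _ _ _ ≫ₑ .tensor d d ◁ₑ .braid hh h ≫ₑ .assocInv _ _ _ ≫ₑ
          (.assoc _ _ _ ≫ₑ d ◁ₑ .braid d h ≫ₑ .assocInv _ _ _ ≫ₑ
            .tensor d h ◁ₑ (.runitInv _ ≫ₑ d ◁ₑ one)) ▷ₑ hh)) ≫ₑ .assocInv _ _ _ ≫ₑ e ▷ₑ hh) ≫ₑ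
    .assocInv _ _ _ ≫ₑ (.assocInv _ _ _ ≫ₑ cap ▷ₑ h ≫ₑ .lunit h) ▷ₑ hh ≫ₑ .braid h hh

/-- The inverse construction to `plug` for the two sides of the compatibility. -/
def unplug (s : Expr (.tensor h hh) (.tensor hh h)) :
    Expr (.tensor (.tensor d h) (.tensor (.tensor d h) (.tensor d h))) (.tensor d h) :=
  .tensor d h ◁ₑ tensorμ d h d h ≫ₑ tensorμ d h (.tensor d d) hh ≫ₑ
    .lunitInv _ ≫ₑ cup ▷ₑ _ ≫ₑ .assoc _ _ _ ≫ₑ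
    d ◁ₑ (comul ▷ₑ _ ≫ₑ tensorμ h h (.tensor d (.tensor d d)) (.tensor h hh) ≫ₑ
      ((.assocInv _ _ _ ≫ₑ cap ▷ₑ .tensor d d ≫ₑ .lunit _) ⊗ₑ
        (h ◁ₑ .assocInv _ _ _ ≫ₑ .assocInv _ _ _ ≫ₑ s ▷ₑ h ≫ₑ .assoc _ _ _ ≫ₑ hh ◁ₑ mul)) ≫ₑ
        .assocInv _ _ _ ≫ₑ
        (.braid _ _ ≫ₑ tensorμ h h d d ≫ₑ (cap ⊗ₑ cap) ≫ₑ .lunit _) ▷ₑ h ≫ₑ .lunit h)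

/-- Evaluation at `x = 1`. -/
def starOne (s : Expr (.tensor h hh) (.tensor hh h)) : Expr hh (.tensor h hh) :=
  .lunitInv _ ≫ₑ one ▷ₑ hh ≫ₑ s ≫ₑ .braid hh h

/-- Evaluation at `k = 1`, with the counit on the last factor. -/
def starCounit (s : Expr (.tensor h hh) (.tensor hh h)) : Expr hh hh :=
  h ◁ₑ (.runitInv _ ≫ₑ h ◁ₑ one) ≫ₑ s ≫ₑ hh ◁ₑ counit ≫ₑ .runit hh

/-- The tensor product coalgebra structure followed by `R ⊗ R`. -/
def rrTwice : Expr hh hh := (comul ⊗ₑ comul) ≫ₑ tensorμ h h h h ≫ₑ (rr ⊗ₑ rr)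

/-- Componentwise opposite product, with the last factor unchanged. -/
def mulOpTwice : Expr (.tensor hh (.tensor hh h)) (.tensor hh h) :=
  .assocInv _ _ _ ≫ₑ
    (tensorμ h h h h ≫ₑ ((.braid h h ≫ₑ mul) ⊗ₑ (.braid h h ≫ₑ mul))) ▷ₑ h

/-- A context for `RbarIdentity` and the comultiplicativity of `R`. -/
def starOfRbar (s : Expr hh (.tensor h hh)) (t : Expr hh hh) :
    Expr (.tensor h hh) (.tensor hh h) :=
  h ◁ₑ (comul ▷ₑ h ≫ₑ .assoc _ _ _) ≫ₑ .assocInv _ _ _ ≫ₑ (t ⊗ₑ s) ≫ₑ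
    hh ◁ₑ .braid h hh ≫ₑ mulOpTwice

/-- A context for `CocommClass`. -/
def starOfCocomm (c : Expr hh hh) : Expr (.tensor h hh) (.tensor hh h) :=
  (comul ⊗ₑ (comul ≫ₑ h ◁ₑ comul) ▷ₑ h) ≫ₑ .assocInv _ _ _ ≫ₑ tensorμ h h h hh ▷ₑ h ≫ₑ
    (rr ⊗ₑ (.assocInv _ _ _ ≫ₑ c ▷ₑ h ≫ₑ .assoc _ _ _)) ▷ₑ h ≫ₑ .assocInv _ _ _ ▷ₑ h ≫ₑ
      .assoc _ _ _ ≫ₑ hh ◁ₑ (.assoc _ _ _ ≫ₑ h ◁ₑ .braid h h ≫ₑ .assocInv _ _ _ ≫ₑ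
        (((comul ≫ₑ ((rbar ≫ₑ .braid h h) ⊗ₑ ant) ≫ₑ .assoc _ _ _) ▷ₑ h ≫ₑ .assoc _ _ _ ≫ₑ
          h ◁ₑ (.assoc _ _ _ ≫ₑ h ◁ₑ .braid h h ≫ₑ h ◁ₑ mul ≫ₑ mul)) ⊗ₑ (rbar ≫ₑ .braid h h)) ≫ₑ
          tensorμ h h h h ≫ₑ hh ◁ₑ mul) ≫ₑ mulOpTwice

end Expr

open WireDiagram.Expr DrinfeldBrace

variable {C : Type u} [Category.{v} C] [MonoidalCategory C] [SymmetricCategory C]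
variable (H Hd : C) [HopfObj H] [ExactPairing Hd H] [IsIso 𝒮[H]]

/-- For a = f ⊗ h, b = g ⊗ k and c = g' ⊗ k', the functional f only multiplies from the left and k'
only from the right. So `plug` sets f and k' to units and lets g and g' run through dual bases
without loss, and `unplug` reinstates all of them. -/
lemma compat_iff_star :
    (ExprData.compatL tE doubleE).eval (hopfModel H Hd (inv 𝒮[H])) =
        (ExprData.compatR tE doubleE).eval (hopfModel H Hd (inv 𝒮[H])) ↔
      starL.eval (hopfModel H Hd (inv 𝒮[H])) = starR.eval (hopfModel H Hd (inv 𝒮[H])) := by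
  have v := WordLaw.valid H Hd
  have plug_congr {e e'} (he : e.eval (hopfModel H Hd (inv 𝒮[H])) = e'.eval _) :
      (plug e).eval (hopfModel H Hd (inv 𝒮[H])) = (plug e').eval _ := by
    simp only [plug, Expr.eval, he]
  have unplug_congr {e e'} (he : e.eval (hopfModel H Hd (inv 𝒮[H])) = e'.eval _) :
      (unplug e).eval (hopfModel H Hd (inv 𝒮[H])) = (unplug e').eval _ := by
    simp only [unplug, Expr.eval, he]
  constructor
  · intro e
    refine Eq.trans ?_ ((plug_congr e).trans ?_)
    · exact eval_eq_of_check v [normalize] [normalize] (by decide +kernel)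
    · exact eval_eq_of_check v [normalize] [normalize] (by decide +kernel)
  · intro e
    refine Eq.trans ?_ ((unplug_congr e).trans ?_)
    · exact eval_eq_of_check v [normalize] [normalize] (by decide +kernel)
    · exact eval_eq_of_check v [normalize] [normalize] (by decide +kernel)

/-- At x = 1 the element S⁻¹(h₃)h₁ ⊗ h₂ is R̄(h) with its legs exchanged, and S(h₄)h₆ ⊗ S⁻¹(h₇)h₅ is
the morphism `S` applied to the second leg of h. -/
lemma rbar_of_star
    (e : starL.eval (hopfModel H Hd (inv 𝒮[H])) = starR.eval (hopfModel H Hd (inv 𝒮[H]))) :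
    rbarL.eval (hopfModel H Hd (inv 𝒮[H])) = rbarR.eval (hopfModel H Hd (inv 𝒮[H])) := by
  have v := WordLaw.valid H Hd
  have congr : (starOne starR).eval (hopfModel H Hd (inv 𝒮[H])) = (starOne starL).eval _ := by
    simp only [starOne, Expr.eval, e]
  refine Eq.trans ?_ (congr.trans ?_)
  · exact eval_eq_of_check v [normalize] [normalize] (by decide +kernel)
  · exact eval_eq_of_check v [normalize] [normalize] (by decide +kernel)

/-- At k = 1 the counit on the last leg removes h₂S(h₄)h₆, and what remains is R(x₁ ⊗ h₁) ⊗ R(x₂ ⊗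
h₂). -/
lemma rr_comul_of_star
    (e : starL.eval (hopfModel H Hd (inv 𝒮[H])) = starR.eval (hopfModel H Hd (inv 𝒮[H]))) :
    (rr ≫ₑ comul).eval (hopfModel H Hd (inv 𝒮[H])) = rrTwice.eval (hopfModel H Hd (inv 𝒮[H])) := by
  have v := WordLaw.valid H Hd
  have congr : (starCounit starL).eval (hopfModel H Hd (inv 𝒮[H])) = (starCounit starR).eval _ := by
    simp only [starCounit, Expr.eval, e]
  refine Eq.trans ?_ (congr.trans ?_)
  · exact eval_eq_of_check v [normalize] [normalize] (by decide +kernel)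
  · exact eval_eq_of_check v [normalize] [normalize] (by decide +kernel)

/-- Since h₃S⁻¹(h₂) cancels, S⁻¹(h₃)xh₁ ⊗ h₂ equals S⁻¹(h₅)h₃ · S⁻¹(h₂)xh₁ ⊗ h₄, which involves only
R̄ and R. Applying the coproduct to the first leg and expanding both factors leaves R(x₂ ⊗ -)
standing between R(x₁ ⊗ -) and the letters that should cancel against it. The class condition moves
R(x₂ ⊗ -) past them, and then the analogous cancellation happens in both tensor factors. -/
lemma star_of_rbar
    (c : cocommL.eval (hopfModel H Hd (inv 𝒮[H])) = cocommR.eval (hopfModel H Hd (inv 𝒮[H])))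
    (e : rbarL.eval (hopfModel H Hd (inv 𝒮[H])) = rbarR.eval (hopfModel H Hd (inv 𝒮[H])))
    (k : (rr ≫ₑ comul).eval (hopfModel H Hd (inv 𝒮[H])) =
      rrTwice.eval (hopfModel H Hd (inv 𝒮[H]))) :
    starL.eval (hopfModel H Hd (inv 𝒮[H])) = starR.eval (hopfModel H Hd (inv 𝒮[H])) := by
  have v := WordLaw.valid H Hd
  have congr : (starOfRbar rbarR (rr ≫ₑ comul)).eval (hopfModel H Hd (inv 𝒮[H])) =
      (starOfRbar rbarL rrTwice).eval _ := by
    simp only [Expr.eval] at k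
    simp only [starOfRbar, Expr.eval, e, k]
  have congr' : (starOfCocomm cocommR).eval (hopfModel H Hd (inv 𝒮[H])) =
      (starOfCocomm cocommL).eval _ := by
    simp only [starOfCocomm, Expr.eval, c]
  -- The three remaining equalities hold in every Hopf algebra with bijective antipode; all
  -- hypotheses have entered through `congr` and `congr'`.
  refine Eq.trans ?_ (congr.trans (Eq.trans ?_ (congr'.trans ?_)))
  · exact eval_eq_of_check v [normalize] [normalize] (by decide +kernel)
  · exact eval_eq_of_check v [normalize] [normalize] (by decide +kernel)
  · exact eval_eq_of_check v [normalize] [normalize] (by decide +kernel)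

end

/-! ### The equivalence -/

section

open WireDiagram.Expr DrinfeldBrace

variable {C : Type u} [Category.{v} C] [MonoidalCategory C] [SymmetricCategory C]
variable (H Hd : C) [HopfObj H] [ExactPairing Hd H] [IsIso 𝒮[H]]

/-- Compatibility with the counits is automatic, because ε is multiplicative and ε ∘ S⁻¹ = ε. -/
lemma isComonHom_R_iff : IsComonHom (R H) ↔
    (rr ≫ₑ comul).eval (hopfModel H Hd (inv 𝒮[H])) =
      rrTwice.eval (hopfModel H Hd (inv 𝒮[H])) := by
  have key : (rr ≫ₑ counit).eval (hopfModel H Hd (inv 𝒮[H])) =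
      ((counit ⊗ₑ counit) ≫ₑ .lunit .unit).eval (hopfModel H Hd (inv 𝒮[H])) :=
    eval_eq_of_check (WordLaw.valid H Hd) [normalize] [normalize] (by decide +kernel)
  have l : (rr ≫ₑ comul).eval (hopfModel H Hd (inv 𝒮[H])) = R H ≫ Δ[H] := by
    rw [← eval_rr H Hd]
  have r : rrTwice.eval (hopfModel H Hd (inv 𝒮[H])) = Δ[H ⊗ H] ≫ (R H ⊗ₘ R H) := by
    rw [← eval_rr H Hd, Comon.tensorObj_comul, Category.assoc]; rfl
  rw [l, r]
  refine ⟨fun h => h.hom_comul, fun h => ⟨?_, h⟩⟩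
  rw [← eval_rr H Hd]
  exact key

theorem isHopfBrace_iff (hc : CocommClass H) :
    IsHopfBrace (T H Hd) (D H Hd) ↔ IsComonHom (R H) ∧ RbarIdentity H := by
  have compat : IsHopfBrace (T H Hd) (D H Hd) ↔
      (ExprData.compatL tE doubleE).eval (hopfModel H Hd (inv 𝒮[H])) =
        (ExprData.compatR tE doubleE).eval (hopfModel H Hd (inv 𝒮[H])) := by
    have l : (ExprData.compatL tE doubleE).eval (hopfModel H Hd (inv 𝒮[H])) =
        (Hd ⊗ H) ◁ (T H Hd).mul ≫ (D H Hd).mul := by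
      rw [← eval_tE, ← eval_doubleE]; rfl
    have r : (ExprData.compatR tE doubleE).eval (hopfModel H Hd (inv 𝒮[H])) =
        (T H Hd).comul ▷ ((Hd ⊗ H) ⊗ (Hd ⊗ H)) ≫ tensorμ _ _ _ _ ≫
          ((D H Hd).mul ⊗ₘ gam (T H Hd) (D H Hd)) ≫ (T H Hd).mul := by
      rw [← eval_tE, ← eval_doubleE, ← eval_gam]; rfl
    rw [l, r]
    -- The equalities of counits and coproducts hold by definition, as the double takes both from
    -- the tensor product.
    exact ⟨fun h => h.compat,
      fun h => ⟨rfl, rfl, isHopfAlgebra_T H Hd, isHopfAlgebra_D H Hd, h⟩⟩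
  have c := (cocommClass_iff H Hd).1 hc
  rw [compat, compat_iff_star, isComonHom_R_iff H Hd, rbarIdentity_iff H Hd]
  exact ⟨fun e => ⟨rr_comul_of_star H Hd e, rbar_of_star H Hd e⟩,
    fun e => star_of_rbar H Hd c e.2 e.1⟩

end

/-! ### Normalization of words without the inverse of the antipode -/

section

open WireDiagram.Expr

/-- The forms of the antipode axiom without inverses: `S(x₁) x₂`, `x₁ S(x₂)`, `S²(x₂) S(x₁)`,
`S(x₂) S²(x₁)`. -/
inductive AntCancel
  | left | right | sqLeft | sqRight

/-- The morphism between the coproduct and the product in a form of the antipode axiom. -/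
def AntCancel.mid : AntCancel → Expr hh hh
  | left => ant ▷ₑ h
  | right => h ◁ₑ ant
  | sqLeft => .braid h h ≫ₑ ((ant ≫ₑ ant) ⊗ₑ ant)
  | sqRight => .braid h h ≫ₑ (ant ⊗ₑ (ant ≫ₑ ant))

/-- The rules for the normalization of words in Hopf algebras. -/
inductive AntLaw
  | hopf (i : HopfLaw)
  | cancel (c : AntCancel)
  | cancelComul (c : AntCancel)
  | cancelMul (c : AntCancel)
  | cancelComulMul (c : AntCancel)

/-- The rewrite rules for the normalization of words in Hopf algebras. -/
def AntLaw.rule : AntLaw → Rule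
  | hopf i => i.rule
  | cancel c => .ofExpr (cancelLhs c.mid) (counit ≫ₑ one)
  | cancelComul c => .ofExpr (cancelComulLhs c.mid) (.lunitInv h ≫ₑ one ▷ₑ h)
  | cancelMul c => .ofExpr (cancelMulLhs c.mid) (counit ▷ₑ h ≫ₑ .lunit h)
  | cancelComulMul c => .ofExpr (cancelComulMulLhs c.mid) (.braid h h)

/-- All forms of the antipode axiom without inverses. -/
def antCancels : List AntCancel := [.left, .right, .sqLeft, .sqRight]

/-- The rules used in the normalization of words in Hopf algebras. -/
def antLaws : List AntLaw :=
  ([.zigzag, .zigzagDual, .oneMul, .mulOne, .counitComul, .comulCounit, .oneComul, .mulCounit,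
    .oneCounit, .oneAnt, .antCounit, .antComul, .mulAnt, .mulComul, .mulAssoc, .comulAssoc].map
    fun i => .hopf i) ++
  antCancels.map .cancel ++ antCancels.map .cancelMul ++ antCancels.map .cancelComul ++
    antCancels.map .cancelComulMul

/-- Normalization of words in Hopf algebras. -/
def antNormalize : Cmd AntLaw := .simp antLaws 300

section Model

variable {C : Type u} [Category.{v} C] [MonoidalCategory C] [SymmetricCategory C]

variable (H Hd : C) [HopfObj H] [ExactPairing Hd H] (T : H ⟶ H)

/-- The forms with S² are the antipode axiom transported by S, which reverses products and fixes 1.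
-/
lemma AntCancel.valid (c : AntCancel) :
    (Rule.ofExpr (cancelLhs c.mid) (counit ≫ₑ one)).Valid (hopfModel H Hd T) := by
  have v := HopfLaw.valid H Hd T
  cases c <;> refine (Rule.valid_ofExpr (by decide +kernel)).2 ?_
  · exact eval_eq_of_check v [.rw .antLeft []] [] (by decide +kernel)
  · exact eval_eq_of_check v [.rw .antRight []] [] (by decide +kernel)
  · exact eval_eq_of_check v [.rwr .mulAnt [], .rw .antRight [], .rw .oneAnt []] []
      (by decide +kernel)
  · exact eval_eq_of_check v [.rwr .mulAnt [], .rw .antLeft [], .rw .oneAnt []] []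
      (by decide +kernel)

theorem AntLaw.valid (i : AntLaw) : i.rule.Valid (hopfModel H Hd T) := by
  have v' (c : AntCancel) := adjoin_valid (HopfLaw.valid H Hd T) (AntCancel.valid H Hd T c)
  cases i with
  | hopf i => exact HopfLaw.valid H Hd T i
  | cancel c => exact AntCancel.valid H Hd T c
  | cancelComul c =>
    exact (Rule.valid_ofExpr (by cases c <;> decide +kernel)).2 (eval_eq_of_check (v' c)
      [.rwr (some .comulAssoc) [], .rw none [], .rw (some .counitComul) []] []
      (by cases c <;> decide +kernel))
  | cancelMul c =>
    exact (Rule.valid_ofExpr (by cases c <;> decide +kernel)).2 (eval_eq_of_check (v' c)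
      [.rwr (some .mulAssoc) [], .rw none [], .rw (some .oneMul) []] []
      (by cases c <;> decide +kernel))
  | cancelComulMul c =>
    exact (Rule.valid_ofExpr (by cases c <;> decide +kernel)).2 (eval_eq_of_check (v' c)
      [.rwr (some .comulAssoc) [], .rwr (some .mulAssoc) [], .rw none [],
        .rw (some .oneMul) [], .rw (some .counitComul) []] []
      (by cases c <;> decide +kernel))

end Model

end

/-! ### Integrals and the bijectivity of the antipode -/

section

namespace Expr

/-- The partial trace. -/
def tr {A B : Ob} (F : Expr (.tensor h A) (.tensor h B)) : Expr A B :=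
  .lunitInv _ ≫ₑ cup ▷ₑ A ≫ₑ .assoc _ _ _ ≫ₑ d ◁ₑ F ≫ₑ .assocInv _ _ _ ≫ₑ
    (.braid d h ≫ₑ cap) ▷ₑ B ≫ₑ .lunit _

/-- On elements, `w ⊗ x ↦ x S²(w)`. -/
def mulAntSq : Expr hh h := (ant ≫ₑ ant) ▷ₑ h ≫ₑ .braid h h ≫ₑ mul

/-- The projection to the integrals which sends `x` to the trace of
`w ↦ (x S²(w))₁ ⊗ (x S²(w))₂` with respect to the first factor. -/
def integral : Expr h h := tr (mulAntSq ≫ₑ comul)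

/-- `x₁ ⊗ π(x₂)`, with an antipode inserted. -/
def coinvariantL : Expr h hh :=
  tr (comul ▷ₑ h ≫ₑ .assoc _ _ _ ≫ₑ h ◁ₑ (mulAntSq ≫ₑ comul ≫ₑ h ◁ₑ comul) ≫ₑ .assocInv _ _ _ ≫ₑ
    (ant ▷ₑ h ≫ₑ .braid h h ≫ₑ mul) ▷ₑ hh ≫ₑ .assocInv _ _ _ ≫ₑ .braid h h ▷ₑ h ≫ₑ .assoc _ _ _)

/-- The result of moving the coproduct around the loop in `coinvariantL`. -/
def coinvariantR : Expr h hh :=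
  tr (mulAntSq ≫ₑ comul ≫ₑ h ◁ₑ (comul ≫ₑ comul ▷ₑ h ≫ₑ .assoc _ _ _) ≫ₑ .assocInv _ _ _ ≫ₑ
    (h ◁ₑ ant ≫ₑ mul) ▷ₑ hh ≫ₑ .assocInv _ _ _ ≫ₑ .braid h h ▷ₑ h ≫ₑ .assoc _ _ _)

/-- On elements, `w ⊗ x ⊗ h ↦ (x S²(w) S(h₁))₁ ⊗ h₂ ⊗ (x S²(w) S(h₁))₂`. -/
def invariantAux : Expr (.tensor h hh) (.tensor h hh) :=
  .assocInv _ _ _ ≫ₑ (mulAntSq ⊗ₑ comul) ≫ₑ .assocInv _ _ _ ≫ₑ (h ◁ₑ ant ≫ₑ mul ≫ₑ comul) ▷ₑ h ≫ₑ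
    .assoc _ _ _ ≫ₑ h ◁ₑ .braid h h

/-- `π(x) S(h)`. -/
def invariantL : Expr hh h := tr (invariantAux ≫ₑ .assocInv _ _ _ ≫ₑ mul ▷ₑ h)

/-- The result of moving the product around the loop in `invariantL`. -/
def invariantR : Expr hh h :=
  tr (h ◁ₑ (h ◁ₑ comul ≫ₑ .assocInv _ _ _ ≫ₑ .braid hh h) ≫ₑ .assocInv _ _ _ ≫ₑ
    (mul ▷ₑ hh ≫ₑ .assocInv _ _ _ ≫ₑ mulAntSq ▷ₑ h ≫ₑ h ◁ₑ ant ≫ₑ mul ≫ₑ comul))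

/-- The trace of `π ∘ S`. -/
def traceIntegralAnt : Expr .unit .unit := cup ≫ₑ d ◁ₑ (ant ≫ₑ integral) ≫ₑ .braid d h ≫ₑ cap

/-- On elements, `x ⊗ h ↦ π(x)₁ ⊗ π(π(x)₂ h)`. -/
def integralMul : Expr hh hh :=
  (integral ≫ₑ comul) ▷ₑ h ≫ₑ .assoc _ _ _ ≫ₑ h ◁ₑ (mul ≫ₑ integral)

/-- The trace of the composition of `S` and the second tensor factor. -/
def traceAnt (K : Expr hh hh) : Expr h h := tr (ant ▷ₑ h ≫ₑ K ≫ₑ .braid h h)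

/-- The inverse of the antipode. -/
def antipodeInv : Expr h h := traceAnt integralMul

/-- On elements, `x ⊗ h ↦ π(x)₁ ⊗ π(π(x)₂ S(h))`. -/
def integralMulAnt : Expr hh hh := h ◁ₑ ant ≫ₑ integralMul

/-- On elements, `y ⊗ h ↦ y₁ ⊗ y₂ S(h)`. -/
def mulAntL : Expr hh hh := comul ▷ₑ h ≫ₑ .assoc _ _ _ ≫ₑ h ◁ₑ (h ◁ₑ ant ≫ₑ mul)

/-- On elements, `y ⊗ h ↦ (y S(h₁))₁ h₂ ⊗ (y S(h₁))₂`. -/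
def mulAntR : Expr hh hh :=
  h ◁ₑ comul ≫ₑ .assocInv _ _ _ ≫ₑ (h ◁ₑ ant ≫ₑ mul ≫ₑ comul) ▷ₑ h ≫ₑ .assoc _ _ _ ≫ₑ
    h ◁ₑ .braid h h ≫ₑ .assocInv _ _ _ ≫ₑ mul ▷ₑ h

/-- On elements, `x ⊗ h ↦ S(π(x)₁) ⊗ π(π(x)₂ h)`. -/
def antIntegralMul : Expr hh hh := integralMul ≫ₑ ant ▷ₑ h

/-- On elements, `y ⊗ h ↦ S(y₁) (y₂ h)₁ ⊗ (y₂ h)₂`. -/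
def antMulL : Expr hh hh :=
  comul ▷ₑ h ≫ₑ .assoc _ _ _ ≫ₑ (ant ⊗ₑ (mul ≫ₑ comul)) ≫ₑ .assocInv _ _ _ ≫ₑ mul ▷ₑ h

/-- On elements, `y ⊗ h ↦ h₁ ⊗ y h₂`. -/
def antMulR : Expr hh hh :=
  h ◁ₑ comul ≫ₑ .assocInv _ _ _ ≫ₑ .braid h h ▷ₑ h ≫ₑ .assoc _ _ _ ≫ₑ h ◁ₑ mul

/-- On elements, `x ⊗ h ↦ h ⊗ π(x)`. -/
def braidIntegral : Expr hh hh := integral ▷ₑ h ≫ₑ .braid h h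

end Expr

open WireDiagram.Expr

/-- The properties of the projection to the integrals. -/
inductive IntegralLaw
  | ant (i : AntLaw)
  | comulIntegral | integralMul | integralSq

/-- The rewrite rules for the projection to the integrals. -/
def IntegralLaw.rule : IntegralLaw → Rule
  | ant i => i.rule
  | comulIntegral => .ofExpr (comul ≫ₑ h ◁ₑ integral) (.lunitInv h ≫ₑ (one ⊗ₑ integral))
  | integralMul => .ofExpr (integral ▷ₑ h ≫ₑ mul) ((integral ⊗ₑ counit) ≫ₑ .runit h)
  | integralSq => .ofExpr (integral ≫ₑ integral) integral

variable {C : Type u} [Category.{v} C] [MonoidalCategory C] [SymmetricCategory C]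
variable (H Hd : C) [HopfObj H] [ExactPairing Hd H] (T : H ⟶ H)

/-- Under the trace over w, inserting S²(w₂)S(w₁) = ε(w) shows that x₁ ⊗ π(x₂) is the trace in which
y = xS²(w₂) contributes y₁S(w₁) ⊗ y₃ and y₂ closes the loop. By cyclicity w₁ becomes a leg of y₂,
and y₁S(y₂) cancels. -/
lemma comul_integral : (comul ≫ₑ h ◁ₑ integral).eval (hopfModel H Hd T) =
    (Expr.lunitInv h ≫ₑ (one ⊗ₑ integral)).eval (hopfModel H Hd T) := by
  have v := AntLaw.valid H Hd T
  have e₁ : (comul ≫ₑ h ◁ₑ integral).eval (hopfModel H Hd T) = coinvariantL.eval _ :=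
    eval_eq_of_check v [antNormalize] [antNormalize] (by decide +kernel)
  have e₂ : coinvariantL.eval (hopfModel H Hd T) = coinvariantR.eval _ :=
    -- Cyclicity of the trace: the loop is cut anew at the wire 8, which is w₂, and straightened at
    -- the old cup, whose dual wire is 3.
    eval_eq_of_check v [.rwr (.hopf .zigzag) [(0, 8)], .rw (.hopf .zigzag) [(3, 3)]] []
      (by decide +kernel)
  rw [e₁, e₂]
  exact eval_eq_of_check v [.simp [.hopf .comulAssoc, .cancelComul .right] 10, antNormalize]
    [antNormalize] (by decide +kernel)

/-- Cyclicity of the trace turns right multiplication by h₂ at the end of the loop into w ↦ wh₂ at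
its beginning; then S²(h₂)S(h₁) cancels. -/
lemma integral_mul_ant : (integral ▷ₑ h ≫ₑ h ◁ₑ ant ≫ₑ mul).eval (hopfModel H Hd T) =
    ((integral ⊗ₑ counit) ≫ₑ .runit h).eval (hopfModel H Hd T) := by
  have v := AntLaw.valid H Hd T
  have e₁ : (integral ▷ₑ h ≫ₑ h ◁ₑ ant ≫ₑ mul).eval (hopfModel H Hd T) = invariantL.eval _ :=
    eval_eq_of_check v [antNormalize] [antNormalize] (by decide +kernel)
  have e₂ : invariantL.eval (hopfModel H Hd T) = invariantR.eval _ :=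
    eval_eq_of_check v [.rwr (.hopf .zigzag) [(0, 22)], .rw (.hopf .zigzag) [(3, 5)]] []
      (by decide +kernel)
  rw [e₁, e₂]
  exact eval_eq_of_check v [antNormalize] [antNormalize] (by decide +kernel)

/-- By the previous lemma, π(x)h = ε(h₁)π(x)h₂ = π(x)S(h₁)h₂ = ε(h)π(x). Surjectivity of S is not
needed. -/
lemma integral_mul : (integral ▷ₑ h ≫ₑ mul).eval (hopfModel H Hd T) =
    ((integral ⊗ₑ counit) ≫ₑ .runit h).eval (hopfModel H Hd T) :=
  eval_eq_of_check (adjoin_valid (AntLaw.valid H Hd T)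
      ((Rule.valid_ofExpr (by decide +kernel)).2 (integral_mul_ant H Hd T)))
    [.rwr (some (.hopf .counitComul)) [(0, 2)], .rwr none [], .rw (some (.hopf .mulAssoc)) [],
      .rw (some (.hopf .antLeft)) [], .rw (some (.hopf .mulOne)) []] [] (by decide +kernel)

/-- For a value t of π one has tS²(w) = ε(w)t, so the trace defining π(t) is ε(t₁)t₂ = t. -/
lemma integral_sq : (integral ≫ₑ integral).eval (hopfModel H Hd T) =
    integral.eval (hopfModel H Hd T) :=
  eval_eq_of_check (adjoin_valid (AntLaw.valid H Hd T)
      ((Rule.valid_ofExpr (by decide +kernel)).2 (integral_mul H Hd T)))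
    [.rw none [], .simp [some (.hopf .antCounit), some (.hopf .zigzag),
      some (.hopf .counitComul)] 10] [] (by decide +kernel)

theorem IntegralLaw.valid (i : IntegralLaw) : i.rule.Valid (hopfModel H Hd T) := by
  cases i
  · exact AntLaw.valid H Hd T _
  · exact (Rule.valid_ofExpr (by decide +kernel)).2 (comul_integral H Hd T)
  · exact (Rule.valid_ofExpr (by decide +kernel)).2 (integral_mul H Hd T)
  · exact (Rule.valid_ofExpr (by decide +kernel)).2 (integral_sq H Hd T)

/-- The expression has two loops, through v and w, both fed by the coproduct of y = S(v)S²(w).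
Cutting at y instead leaves the trace of y ↦ S(y₂)S²(y₁) = ε(y)1, which is ε(1). -/
lemma traceIntegralAnt_eq : traceIntegralAnt.eval (hopfModel H Hd T) =
    (Expr.id .unit).eval (hopfModel H Hd T) :=
  eval_eq_of_check (AntLaw.valid H Hd T) [.rwr (.hopf .zigzag) [(0, 14)],
    .rw (.hopf .zigzag) [(3, 7)], .rw (.hopf .zigzag) [(3, 1)], antNormalize] [] (by decide +kernel)

/-- For t = π(x), t₁ ⊗ t₂S(h) = (tS(h₁))₁h₂ ⊗ (tS(h₁))₂ = t₁h ⊗ t₂ because t is a right integral.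
Applying π to the second leg gives h ⊗ π(t) = h ⊗ t. -/
lemma integralMulAnt_eq :
    integralMulAnt.eval (hopfModel H Hd T) = braidIntegral.eval (hopfModel H Hd T) := by
  have e₁ : integralMulAnt.eval (hopfModel H Hd T) =
      (integral ▷ₑ h ≫ₑ mulAntL ≫ₑ h ◁ₑ integral).eval _ :=
    eval_eq_of_check (AntLaw.valid H Hd T) [] [] (by decide +kernel)
  have e₂ : mulAntL.eval (hopfModel H Hd T) = mulAntR.eval _ :=
    eval_eq_of_check (AntLaw.valid H Hd T) [antNormalize] [antNormalize] (by decide +kernel)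
  have e₃ : (integral ▷ₑ h ≫ₑ mulAntL ≫ₑ h ◁ₑ integral).eval (hopfModel H Hd T) =
      (integral ▷ₑ h ≫ₑ mulAntR ≫ₑ h ◁ₑ integral).eval _ := by
    simp only [Expr.eval, e₂]
  rw [e₁, e₃]
  exact eval_eq_of_check (IntegralLaw.valid H Hd T) [.rw .integralMul [],
    .simp [.ant (.hopf .antCounit), .ant (.hopf .counitComul)] 10, .rw .comulIntegral [],
    .rw (.ant (.hopf .oneMul)) [], .rw .integralSq []] [] (by decide +kernel)

/-- For t = π(x), the property of π under the coproduct gives S(t₁) ⊗ π(t₂h) = S(t₁)(t₂h)₁ ⊗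
π((t₂h)₂) = h₁ ⊗ π(th₂) = h ⊗ t. -/
lemma antIntegralMul_eq :
    antIntegralMul.eval (hopfModel H Hd T) = braidIntegral.eval (hopfModel H Hd T) := by
  have e₁ : antIntegralMul.eval (hopfModel H Hd T) =
      (integral ▷ₑ h ≫ₑ antMulL ≫ₑ h ◁ₑ integral).eval _ :=
    eval_eq_of_check (IntegralLaw.valid H Hd T) [] [.rw .comulIntegral [],
      .rw (.ant (.hopf .mulOne)) []] (by decide +kernel)
  have e₂ : antMulL.eval (hopfModel H Hd T) = antMulR.eval _ :=
    eval_eq_of_check (AntLaw.valid H Hd T) [antNormalize] [antNormalize] (by decide +kernel)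
  have e₃ : (integral ▷ₑ h ≫ₑ antMulL ≫ₑ h ◁ₑ integral).eval (hopfModel H Hd T) =
      (integral ▷ₑ h ≫ₑ antMulR ≫ₑ h ◁ₑ integral).eval _ := by
    simp only [Expr.eval, e₂]
  rw [e₁, e₃]
  exact eval_eq_of_check (IntegralLaw.valid H Hd T) [.rw .integralMul [],
    .rw (.ant (.hopf .comulCounit)) [], .rw .integralSq []] [] (by decide +kernel)

/-- The strand h passes through untouched and the loop splits off as the trace of π ∘ S, which is 1.
-/
lemma traceAnt_braidIntegral :
    (traceAnt braidIntegral).eval (hopfModel H Hd T) = (Expr.id h).eval (hopfModel H Hd T) :=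
  eval_eq_of_check (adjoin_valid (AntLaw.valid H Hd T)
      ((Rule.valid_ofExpr (by decide +kernel)).2 (traceIntegralAnt_eq H Hd T)))
    [.rw none []] [] (by decide +kernel)

/-- If π were x ↦ λ(x)t with λ(S(t)) = 1, `antipodeInv` would be h ↦ λ(t₂h)t₁. The two composites
with S come from `integralMulAnt` and `antIntegralMul`, both of which equal x ⊗ h ↦ h ⊗ π(x). -/
theorem isIso_antipode {C : Type u} [Category.{v} C] [MonoidalCategory C] [SymmetricCategory C]
    (H Hd : C) [HopfObj H] [ExactPairing Hd H] : IsIso 𝒮[H] := by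
  -- The interpretation of `ainv` is a dummy: neither the rules nor the expressions used here
  -- contain it.
  let M := hopfModel H Hd 𝒮[H]
  have congr {K K' : Expr hh hh} (e : K.eval M = K'.eval M) :
      (traceAnt K).eval M = (traceAnt K').eval M := by
    simp only [traceAnt, tr, Expr.eval, e]
  have e₁ : (Expr.ant ≫ₑ antipodeInv).eval M = (traceAnt integralMulAnt).eval M :=
    eval_eq_of_check (AntLaw.valid H Hd _) [] [] (by decide +kernel)
  have e₂ : (antipodeInv ≫ₑ Expr.ant).eval M = (traceAnt antIntegralMul).eval M :=
    eval_eq_of_check (AntLaw.valid H Hd _) [] [] (by decide +kernel)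
  exact ⟨antipodeInv.eval M,
    e₁.trans ((congr (integralMulAnt_eq H Hd _)).trans (traceAnt_braidIntegral H Hd _)),
    e₂.trans ((congr (antIntegralMul_eq H Hd _)).trans (traceAnt_braidIntegral H Hd _))⟩

end

end WireDiagram

theorem corollary2p12 {C : Type u} [Category.{v} C] [MonoidalCategory C] [SymmetricCategory C]
    (H Hd : C) [HopfObj H] [ExactPairing Hd H] :
    ∃ _ : IsIso 𝒮[H],
      DrinfeldBrace.CocommClass H →
        (DrinfeldBrace.IsHopfBrace (DrinfeldBrace.T H Hd) (DrinfeldBrace.D H Hd) ↔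
          IsComonHom (DrinfeldBrace.R H) ∧ DrinfeldBrace.RbarIdentity H) := by
  have := WireDiagram.isIso_antipode H Hd
  exact ⟨this, WireDiagram.isHopfBrace_iff H Hd⟩
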